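/- Let $d=3$. For $f\in L^2(\mathbb R^3)$ and a finite signed Borel measure $w$ on $\mathbb R^3$ put $\hat w(\xi)=\int_{\mathbb R^3}e^{-i\langle x,\xi\rangle}\,dw(x)$ and $m=\hat w(0)\|f\|_{L^2}^2$. Let $\int\cdot\,dW$ be the Wiener integral of a complex white noise on $\mathbb R^3$ over a probability space $(\Omega,\mathcal A,\mathbb P)$, i.e. a complex-linear isometry $L^2(\mathbb R^3)\to L^2(\Omega)$ for which $\int g\,dW$ is a centered (circular) complex Gaussian variable of variance $\|g\|_{L^2}^2$, and let $$Y(t,x)=\int_{\mathbb R^3}e^{i\langle x,\xi\rangle-it(m+|\xi|^2)}f(\xi)\,dW(\xi),\qquad S(t)=e^{-it(m-\Delta)},\qquad D(\psi)(t)=-i\int_0^tS(t-\tau)\psi(\tau)\,d\tau .$$ Let $L=L(f,w)$ be the linear operator on real-valued functions $u\in L^2_tL^2_x=L^2(\mathbb R_t;L^2(\mathbb R^3_x))$ given by $$L[u](t,x)=2\,\mathrm{Re}\,\mathbb E\big[\overline{Y(t,x)}\;D\big((w*u)Y\big)(t,x)\big],$$ where $*$ is the convolution in $x$. Proposition. There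 are absolute constants $\delta,\delta_0>0$ such that the following holds. Let $|f(\xi)|^2=\chi_{\{|\xi|\le1\}}(\xi)$ for almost every $\xi$, and let $w$ be a finite signed Borel measure on $\mathbb R^3$ such that $\hat w$ is real-valued and $$-\delta\le\hat w(\xi)\le\frac{\delta_0}{\langle\log|\xi|\rangle}\qquad\text{for all }\xi\ne0,\qquad \langle s\rangle=(1+s^2)^{1/2}.$$ Then $(1-L(f,w))^{-1}$ is a bounded operator on $L^2_tL^2_x$; that is, there is a bounded linear operator $R$ on $L^2_tL^2_x$ such that, for all $u,g\in L^2_tL^2_x$, $u-L[u]=g$ if and only if $u=Rg$. -/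

import Mathlib

open MeasureTheory ProbabilityTheory Filter Topology
open scoped FourierTransform NNReal ENNReal BoundedContinuousFunction ComplexConjugate

noncomputable section

namespace HartreeFermi

/-- The physical space `ℝ³` with its Euclidean norm. -/
abbrev R3 : Type := EuclideanSpace ℝ (Fin 3)

/-- `L²(ℝ³; F)`. -/
abbrev L2 (F : Type*) [NormedAddCommGroup F] : Type _ := Lp F 2 (volume : Measure R3)

/-- The space `L²_t L²_x` of real-valued functions of `(t, x) ∈ ℝ × ℝ³`. -/
abbrev L2tx : Type := Lp (L2 ℝ) 2 (volume : Measure ℝ)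

section Multiplication

variable {F : Type*} [NormedAddCommGroup F] [NormedSpace ℂ F]

lemma memLp_phase_smul (φ : C(R3, ℝ)) (u : L2 F) :
    MemLp (fun ξ => Complex.exp (Complex.I * (φ ξ : ℂ)) • u ξ) 2 (volume : Measure R3) := by
  refine (Lp.memLp u).of_le ?_ ?_
  · have hc : Continuous fun ξ => Complex.exp (Complex.I * (φ ξ : ℂ)) := by fun_prop
    exact hc.aestronglyMeasurable.smul (Lp.aestronglyMeasurable u)
  · filter_upwards with ξ
    rw [norm_smul, mul_comm Complex.I, Complex.norm_exp_ofReal_mul_I, one_mul]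

/-- Multiplication of `u ∈ L²(ℝ³; F)` by the unimodular function `ξ ↦ e^{i φ(ξ)}`. -/
def phaseMul (φ : C(R3, ℝ)) (u : L2 F) : L2 F := (memLp_phase_smul φ u).toLp

lemma norm_phaseMul (φ : C(R3, ℝ)) (u : L2 F) : ‖phaseMul φ u‖ = ‖u‖ := by
  rw [phaseMul, Lp.norm_toLp, Lp.norm_def]
  congr 1
  refine eLpNorm_congr_norm_ae ?_
  filter_upwards with ξ
  rw [norm_smul, mul_comm Complex.I, Complex.norm_exp_ofReal_mul_I, one_mul]

lemma memLp_smul_field (V : L2 ℝ) (Z : R3 →ᵇ F) :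
    MemLp (fun x => (V x : ℂ) • Z x) 2 (volume : Measure R3) := by
  refine (Lp.memLp V).of_le_mul (c := ‖Z‖) ?_ ?_
  · exact (Complex.continuous_ofReal.comp_aestronglyMeasurable (Lp.aestronglyMeasurable V)).smul
      Z.continuous.aestronglyMeasurable
  · filter_upwards with x
    rw [norm_smul, Complex.norm_real, mul_comm]
    exact mul_le_mul_of_nonneg_right (Z.norm_coe_le_norm x) (norm_nonneg _)

/-- The product `V Z` of a real function `V ∈ L²(ℝ³)` and a bounded continuous field
`Z : ℝ³ → F`. -/
def mulField (V : L2 ℝ) (Z : R3 →ᵇ F) : L2 F := (memLp_smul_field V Z).toLp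

end Multiplication

section FreeFlow

variable {F : Type*} [NormedAddCommGroup F] [InnerProductSpace ℂ F] [CompleteSpace F]

/-- The propagator `S(t) = e^{-it(m - Δ)}` on `L²(ℝ³; F)`, a Fourier multiplier. The Fourier
transform `𝓕` has the kernel `e^{-2πi⟨x, ξ⟩}`, so that `-Δ` has the symbol `4π²|ξ|²`. -/
def freeFlow (m t : ℝ) (u : L2 F) : L2 F :=
  𝓕⁻ (phaseMul ⟨fun ξ => -(t * (m + 4 * Real.pi ^ 2 * ‖ξ‖ ^ 2)), by fun_prop⟩ (𝓕 u))

end FreeFlow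

section Potential

/-- The Fourier transform `ŵ(ξ) = ∫ e^{-i⟨x, ξ⟩} dw(x)` of a finite signed Borel measure,
through the Jordan decomposition `w = w⁺ - w⁻`. -/
def fourierMeasure (w : SignedMeasure R3) (ξ : R3) : ℂ :=
  (∫ x, Complex.exp (-Complex.I * ((inner ℝ x ξ : ℝ) : ℂ))
      ∂w.toJordanDecomposition.posPart) -
    ∫ x, Complex.exp (-Complex.I * ((inner ℝ x ξ : ℝ) : ℂ))
      ∂w.toJordanDecomposition.negPart

/-- The translate `x ↦ u(x - y)`. -/
def translate (y : R3) (u : L2 ℝ) : L2 ℝ :=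
  Lp.compMeasurePreserving (fun x => x - y) (measurePreserving_sub_right volume y) u

/-- The convolution `w ∗ u = ∫ u(· - y) dw(y)` of a finite signed Borel measure and a function
`u ∈ L²(ℝ³)`, as an `L²`-valued Bochner integral. -/
def conv (w : SignedMeasure R3) (u : L2 ℝ) : L2 ℝ :=
  (∫ y, translate y u ∂w.toJordanDecomposition.posPart) -
    ∫ y, translate y u ∂w.toJordanDecomposition.negPart

end Potential

/-- The centered complex normal law `ℂN(0, v)` of variance `v`: the real part and the imaginary
part are independent with law `N(0, v / 2)`. -/
def complexGaussian (v : ℝ≥0) : Measure ℂ :=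
  ((gaussianReal 0 (v / 2)).prod (gaussianReal 0 (v / 2))).map
    Complex.measurableEquivRealProd.symm

/-- The Wiener integral `g ↦ ∫ g(ξ) dW(ξ)` of a complex white noise on `ℝ³` that lives on the
probability space `(Ω, P)`: a complex-linear isometry of `L²(ℝ³)` into `L²(Ω)` for which
`∫ g dW` has the law `ℂN(0, ‖g‖²)`. -/
structure WienerIntegral {Ω : Type*} [MeasurableSpace Ω] (P : Measure Ω) where
  toIsometry : L2 ℂ →ₗᵢ[ℂ] Lp ℂ 2 P
  law : ∀ g : L2 ℂ, P.map (toIsometry g) = complexGaussian (‖g‖₊ ^ 2)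

/-- The integrand `ξ ↦ e^{i⟨x, ξ⟩ - it(m + |ξ|²)} f(ξ)` of the steady state. -/
def planeWave (f : L2 ℂ) (m t : ℝ) (x : R3) : L2 ℂ :=
  phaseMul ⟨fun ξ => inner ℝ x ξ - t * (m + ‖ξ‖ ^ 2), by fun_prop⟩ f

lemma coeFn_planeWave (f : L2 ℂ) (m t : ℝ) (x : R3) :
    planeWave f m t x =ᵐ[volume] fun ξ =>
      Complex.exp (Complex.I * ((inner ℝ x ξ - t * (m + ‖ξ‖ ^ 2) : ℝ) : ℂ)) • f ξ :=
  (memLp_phase_smul ⟨fun ξ => inner ℝ x ξ - t * (m + ‖ξ‖ ^ 2), by fun_prop⟩ f).coeFn_toLp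

lemma norm_planeWave (f : L2 ℂ) (m t : ℝ) (x : R3) : ‖planeWave f m t x‖ = ‖f‖ :=
  norm_phaseMul _ f

lemma continuous_inner_planeWave (f g : L2 ℂ) (m t : ℝ) :
    Continuous fun x => inner ℂ g (planeWave f m t x) := by
  have h : (fun x => inner ℂ g (planeWave f m t x)) =
      fun x => ∫ ξ, inner ℂ (g ξ) (Complex.exp (Complex.I *
        ((inner ℝ x ξ - t * (m + ‖ξ‖ ^ 2) : ℝ) : ℂ)) • f ξ) := by
    funext x
    rw [L2.inner_def]
    refine integral_congr_ae ?_
    filter_upwards [coeFn_planeWave f m t x] with ξ hξ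
    rw [hξ]
  rw [h]
  refine continuous_of_dominated (bound := fun ξ => ‖g ξ‖ * ‖f ξ‖)
    (fun x => ?_) (fun x => ?_) ?_ ?_
  · exact ((Lp.aestronglyMeasurable g).inner (𝕜 := ℂ)
      (Lp.aestronglyMeasurable (planeWave f m t x))).congr
        ((coeFn_planeWave f m t x).mono fun ξ hξ => by simp only [hξ])
  · filter_upwards with ξ
    refine (norm_inner_le_norm _ _).trans (le_of_eq ?_)
    rw [norm_smul, mul_comm Complex.I, Complex.norm_exp_ofReal_mul_I, one_mul]
  · exact (Lp.memLp g).norm.integrable_mul (Lp.memLp f).norm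
  · filter_upwards with ξ
    have hc : Continuous fun x : R3 => Complex.exp (Complex.I *
        ((inner ℝ x ξ - t * (m + ‖ξ‖ ^ 2) : ℝ) : ℂ)) • f ξ := by fun_prop
    exact continuous_const.inner hc

lemma continuous_planeWave (f : L2 ℂ) (m t : ℝ) : Continuous (planeWave f m t) := by
  rw [continuous_iff_continuousAt]
  intro x₀
  rw [ContinuousAt, tendsto_iff_norm_sub_tendsto_zero]
  have h : ∀ x, ‖planeWave f m t x - planeWave f m t x₀‖ ^ 2 =
      2 * ‖f‖ ^ 2 - 2 * (inner ℂ (planeWave f m t x₀) (planeWave f m t x)).re := by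
    intro x
    rw [norm_sub_rev, @norm_sub_sq ℂ, norm_planeWave, norm_planeWave, RCLike.re_to_complex]
    ring
  have h0 : 2 * ‖f‖ ^ 2 -
      2 * (inner ℂ (planeWave f m t x₀) (planeWave f m t x₀)).re = 0 := by
    rw [← h x₀, sub_self, norm_zero, zero_pow two_ne_zero]
  have hsq : Tendsto (fun x => ‖planeWave f m t x - planeWave f m t x₀‖ ^ 2) (𝓝 x₀) (𝓝 0) := by
    simp only [h]
    rw [← h0]
    exact (continuous_const.sub (continuous_const.mul (Complex.continuous_re.comp
      (continuous_inner_planeWave f (planeWave f m t x₀) m t)))).tendsto x₀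
  have := hsq.sqrt
  simpa only [Real.sqrt_sq (norm_nonneg _), Real.sqrt_zero] using this

section LinearResponse

variable {Ω : Type*} [MeasurableSpace Ω] {P : Measure Ω}

/-- The steady state `Y_f(t, x) = ∫ e^{i⟨x, ξ⟩ - it(m + |ξ|²)} f(ξ) dW(ξ)` at time `t`, as a
bounded continuous function of `x` with values in `L²(Ω)`. -/
def steadyState (W : WienerIntegral P) (f : L2 ℂ) (m t : ℝ) : R3 →ᵇ Lp ℂ 2 P :=
  BoundedContinuousFunction.ofNormedAddCommGroup
    (fun x => W.toIsometry (planeWave f m t x))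
    (W.toIsometry.continuous.comp (continuous_planeWave f m t)) ‖f‖
    (fun x => by rw [LinearIsometry.norm_map, norm_planeWave])

/-- The mass `m = ŵ(0) ‖f‖²` of the steady state; `ŵ(0)` is always real. -/
def mass (f : L2 ℂ) (w : SignedMeasure R3) : ℝ := (fourierMeasure w 0).re * ‖f‖ ^ 2

/-- `D(ψ)(t) = -i ∫₀ᵗ S(t - τ) ψ(τ) dτ` for `ψ : ℝ → L²(ℝ³; L²(Ω))`. -/
def duhamel (P : Measure Ω) (m : ℝ) (ψ : ℝ → L2 (Lp ℂ 2 P)) (t : ℝ) : L2 (Lp ℂ 2 P) :=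
  -Complex.I • ∫ τ in (0 : ℝ)..t, freeFlow m (t - τ) (ψ τ)

/-- The linear response operator
`L[u](t, x) = 2 Re 𝔼[conj(Y(t, x)) · D((w ∗ u) Y)(t, x)]`, `L = L(f, w)`. -/
def linearResponse (W : WienerIntegral P) (f : L2 ℂ) (w : SignedMeasure R3)
    (u : L2tx) (t : ℝ) (x : R3) : ℝ :=
  let m := mass f w
  let ψ : ℝ → L2 (Lp ℂ 2 P) := fun τ => mulField (conv w (u τ)) (steadyState W f m τ)
  2 * (∫ ω, conj (steadyState W f m t x ω) * (duhamel P m ψ t x) ω ∂P).re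

end LinearResponse

/-- `(1 - L)⁻¹` is a bounded operator on `L²_t L²_x`, where `1 - L` has its maximal domain
`{u ∈ L²_t L²_x : L[u] ∈ L²_t L²_x}`: there is a bounded operator `R` on `L²_t L²_x` such that,
for all `u, g ∈ L²_t L²_x`, the equation `u - L[u] = g` holds if and only if `u = R g`. -/
def OneSubHasBoundedInverse (L : L2tx → ℝ → R3 → ℝ) : Prop :=
  ∃ R : L2tx →L[ℝ] L2tx, ∀ u g : L2tx,
    (∀ᵐ t : ℝ, ∀ᵐ x : R3, u t x - L u t x = g t x) ↔ u = R g

end HartreeFermi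

end

/-! In the Fourier variable, L acts at each spatial frequency as a causal convolution in time,
because the covariance of Y depends only on the differences of times and positions. If r is the
length of the frequency and |f|² is the indicator of the unit ball, the kernel is −ŵ · 2 sin(s r²)
φ(2rs), with φ = `ballKernel` the Fourier transform of the ball (`im_inner_mulField_freeFlow`,
`weightForm_conv`).

To invert 1 − L, a one-sided bound suffices: if ⟨u, Lu⟩ ≤ ‖u‖²/2, then Lax–Milgram inverts 1 − L
with norm at most 2. This is applied to the truncations of L to the windows [−n, n], which are
bounded for elementary reasons. Causality makes the inverses on different windows compatible, and
the uniform bound 2 allows them to be glued (`exists_inverse_of_causal`). No bound of L itself on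
L²_t L²_x is needed.

The Duhamel integral starts at time 0, so the form ⟨u, Lu⟩ lives on two triangles, one of positive
and one of negative times. Symmetrizing fills two squares (`IsAmplitude.integral_causal_le`), and
the required 1/2 follows once the symmetric kernel κ(|t − τ|) is at most 1 as a form at every
nonzero frequency.

This bound depends on the sign of ŵ. Where ŵ ≥ 0, Schur's test applies (`abs_pairForm_le`): the L¹
norm of the kernel is O(⟨log r⟩) by `exists_integral_abs_responseKernel_le`, which the logarithm in
the hypothesis compensates. Where ŵ ≤ 0, only an upper bound of the form of 2 sin(s r²) φ(2rs) is
needed, and it is uniform in r (`exists_formLE_responseKernel`). Indeed sin(s r²) = s r² ∫₀¹ cos(θ s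
r²) dθ reduces the claim to modulations of xφ(x) at x = 2rs. The only non-integrable part of xφ(x)
is the tail −4π cos x / x, and up to an integrable error this is minus a modulated mixture of the
positive definite kernels e^{−l|x|}. The slowly decaying part thus has the favourable sign. -/

noncomputable section

namespace HartreeFermi

/-! ### Gluing the inverses of causal truncations -/

section Causal

variable {H : Type*} [NormedAddCommGroup H] [InnerProductSpace ℝ H] [CompleteSpace H]

/-- A bounded operator whose quadratic form is at most `‖u‖² / 2` has an inverse of `1 - A`
of norm at most `2`. -/
lemma exists_inverse_of_inner_le (A : H →L[ℝ] H) (hA : ∀ u, inner ℝ u (A u) ≤ ‖u‖ ^ 2 / 2) :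
    ∃ R : H →L[ℝ] H, (∀ g, R g - A (R g) = g) ∧ (∀ u, R (u - A u) = u) ∧
      ∀ g, ‖R g‖ ≤ 2 * ‖g‖ := by
  let B : H →L[ℝ] H := ContinuousLinearMap.id ℝ H - A
  have hBapp : ∀ u, B u = u - A u := fun u => rfl
  have hBu : ∀ u, ‖u‖ ^ 2 / 2 ≤ inner ℝ (B u) u := by
    intro u
    have h1 : inner ℝ (B u) u = ‖u‖ ^ 2 - inner ℝ u (A u) := by
      rw [hBapp, inner_sub_left, real_inner_self_eq_norm_sq,
        real_inner_comm]
    rw [h1]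
    linarith [hA u]
  let Φ : H →L[ℝ] H →L[ℝ] ℝ := (innerSL ℝ).comp B
  have hΦ : ∀ u v, Φ u v = inner ℝ (B u) v := fun u v => rfl
  -- Lax–Milgram; the coercivity constant 1/2 is the source of the norm bound 2.
  have hco : IsCoercive Φ := ⟨1 / 2, by norm_num, fun u => by
    rw [hΦ]
    calc 1 / 2 * ‖u‖ * ‖u‖ = ‖u‖ ^ 2 / 2 := by ring
      _ ≤ _ := hBu u⟩
  let E : H ≃L[ℝ] H := hco.continuousLinearEquivOfBilin
  have hE : ∀ u, E u = B u := fun u => ext_inner_right ℝ fun v => by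
    rw [← hΦ]; exact hco.continuousLinearEquivOfBilin_apply u v
  refine ⟨E.symm, fun g => ?_, fun u => ?_, fun g => ?_⟩
  · rw [← hBapp, ← hE]
    exact E.apply_symm_apply g
  · rw [← hBapp, ← hE]
    exact E.symm_apply_apply u
  · set u : H := E.symm g with hu
    change ‖u‖ ≤ _
    have h1 : B u = g := by rw [← hE]; exact E.apply_symm_apply g
    have h2 := hBu u
    rw [h1] at h2
    have h3 := real_inner_le_norm g u
    rcases (norm_nonneg u).eq_or_lt with h0 | h0
    · rw [← h0]; positivity
    · nlinarith

/-- Bounded causal truncations of an operator with uniformly coercive `1 - A n` are glued to a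
bounded inverse of the full operator. -/
theorem exists_inverse_of_causal (P A : ℕ → H →L[ℝ] H)
    (hP : ∀ n m, n ≤ m → ∀ u, P n (P m u) = P n u)
    (hPs : ∀ n u v, inner ℝ (P n u) v = inner ℝ u (P n v))
    (hPt : ∀ u, Tendsto (fun n => P n u) atTop (𝓝 u))
    (hPA : ∀ n m, n ≤ m → ∀ u, P n (A m u) = A n u)
    (hAP : ∀ n u, A n (P n u) = A n u)
    (hA : ∀ n u, inner ℝ u (A n u) ≤ ‖u‖ ^ 2 / 2) :
    ∃ R : H →L[ℝ] H, ∀ u g, (∀ n, P n u - A n u = P n g) ↔ u = R g := by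
  choose R hR1 hR2 hR3 using fun n => exists_inverse_of_inner_le (A n) (hA n)
  -- Applying `P n` to the equation solved by `R m g` gives the equation on the smaller window,
  -- whose solution is unique.
  have hcomm : ∀ n m, n ≤ m → ∀ g, P n (R m g) = R n (P n g) := by
    intro n m hnm g
    rw [← hR2 n (P n (R m g)), hAP, ← hPA n m hnm, ← map_sub, hR1]
  -- Idempotent and self-adjoint, `P n` is an orthogonal projection.
  have hpyth : ∀ n x, ‖x - P n x‖ ^ 2 = ‖x‖ ^ 2 - ‖P n x‖ ^ 2 := by
    intro n x
    have : inner ℝ x (P n x) = ‖P n x‖ ^ 2 := by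
      rw [← real_inner_self_eq_norm_sq, hPs, hP n n le_rfl]
    rw [norm_sub_sq_real, this]
    ring
  have hPle : ∀ n x, ‖P n x‖ ≤ ‖x‖ := by
    intro n x
    have := hpyth n x
    refine abs_le_of_sq_le_sq' ?_ (norm_nonneg _) |>.2
    nlinarith [sq_nonneg ‖x - P n x‖]
  let T : ℕ → H →L[ℝ] H := fun n => (P n).comp (R n)
  have hT : ∀ n g, T n g = P n (R n g) := fun n g => rfl
  have hPT : ∀ n m, n ≤ m → ∀ g, P n (T m g) = T n g := by
    intro n m hnm g
    rw [hT, hP n m hnm, hcomm n m hnm, hT, hcomm n n le_rfl]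
  have hTle : ∀ n g, ‖T n g‖ ≤ 2 * ‖g‖ := fun n g => (hPle n _).trans (hR3 n g)
  have hmono : ∀ g, Monotone fun n => ‖T n g‖ ^ 2 := by
    intro g n m hnm
    have := hPle n (T m g)
    rw [hPT n m hnm] at this
    exact pow_le_pow_left₀ (norm_nonneg _) this 2
  -- The squares ‖T n g‖² increase and stay below (2‖g‖)². Since `P N (T n g) = T N g`, Pythagoras
  -- identifies their increments with ‖T n g − T N g‖², so the sequence is Cauchy.
  have hcau : ∀ g, ∃ x, Tendsto (fun n => T n g) atTop (𝓝 x) := by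
    intro g
    refine cauchySeq_tendsto_of_complete ?_
    have hb : BddAbove (Set.range fun n => ‖T n g‖ ^ 2) := by
      refine ⟨(2 * ‖g‖) ^ 2, ?_⟩
      rintro _ ⟨n, rfl⟩
      exact pow_le_pow_left₀ (norm_nonneg _) (hTle n g) 2
    have hc := (tendsto_atTop_ciSup (hmono g) hb).cauchySeq
    rw [Metric.cauchySeq_iff'] at hc ⊢
    intro ε hε
    obtain ⟨N, hN⟩ := hc (ε ^ 2) (by positivity)
    refine ⟨N, fun n hn => ?_⟩
    have h1 := hN n hn
    rw [Real.dist_eq, abs_of_nonneg (sub_nonneg.2 (hmono g hn))] at h1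
    rw [dist_eq_norm]
    have h2 := hpyth N (T n g)
    rw [hPT N n hn] at h2
    refine lt_of_pow_lt_pow_left₀ 2 hε.le ?_
    rw [h2]
    exact h1
  choose S hS using hcau
  -- The pointwise limit is bounded by Banach–Steinhaus.
  let R' : H →L[ℝ] H := continuousLinearMapOfTendsto T (f := S) (tendsto_pi_nhds.2 hS)
  have hR' : ∀ g, R' g = S g := fun g => rfl
  have hPR' : ∀ n g, P n (R' g) = T n g := by
    intro n g
    have h1 : Tendsto (fun m => P n (T m g)) atTop (𝓝 (P n (R' g))) :=
      ((P n).continuous.tendsto _).comp (hS g)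
    refine tendsto_nhds_unique h1 ?_
    refine tendsto_const_nhds.congr' ?_
    filter_upwards [eventually_ge_atTop n] with m hm
    rw [hPT n m hm]
  refine ⟨R', fun u g => ⟨fun h => ?_, fun h n => ?_⟩⟩
  · have h1 : ∀ n, P n u = P n (R' g) := by
      intro n
      rw [hPR', hT, hcomm n n le_rfl, ← h n, ← hAP n u, hR2]
    have h2 := hPt u
    simp only [h1] at h2
    exact tendsto_nhds_unique h2 (hPt _)
  · rw [h, ← hAP, hPR', hT, hAP, ← hPA n n le_rfl, ← map_sub, hR1]

end Causal

/-! ### Quadratic forms of symmetric convolution kernels in time -/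

section PairForm

/-- The quadratic form `∬ κ(|t - τ|) Re (conj b(t) b(τ)) dt dτ`. -/
def pairForm (κ : ℝ → ℝ) (b : ℝ → ℂ) : ℝ :=
  ∫ p : ℝ × ℝ, κ |p.1 - p.2| * (conj (b p.1) * b p.2).re

lemma integrable_conj_mul {b : ℝ → ℂ} (hb : Integrable b) :
    Integrable (fun p : ℝ × ℝ => conj (b p.1) * b p.2) := by
  have h : Integrable (fun t => conj (b t)) := (Complex.conjCLE.toContinuousLinearMap.integrable_comp hb)
  exact h.mul_prod hb

lemma integrable_re_conj_mul {b : ℝ → ℂ} (hb : Integrable b) :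
    Integrable (fun p : ℝ × ℝ => (conj (b p.1) * b p.2).re) :=
  (integrable_conj_mul hb).re

lemma integrable_pairForm {κ : ℝ → ℝ} (hκ : Measurable κ) {M : ℝ}
    (hM : ∀ s, 0 ≤ s → |κ s| ≤ M) {b : ℝ → ℂ} (hb : Integrable b) :
    Integrable (fun p : ℝ × ℝ => κ |p.1 - p.2| * (conj (b p.1) * b p.2).re) := by
  refine (integrable_re_conj_mul hb).bdd_mul (c := M) ?_ ?_
  · have : Measurable fun p : ℝ × ℝ => κ |p.1 - p.2| := by fun_prop
    exact this.aestronglyMeasurable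
  · filter_upwards with p
    exact hM _ (abs_nonneg _)

lemma pairForm_congr {κ κ' : ℝ → ℝ} (h : ∀ s, 0 ≤ s → κ s = κ' s) (b : ℝ → ℂ) :
    pairForm κ b = pairForm κ' b := by
  simp only [pairForm, h _ (abs_nonneg _)]

lemma pairForm_const_mul (c : ℝ) (κ : ℝ → ℝ) (b : ℝ → ℂ) :
    pairForm (fun s => c * κ s) b = c * pairForm κ b := by
  simp only [pairForm, mul_assoc, integral_const_mul]

lemma pairForm_add {κ κ' : ℝ → ℝ} (hκ : Measurable κ) (hκ' : Measurable κ') {M M' : ℝ}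
    (hM : ∀ s, 0 ≤ s → |κ s| ≤ M) (hM' : ∀ s, 0 ≤ s → |κ' s| ≤ M') {b : ℝ → ℂ}
    (hb : Integrable b) :
    pairForm (fun s => κ s + κ' s) b = pairForm κ b + pairForm κ' b := by
  simp only [pairForm, add_mul]
  exact integral_add (integrable_pairForm hκ hM hb) (integrable_pairForm hκ' hM' hb)

/-- The form of an average of kernels is the average of the forms. -/
lemma pairForm_average {κ : ℝ → ℝ → ℝ} (hκ : Measurable (Function.uncurry κ)) {M : ℝ}
    (hM : ∀ θ s, θ ∈ Set.Ioc (0 : ℝ) 1 → 0 ≤ s → |κ θ s| ≤ M) {b : ℝ → ℂ} (hb : Integrable b) :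
    pairForm (fun s => ∫ θ in Set.Ioc (0 : ℝ) 1, κ θ s) b =
      ∫ θ in Set.Ioc (0 : ℝ) 1, pairForm (κ θ) b := by
  simp only [pairForm, ← integral_mul_const]
  refine integral_integral_swap ?_
  have h1 : Integrable (fun q : (ℝ × ℝ) × ℝ => (conj (b q.1.1) * b q.1.2).re * (1 : ℝ))
      ((volume : Measure (ℝ × ℝ)).prod (volume.restrict (Set.Ioc (0 : ℝ) 1))) :=
    (integrable_re_conj_mul hb).mul_prod (integrable_const 1)
  simp only [mul_one] at h1
  refine h1.bdd_mul (c := M) ?_ ?_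
  · have : Measurable fun q : (ℝ × ℝ) × ℝ => Function.uncurry κ (q.2, |q.1.1 - q.1.2|) := by
      fun_prop
    exact this.aestronglyMeasurable
  · have h2 : ∀ᵐ q : (ℝ × ℝ) × ℝ ∂((volume : Measure (ℝ × ℝ)).prod
        (volume.restrict (Set.Ioc (0 : ℝ) 1))), q.2 ∈ Set.Ioc (0 : ℝ) 1 :=
      Measure.quasiMeasurePreserving_snd.ae (ae_restrict_mem measurableSet_Ioc)
    filter_upwards [h2] with q hq
    exact hM _ _ hq (abs_nonneg _)

lemma integrable_comp_abs {κ : ℝ → ℝ} (hκ : IntegrableOn κ (Set.Ioi 0)) :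
    Integrable fun s => κ |s| := by
  rw [← integrableOn_univ, ← Set.Iic_union_Ioi (a := (0 : ℝ))]
  refine IntegrableOn.union ?_ ?_
  · have h := (integrableOn_Ici_iff_integrableOn_Ioi (by simp)).2 hκ
    rw [← neg_zero] at h
    refine (h.comp_neg_Iic).congr_fun (fun s hs => ?_) measurableSet_Iic
    simp only [abs_of_nonpos (Set.mem_Iic.1 hs)]
  · refine hκ.congr_fun (fun s hs => ?_) measurableSet_Ioi
    simp only [abs_of_pos (Set.mem_Ioi.1 hs)]

/-- Schur's bound of the form by the `L¹` norm of the kernel. -/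
lemma abs_pairForm_le {κ : ℝ → ℝ} (hκm : Measurable κ) (hκ : IntegrableOn κ (Set.Ioi 0))
    {b : ℝ → ℂ} (hb : MemLp b 2) :
    |pairForm κ b| ≤ 2 * (∫ s in Set.Ioi 0, |κ s|) * ∫ t, ‖b t‖ ^ 2 := by
  have hK : Integrable fun s : ℝ => |κ (|s|)| := (integrable_comp_abs hκ).abs
  -- The two half-lines account for the factor 2 in the bound.
  have hKint : ∫ s : ℝ, |κ (|s|)| = 2 * ∫ s in Set.Ioi 0, |κ s| :=
    integral_comp_abs (f := fun s => |κ s|)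
  have hb2 : Integrable fun t => ‖b t‖ ^ 2 := hb.norm.integrable_sq
  have hm : AEStronglyMeasurable (fun p : ℝ × ℝ => |κ (|p.1 - p.2|)| * ‖b p.1‖ ^ 2)
      (volume.prod volume) := by
    have h1 : Measurable fun p : ℝ × ℝ => |κ (|p.1 - p.2|)| := by fun_prop
    exact h1.aestronglyMeasurable.mul (hb2.aestronglyMeasurable.comp_fst)
  have hG : Integrable (fun p : ℝ × ℝ => |κ (|p.1 - p.2|)| * ‖b p.1‖ ^ 2)
      (volume.prod volume) := by
    rw [integrable_prod_iff hm]
    refine ⟨Eventually.of_forall fun t => (hK.comp_sub_left t).mul_const (‖b t‖ ^ 2), ?_⟩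
    simp only [norm_mul, norm_abs_eq_norm, Real.norm_eq_abs, integral_mul_const]
    have : ∀ t, ∫ τ, |κ (|t - τ|)| = ∫ s : ℝ, |κ (|s|)| := fun t =>
      integral_sub_left_eq_self (fun s => |κ (|s|)|) volume t
    simp only [this]
    simpa using hb2.const_mul (∫ s : ℝ, |κ (|s|)|)
  have hGint : ∫ p : ℝ × ℝ, |κ (|p.1 - p.2|)| * ‖b p.1‖ ^ 2 =
      (∫ s : ℝ, |κ (|s|)|) * ∫ t, ‖b t‖ ^ 2 := by
    rw [Measure.volume_eq_prod, integral_prod _ hG]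
    simp only [integral_mul_const]
    have : ∀ t, ∫ τ, |κ (|t - τ|)| = ∫ s : ℝ, |κ (|s|)| := fun t =>
      integral_sub_left_eq_self (fun s => |κ (|s|)|) volume t
    simp only [this, integral_const_mul]
  have hG' : Integrable (fun p : ℝ × ℝ => |κ (|p.1 - p.2|)| * ‖b p.2‖ ^ 2)
      (volume.prod volume) := by
    refine hG.swap.congr (Eventually.of_forall fun p => ?_)
    simp only [Function.comp, Prod.fst_swap, Prod.snd_swap, abs_sub_comm p.2 p.1]
  have hGint' : ∫ p : ℝ × ℝ, |κ (|p.1 - p.2|)| * ‖b p.2‖ ^ 2 =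
      (∫ s : ℝ, |κ (|s|)|) * ∫ t, ‖b t‖ ^ 2 := by
    rw [← hGint, Measure.volume_eq_prod, ← integral_prod_swap]
    simp only [Prod.fst_swap, Prod.snd_swap]
    congr 1
    ext p
    rw [abs_sub_comm]
  -- Schur's test: |b(t) b(τ)| is split into half the sum of the squares, and each square is
  -- integrated against the kernel in the other variable.
  calc |pairForm κ b| ≤ ∫ p : ℝ × ℝ, |κ |p.1 - p.2| * (conj (b p.1) * b p.2).re| :=
        abs_integral_le_integral_abs
    _ ≤ ∫ p : ℝ × ℝ, (1 / 2 * (|κ (|p.1 - p.2|)| * ‖b p.1‖ ^ 2) +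
          1 / 2 * (|κ (|p.1 - p.2|)| * ‖b p.2‖ ^ 2)) := by
        refine integral_mono_of_nonneg (Eventually.of_forall fun p => abs_nonneg _)
          ((hG.const_mul _).add (hG'.const_mul _)) (Eventually.of_forall fun p => ?_)
        simp only [abs_mul]
        have h1 : |(conj (b p.1) * b p.2).re| ≤ ‖b p.1‖ * ‖b p.2‖ := by
          refine (Complex.abs_re_le_norm _).trans (le_of_eq ?_)
          rw [norm_mul, RCLike.norm_conj]
        have h2 : ‖b p.1‖ * ‖b p.2‖ ≤ 1 / 2 * ‖b p.1‖ ^ 2 + 1 / 2 * ‖b p.2‖ ^ 2 := by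
          nlinarith [sq_nonneg (‖b p.1‖ - ‖b p.2‖)]
        calc _ ≤ |κ (|p.1 - p.2|)| * (1 / 2 * ‖b p.1‖ ^ 2 + 1 / 2 * ‖b p.2‖ ^ 2) :=
              mul_le_mul_of_nonneg_left (h1.trans h2) (abs_nonneg _)
          _ = _ := by ring
    _ = _ := by
        rw [Measure.volume_eq_prod] at hGint hGint' ⊢
        rw [integral_add (hG.const_mul _) (hG'.const_mul _), integral_const_mul,
          integral_const_mul]
        rw [hGint, hGint', hKint]
        ring

/-- The multiple `κ(|·|)` is at most `C δ₀` as a form. -/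
def FormLE (κ : ℝ → ℝ) (C : ℝ) : Prop :=
  ∀ b : ℝ → ℂ, Integrable b → MemLp b 2 → pairForm κ b ≤ C * ∫ t, ‖b t‖ ^ 2

/-- The cosine is the mean of the characters e^{±iω(t − τ)}, and each character factors into a
modulation of b at t and one at τ. -/
lemma pairForm_cos_mul {κ : ℝ → ℝ} (hκ : Measurable κ) {M : ℝ}
    (hM : ∀ s, 0 ≤ s → |κ s| ≤ M) (ω : ℝ) {b : ℝ → ℂ} (hb : Integrable b) :
    pairForm (fun s => Real.cos (ω * s) * κ s) b =
      (pairForm κ (fun t => Complex.exp ((ω * t : ℝ) * Complex.I) * b t) +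
        pairForm κ (fun t => Complex.exp ((-ω * t : ℝ) * Complex.I) * b t)) / 2 := by
  have hb' : ∀ ω : ℝ, Integrable fun t => Complex.exp ((ω * t : ℝ) * Complex.I) * b t := by
    intro ω
    refine hb.bdd_mul (c := 1) ?_ (Eventually.of_forall fun t => ?_)
    · exact (by fun_prop : Continuous fun t : ℝ =>
        Complex.exp ((ω * t : ℝ) * Complex.I)).aestronglyMeasurable
    · rw [Complex.norm_exp_ofReal_mul_I]
  rw [pairForm, pairForm, pairForm, ← integral_add (integrable_pairForm hκ hM (hb' ω))
    (integrable_pairForm hκ hM (hb' (-ω))), ← integral_div]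
  congr 1
  ext p
  have hcos : Real.cos (ω * |p.1 - p.2|) = Real.cos (ω * p.1 - ω * p.2) := by
    rcases abs_choice (p.1 - p.2) with h | h
    · rw [h]; ring_nf
    · rw [h, ← Real.cos_neg]; ring_nf
  have hexp : ∀ ω : ℝ, conj (Complex.exp ((ω * p.1 : ℝ) * Complex.I) * b p.1) *
      (Complex.exp ((ω * p.2 : ℝ) * Complex.I) * b p.2) =
      Complex.exp ((-(ω * p.1 - ω * p.2) : ℝ) * Complex.I) * (conj (b p.1) * b p.2) := by
    intro ω
    have : ((-(ω * p.1 - ω * p.2) : ℝ) : ℂ) * Complex.I =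
      (-(ω * p.1 : ℝ) : ℂ) * Complex.I + ((ω * p.2 : ℝ) : ℂ) * Complex.I := by
        push_cast; ring
    rw [this, Complex.exp_add, map_mul, ← Complex.exp_conj, map_mul, Complex.conj_I,
      Complex.conj_ofReal, mul_neg, neg_mul]
    ring
  rw [hexp, hexp, Complex.mul_re (Complex.exp _), Complex.mul_re (Complex.exp _),
    Complex.exp_ofReal_mul_I_re, Complex.exp_ofReal_mul_I_im, Complex.exp_ofReal_mul_I_re,
    Complex.exp_ofReal_mul_I_im, hcos]
  have e1 : -(-ω * p.1 - -ω * p.2) = ω * p.1 - ω * p.2 := by ring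
  rw [e1, Real.cos_neg, Real.sin_neg]
  ring

/-- Modulations preserve |b|, so the bound holds for both terms of `pairForm_cos_mul` with the same
constant. -/
lemma FormLE.cos_mul {κ : ℝ → ℝ} (hκ : Measurable κ) {M : ℝ}
    (hM : ∀ s, 0 ≤ s → |κ s| ≤ M) {C : ℝ} (h : FormLE κ C) (ω : ℝ) :
    FormLE (fun s => Real.cos (ω * s) * κ s) C := by
  intro b hb hb2
  rw [pairForm_cos_mul hκ hM ω hb]
  have h' : ∀ ω : ℝ, pairForm κ (fun t => Complex.exp ((ω * t : ℝ) * Complex.I) * b t) ≤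
      C * ∫ t, ‖b t‖ ^ 2 := by
    intro ω
    have hc : Continuous fun t : ℝ => Complex.exp ((ω * t : ℝ) * Complex.I) := by fun_prop
    have hn : ∀ t : ℝ, ‖Complex.exp ((ω * t : ℝ) * Complex.I) * b t‖ = ‖b t‖ := fun t => by
      rw [norm_mul, Complex.norm_exp_ofReal_mul_I, one_mul]
    have := h (fun t => Complex.exp ((ω * t : ℝ) * Complex.I) * b t)
      (hb.bdd_mul (c := 1) hc.aestronglyMeasurable (Eventually.of_forall fun t => by
        rw [Complex.norm_exp_ofReal_mul_I]))
      (hb2.of_le (hc.aestronglyMeasurable.mul hb2.1) (Eventually.of_forall fun t => (hn t).le))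
    simpa only [hn] using this
  linarith [h' ω, h' (-ω)]

/-- The kernel `e^{-λ|t - τ|}` is positive definite. -/
lemma pairForm_exp_nonneg {l : ℝ} (hl : 0 < l) {b : ℝ → ℂ} (hb : Integrable b) :
    0 ≤ pairForm (fun s => Real.exp (-l * s)) b := by
  -- One-sided exponentials: ∫ g(z,t) g(z,τ) dz = e^{−l|t−τ|} / (2l), so the form equals 2l ∫ |∫
  -- g(z,t) b(t) dt|² dz.
  let g : ℝ → ℝ → ℝ := fun z t => (Set.Iic t).indicator (fun z => Real.exp (-l * (t - z))) z
  have hgm : Measurable (Function.uncurry g) := by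
    have : Function.uncurry g = Set.indicator {q : ℝ × ℝ | q.1 ≤ q.2}
        (fun q => Real.exp (-l * (q.2 - q.1))) := by
      ext q
      simp only [Function.uncurry, g, Set.indicator_apply, Set.mem_Iic, Set.mem_ofPred_eq]
    rw [this]
    exact Measurable.indicator (by fun_prop) (measurableSet_le measurable_fst measurable_snd)
  have hg0 : ∀ z t, 0 ≤ g z t := fun z t => Set.indicator_nonneg (fun _ _ => (Real.exp_pos _).le) _
  have hgg : ∀ t τ, (fun z => g z t * g z τ) = (Set.Iic (min t τ)).indicator
      (fun z => Real.exp (-l * (t + τ)) * Real.exp (2 * l * z)) := by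
    intro t τ
    ext z
    simp only [g, Set.indicator_apply, Set.mem_Iic, le_min_iff]
    by_cases h1 : z ≤ t <;> by_cases h2 : z ≤ τ <;> simp [h1, h2]
    rw [← Real.exp_add, ← Real.exp_add]
    ring_nf
  have hl2 : 0 < 2 * l := by linarith
  have hint : ∀ t τ, Integrable (fun z => g z t * g z τ) := by
    intro t τ
    rw [hgg, integrable_indicator_iff measurableSet_Iic]
    exact (integrableOn_exp_mul_Iic hl2 _).const_mul _
  have hval : ∀ t τ, ∫ z, g z t * g z τ = Real.exp (-l * |t - τ|) / (2 * l) := by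
    intro t τ
    rw [hgg, integral_indicator measurableSet_Iic, integral_const_mul,
      integral_exp_mul_Iic hl2, mul_div_assoc', ← Real.exp_add]
    congr 2
    rcases le_total t τ with h | h
    · rw [min_eq_left h, abs_of_nonpos (by linarith)]; ring
    · rw [min_eq_right h, abs_of_nonneg (by linarith)]; ring
  let F : ℝ × ℝ → ℝ → ℂ := fun p z => ((g z p.1 * g z p.2 : ℝ) : ℂ) * (conj (b p.1) * b p.2)
  have hFi : Integrable (Function.uncurry F)
      ((volume : Measure (ℝ × ℝ)).prod (volume : Measure ℝ)) := by
    have hm : AEStronglyMeasurable (Function.uncurry F)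
        ((volume : Measure (ℝ × ℝ)).prod (volume : Measure ℝ)) := by
      have h1 : Measurable fun q : (ℝ × ℝ) × ℝ => ((Function.uncurry g (q.2, q.1.1) *
          Function.uncurry g (q.2, q.1.2) : ℝ) : ℂ) := by fun_prop
      exact h1.aestronglyMeasurable.mul (integrable_conj_mul hb).aestronglyMeasurable.comp_fst
    rw [integrable_prod_iff hm]
    refine ⟨Eventually.of_forall fun p => ?_, ?_⟩
    · exact (hint p.1 p.2).ofReal.mul_const (conj (b p.1) * b p.2)
    · have h2 : ∀ p : ℝ × ℝ, ∫ z, ‖Function.uncurry F (p, z)‖ =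
          Real.exp (-l * |p.1 - p.2|) / (2 * l) * ‖conj (b p.1) * b p.2‖ := by
        intro p
        rw [← hval, ← integral_mul_const]
        congr 1
        ext z
        simp only [Function.uncurry, F]
        rw [norm_mul, Complex.norm_real, Real.norm_of_nonneg (mul_nonneg (hg0 _ _) (hg0 _ _))]
      simp only [h2]
      refine (integrable_conj_mul hb).norm.bdd_mul (c := 1 / (2 * l)) ?_ ?_
      · exact (by fun_prop : Continuous fun p : ℝ × ℝ =>
          Real.exp (-l * |p.1 - p.2|) / (2 * l)).aestronglyMeasurable
      · refine Eventually.of_forall fun p => ?_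
        rw [Real.norm_of_nonneg (by positivity)]
        gcongr
        rw [Real.exp_le_one_iff]
        nlinarith [abs_nonneg (p.1 - p.2)]
  have hA : ∀ p : ℝ × ℝ, Real.exp (-l * |p.1 - p.2|) * (conj (b p.1) * b p.2).re =
      2 * l * (∫ z, F p z).re := by
    intro p
    simp only [F]
    rw [integral_mul_const, integral_complex_ofReal, hval, Complex.re_ofReal_mul]
    field_simp
  have hB : ∀ z, ∫ p, F p z = ((‖∫ t, (g z t : ℂ) * b t‖ ^ 2 : ℝ) : ℂ) := by
    intro z
    have h3 : ∀ p : ℝ × ℝ, F p z = conj ((g z p.1 : ℂ) * b p.1) * ((g z p.2 : ℂ) * b p.2) := by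
      intro p
      simp only [F, map_mul, Complex.conj_ofReal]
      push_cast
      ring
    simp only [h3]
    rw [Measure.volume_eq_prod, integral_prod_mul (fun t => conj ((g z t : ℂ) * b t))
      (fun t => (g z t : ℂ) * b t), integral_conj, Complex.conj_mul']
    push_cast
    rfl
  have hre : ∀ {α : Type} [MeasurableSpace α] (μ : Measure α) (f : α → ℂ), Integrable f μ →
      ∫ x, (f x).re ∂μ = (∫ x, f x ∂μ).re := fun μ f hf => integral_re hf
  rw [pairForm]
  simp only [hA]
  rw [integral_const_mul, hre _ (fun p => ∫ z, F p z) hFi.integral_prod_left]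
  refine mul_nonneg hl2.le ?_
  rw [integral_integral_swap hFi]
  simp only [hB]
  rw [integral_complex_ofReal, Complex.ofReal_re]
  exact integral_nonneg fun z => sq_nonneg _

end PairForm

/-! ### Size of the response kernel -/

section Kernel

/-- The Fourier transform `σ ↦ ∫_{|ξ| ≤ 1} cos(σ ξ₀) dξ` of the unit ball, for `σ ≠ 0`. -/
def ballKernel (x : ℝ) : ℝ := 4 * Real.pi * (Real.sin x - x * Real.cos x) / x ^ 3

/-- The response kernel `2 sin(s r²) φ(2 r s)` at the frequency `r`. -/
def responseKernel (r s : ℝ) : ℝ := 2 * Real.sin (s * r ^ 2) * ballKernel (2 * r * s)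

lemma measurable_ballKernel : Measurable ballKernel := by
  unfold ballKernel
  fun_prop

lemma abs_sin_sub_le {x : ℝ} (hx : 0 ≤ x) : |Real.sin x - x| ≤ x ^ 3 / 4 := by
  rcases hx.eq_or_lt with h0 | h0
  · simp [← h0]
  have := Real.sin_gt_sub_cube h0
  rw [abs_of_nonpos (by linarith [Real.sin_le hx])]
  linarith [pow_pos h0 3]

lemma abs_sin_sub_mul_cos_le {x : ℝ} (hx : 0 ≤ x) :
    |Real.sin x - x * Real.cos x| ≤ x ^ 3 := by
  have h1 := abs_sin_sub_le hx
  have h2 := Real.one_sub_sq_div_two_le_cos (x := x)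
  have h3 := Real.cos_le_one x
  have h4 : |x - x * Real.cos x| ≤ x ^ 3 / 2 := by
    rw [abs_of_nonneg (by nlinarith)]
    nlinarith
  calc |Real.sin x - x * Real.cos x| = |(Real.sin x - x) + (x - x * Real.cos x)| := by ring_nf
    _ ≤ _ := abs_add_le _ _
    _ ≤ x ^ 3 / 4 + x ^ 3 / 2 := add_le_add h1 h4
    _ ≤ x ^ 3 := by nlinarith [pow_nonneg hx 3]

/-- Below 1 the numerator vanishes to third order; beyond 1 it is at most 1 + x ≤ 2x³. At x = 0
division by zero returns 0. -/
lemma abs_ballKernel_le (x : ℝ) (hx : 0 ≤ x) : |ballKernel x| ≤ 8 * Real.pi := by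
  have hpi := Real.pi_pos
  rcases hx.eq_or_lt with h0 | h0
  · rw [← h0, ballKernel]
    simp [hpi.le]
  have h3 : 0 < x ^ 3 := by positivity
  rw [ballKernel, abs_div, abs_mul, abs_of_pos (by positivity : 0 < 4 * Real.pi), abs_of_pos h3,
    div_le_iff₀ h3]
  rcases le_total x 1 with h1 | h1
  · nlinarith [abs_sin_sub_mul_cos_le hx]
  · have : |Real.sin x - x * Real.cos x| ≤ 2 * x ^ 3 := by
      have h5 : |Real.sin x - x * Real.cos x| ≤ 1 + x := by
        refine (abs_sub _ _).trans ?_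
        rw [abs_mul, abs_of_pos h0]
        nlinarith [Real.abs_sin_le_one x, Real.abs_cos_le_one x]
      nlinarith [one_le_pow₀ h1 (n := 2)]
    nlinarith

lemma abs_ballKernel_le_inv_sq {x : ℝ} (hx : 0 < x) : |ballKernel x| ≤ 8 * Real.pi / x ^ 2 := by
  have hpi := Real.pi_pos
  rcases le_total x 1 with h1 | h1
  · refine (abs_ballKernel_le x hx.le).trans ?_
    rw [le_div_iff₀ (by positivity)]
    have : x ^ 2 ≤ 1 := pow_le_one₀ hx.le h1
    nlinarith
  · have h5 : |Real.sin x - x * Real.cos x| ≤ 1 + x := by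
      refine (abs_sub _ _).trans ?_
      rw [abs_mul, abs_of_pos hx]
      nlinarith [Real.abs_sin_le_one x, Real.abs_cos_le_one x]
    rw [ballKernel, abs_div, abs_mul, abs_of_pos (by positivity : 0 < 4 * Real.pi),
      abs_of_pos (by positivity : 0 < x ^ 3), div_le_div_iff₀ (by positivity) (by positivity)]
    have : |Real.sin x - x * Real.cos x| ≤ 2 * x := by linarith
    calc _ ≤ 4 * Real.pi * (2 * x) * x ^ 2 := by gcongr
      _ = _ := by ring

lemma measurable_responseKernel : Measurable (Function.uncurry responseKernel) := by
  have := measurable_ballKernel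
  have : Measurable fun q : ℝ × ℝ => 2 * Real.sin (q.2 * q.1 ^ 2) * ballKernel (2 * q.1 * q.2) := by
    fun_prop
  exact this

lemma abs_responseKernel_le {r s : ℝ} (hr : 0 ≤ r) (hs : 0 ≤ s) :
    |responseKernel r s| ≤ 16 * Real.pi := by
  rw [responseKernel, abs_mul, abs_mul, abs_two]
  have h1 := Real.abs_sin_le_one (s * r ^ 2)
  have h2 := abs_ballKernel_le (2 * r * s) (by positivity)
  calc _ ≤ 2 * 1 * (8 * Real.pi) := by gcongr
    _ = _ := by ring

lemma ballKernel_neg (x : ℝ) : ballKernel (-x) = ballKernel x := by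
  rw [ballKernel, ballKernel, Real.sin_neg, Real.cos_neg, Odd.neg_pow (by decide), div_neg,
    ← neg_div]
  ring_nf

lemma responseKernel_neg (r s : ℝ) : responseKernel r (-s) = -responseKernel r s := by
  rw [responseKernel, responseKernel, mul_neg, ballKernel_neg, neg_mul, Real.sin_neg]
  ring

lemma responseKernel_zero (r : ℝ) : responseKernel r 0 = 0 := by
  simp [responseKernel]

/-- The `L¹` norm of the response kernel grows at most like `|log r|` at low frequencies. -/
lemma exists_integral_abs_responseKernel_le : ∃ C : ℝ, 0 < C ∧ ∀ r : ℝ, 0 < r →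
    IntegrableOn (responseKernel r) (Set.Ioi 0) ∧
      ∫ s in Set.Ioi 0, |responseKernel r s| ≤ C * √(1 + Real.log r ^ 2) := by
  have hpi := Real.pi_pos
  -- The constant is the sum of the contributions 16π, 4π |log r| and 4π of the three ranges of s
  -- below.
  refine ⟨24 * Real.pi, by positivity, fun r hr => ?_⟩
  have hm : Measurable (responseKernel r) := measurable_responseKernel.of_uncurry_left
  set a : ℝ := 1 / r with ha
  set b : ℝ := max (1 / r) (1 / r ^ 2) with hb
  have ha0 : 0 < a := by positivity
  have hab : a ≤ b := le_max_left _ _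
  have hb0 : 0 < b := ha0.trans_le hab
  have hsin : ∀ s, 0 < s → |Real.sin (s * r ^ 2)| ≤ s * r ^ 2 := fun s hs => by
    have := Real.abs_sin_lt_abs (x := s * r ^ 2) (by positivity)
    rw [abs_of_pos (by positivity : 0 < s * r ^ 2)] at this
    exact this.le
  have hk : ∀ s, |responseKernel r s| = 2 * |Real.sin (s * r ^ 2)| * |ballKernel (2 * r * s)| :=
    fun s => by rw [responseKernel, abs_mul, abs_mul, abs_two]
  have h1 : ∀ s ∈ Set.Ioc 0 a, |responseKernel r s| ≤ 16 * Real.pi * r := by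
    intro s hs
    rw [hk]
    have e1 : s * r ^ 2 ≤ r := by
      have : s * r ≤ 1 := by
        have := hs.2
        rw [ha, le_div_iff₀ hr] at this
        exact this
      nlinarith
    calc _ ≤ 2 * r * (8 * Real.pi) := by
          gcongr
          · exact (hsin s hs.1).trans e1
          · exact abs_ballKernel_le _ (by have := hs.1; positivity)
      _ = _ := by ring
  have h2 : ∀ s ∈ Set.Ioc a b, |responseKernel r s| ≤ 4 * Real.pi * s⁻¹ := by
    intro s hs
    have hs0 : 0 < s := ha0.trans hs.1
    rw [hk]
    calc _ ≤ 2 * (s * r ^ 2) * (8 * Real.pi / (2 * r * s) ^ 2) := by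
          gcongr
          · exact hsin s hs0
          · exact abs_ballKernel_le_inv_sq (by positivity)
      _ = _ := by field_simp; norm_num
  have h3 : ∀ s ∈ Set.Ioi b, |responseKernel r s| ≤ 4 * Real.pi / r ^ 2 * s ^ (-2 : ℝ) := by
    intro s hs
    have hs0 : 0 < s := hb0.trans hs
    rw [hk]
    calc _ ≤ 2 * 1 * (8 * Real.pi / (2 * r * s) ^ 2) := by
          gcongr
          · exact Real.abs_sin_le_one _
          · exact abs_ballKernel_le_inv_sq (by positivity)
      _ = _ := by
          rw [Real.rpow_neg hs0.le]
          norm_num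
          field_simp
          norm_num
  have i1 : IntegrableOn (fun _ : ℝ => 16 * Real.pi * r) (Set.Ioc 0 a) :=
    integrableOn_const (by simp)
  have i2 : IntegrableOn (fun s : ℝ => 4 * Real.pi * s⁻¹) (Set.Ioc a b) := by
    have : IntervalIntegrable (fun s : ℝ => s⁻¹) volume a b :=
      intervalIntegral.intervalIntegrable_inv (fun x hx => by
        rw [Set.uIcc_of_le hab] at hx; exact (ha0.trans_le hx.1).ne') continuousOn_id
    exact ((intervalIntegrable_iff_integrableOn_Ioc_of_le hab).1 this).const_mul _
  have i3 : IntegrableOn (fun s : ℝ => 4 * Real.pi / r ^ 2 * s ^ (-2 : ℝ)) (Set.Ioi b) :=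
    (integrableOn_Ioi_rpow_of_lt (by norm_num) hb0).const_mul _
  have j1 : IntegrableOn (responseKernel r) (Set.Ioc 0 a) :=
    i1.mono' hm.aestronglyMeasurable ((ae_restrict_mem measurableSet_Ioc).mono h1)
  have j2 : IntegrableOn (responseKernel r) (Set.Ioc a b) :=
    i2.mono' hm.aestronglyMeasurable ((ae_restrict_mem measurableSet_Ioc).mono h2)
  have j3 : IntegrableOn (responseKernel r) (Set.Ioi b) :=
    i3.mono' hm.aestronglyMeasurable ((ae_restrict_mem measurableSet_Ioi).mono h3)
  have hu1 : Set.Ioi (0 : ℝ) = Set.Ioc 0 b ∪ Set.Ioi b := (Set.Ioc_union_Ioi_eq_Ioi hb0.le).symm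
  have hu2 : Set.Ioc (0 : ℝ) b = Set.Ioc 0 a ∪ Set.Ioc a b :=
    (Set.Ioc_union_Ioc_eq_Ioc ha0.le hab).symm
  have j12 : IntegrableOn (responseKernel r) (Set.Ioc 0 b) := by rw [hu2]; exact j1.union j2
  refine ⟨by rw [hu1]; exact j12.union j3, ?_⟩
  rw [hu1, setIntegral_union (Set.Ioc_disjoint_Ioi le_rfl) measurableSet_Ioi j12.abs j3.abs,
    hu2, setIntegral_union (Set.Ioc_disjoint_Ioc_of_le le_rfl) measurableSet_Ioc
      j1.abs j2.abs]
  have k1 : ∫ s in Set.Ioc 0 a, |responseKernel r s| ≤ 16 * Real.pi := by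
    refine (setIntegral_mono_on j1.abs i1 measurableSet_Ioc h1).trans (le_of_eq ?_)
    rw [setIntegral_const, Real.volume_real_Ioc_of_le ha0.le, smul_eq_mul, ha]
    field_simp
    ring
  have k2 : ∫ s in Set.Ioc a b, |responseKernel r s| ≤ 4 * Real.pi * |Real.log r| := by
    refine (setIntegral_mono_on j2.abs i2 measurableSet_Ioc h2).trans ?_
    rw [integral_const_mul, ← intervalIntegral.integral_of_le hab, integral_inv_of_pos ha0 hb0]
    refine mul_le_mul_of_nonneg_left ?_ (by positivity)
    rcases le_total 1 r with h | h
    · have : b = a := max_eq_left (by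
        gcongr
        nlinarith)
      rw [this, div_self ha0.ne', Real.log_one]
      exact abs_nonneg _
    · have : b = 1 / r ^ 2 := max_eq_right (by
        gcongr
        nlinarith)
      rw [this, ha]
      have : 1 / r ^ 2 / (1 / r) = r⁻¹ := by field_simp
      rw [this, Real.log_inv]
      exact neg_le_abs _
  have k3 : ∫ s in Set.Ioi b, |responseKernel r s| ≤ 4 * Real.pi := by
    refine (setIntegral_mono_on j3.abs i3 measurableSet_Ioi h3).trans ?_
    rw [integral_const_mul, integral_Ioi_rpow_of_lt (by norm_num) hb0]
    have : -b ^ (-2 + 1 : ℝ) / (-2 + 1) = b⁻¹ := by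
      have : (-2 + 1 : ℝ) = -1 := by norm_num
      rw [this, Real.rpow_neg_one]
      norm_num
    rw [this]
    have h4 : b⁻¹ ≤ r ^ 2 := by
      rw [inv_le_comm₀ hb0 (by positivity), ← one_div]
      exact le_max_right _ _
    calc _ ≤ 4 * Real.pi / r ^ 2 * r ^ 2 := by gcongr
      _ = _ := by field_simp
  have l1 : |Real.log r| ≤ √(1 + Real.log r ^ 2) := Real.abs_le_sqrt (by linarith)
  have l2 : 1 ≤ √(1 + Real.log r ^ 2) := by
    rw [Real.one_le_sqrt]
    nlinarith [sq_nonneg (Real.log r)]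
  nlinarith

end Kernel

/-! ### One-sided form bound of the response kernel -/

section OneSided

lemma FormLE.add {κ κ' : ℝ → ℝ} (hκ : Measurable κ) (hκ' : Measurable κ') {M M' : ℝ}
    (hM : ∀ s, 0 ≤ s → |κ s| ≤ M) (hM' : ∀ s, 0 ≤ s → |κ' s| ≤ M') {C C' : ℝ}
    (h : FormLE κ C) (h' : FormLE κ' C') : FormLE (fun s => κ s + κ' s) (C + C') := by
  intro b hb hb2
  rw [pairForm_add hκ hκ' hM hM' hb, add_mul]
  exact add_le_add (h b hb hb2) (h' b hb hb2)

lemma FormLE.const_mul {κ : ℝ → ℝ} {C : ℝ} (h : FormLE κ C) {c : ℝ} (hc : 0 ≤ c) :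
    FormLE (fun s => c * κ s) (c * C) := by
  intro b hb hb2
  rw [pairForm_const_mul, mul_assoc]
  exact mul_le_mul_of_nonneg_left (h b hb hb2) hc

lemma FormLE.congr {κ κ' : ℝ → ℝ} {C : ℝ} (h : FormLE κ C) (hκ : ∀ s, 0 ≤ s → κ' s = κ s) :
    FormLE κ' C := by
  intro b hb hb2
  rw [pairForm_congr hκ]
  exact h b hb hb2

lemma FormLE.average {κ : ℝ → ℝ → ℝ} (hκ : Measurable (Function.uncurry κ)) {M : ℝ}
    (hM : ∀ θ s, θ ∈ Set.Ioc (0 : ℝ) 1 → 0 ≤ s → |κ θ s| ≤ M) {C : ℝ}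
    (h : ∀ θ ∈ Set.Ioc (0 : ℝ) 1, FormLE (κ θ) C) (hC : 0 ≤ C) :
    FormLE (fun s => ∫ θ in Set.Ioc (0 : ℝ) 1, κ θ s) C := by
  intro b hb hb2
  rw [pairForm_average hκ hM hb]
  set D := C * ∫ t, ‖b t‖ ^ 2 with hD
  have hD0 : 0 ≤ D := mul_nonneg hC (integral_nonneg fun t => sq_nonneg _)
  -- If the forms are not integrable in θ their integral is 0 by convention, and 0 ≤ C covers this
  -- case.
  by_cases hi : IntegrableOn (fun θ => pairForm (κ θ) b) (Set.Ioc 0 1)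
  · calc _ ≤ ∫ θ in Set.Ioc (0 : ℝ) 1, D :=
          setIntegral_mono_on hi (integrableOn_const (by simp)) measurableSet_Ioc
            fun θ hθ => h θ hθ b hb hb2
      _ = D := by simp
  · rw [integral_undef hi]
    exact hD0

lemma formLE_of_integrableOn {κ : ℝ → ℝ} (hκm : Measurable κ)
    (hκ : IntegrableOn κ (Set.Ioi 0)) : FormLE κ (2 * ∫ s in Set.Ioi 0, |κ s|) :=
  fun _ _ hb2 => (le_abs_self _).trans (abs_pairForm_le hκm hκ hb2)

/-- The regularization `(1 - e^{-x}) / x` of `1 / x`, a mixture of exponentials. -/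
def expAverage (x : ℝ) : ℝ := ∫ l in Set.Ioc (0 : ℝ) 1, Real.exp (-l * x)

lemma measurable_expAverage : Measurable expAverage := by
  have h : Continuous (Function.uncurry fun x l : ℝ => Real.exp (-l * x)) := by fun_prop
  exact h.stronglyMeasurable.integral_prod_right.measurable

lemma abs_expAverage_le {x : ℝ} (hx : 0 ≤ x) : |expAverage x| ≤ 1 := by
  have := norm_setIntegral_le_of_norm_le_const (μ := volume) (s := Set.Ioc (0 : ℝ) 1) (C := 1)
    (f := fun l => Real.exp (-l * x)) (by simp) (fun l hl => by
      rw [Real.norm_of_nonneg (Real.exp_pos _).le, Real.exp_le_one_iff]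
      nlinarith [hl.1])
  simpa [expAverage] using this

lemma expAverage_eq {x : ℝ} (hx : 0 < x) : expAverage x = (1 - Real.exp (-x)) / x := by
  rw [expAverage, ← intervalIntegral.integral_of_le zero_le_one]
  have h : ∀ l ∈ Set.uIcc (0 : ℝ) 1,
      HasDerivAt (fun l => -Real.exp (-l * x) / x) (Real.exp (-l * x)) l := by
    intro l _
    have h1 : HasDerivAt (fun l : ℝ => -l * x) (-1 * x) l := (hasDerivAt_neg l).mul_const x
    have h2 := (h1.exp.neg).div_const x
    convert! h2 using 1
    field_simp
  rw [intervalIntegral.integral_eq_sub_of_hasDerivAt h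
    ((by fun_prop : Continuous fun l : ℝ => Real.exp (-l * x)).intervalIntegrable _ _)]
  simp
  ring

/-- `expAverage` averages the positive definite kernels e^{−lx} over l in (0, 1], so its negative is
a nonpositive form; modulation by the cosine keeps the bound 0. -/
lemma formLE_neg_cos_mul_expAverage {μ : ℝ} (hμ : 0 < μ) (ω : ℝ) :
    FormLE (fun s => Real.cos (ω * s) * (-1 * expAverage (μ * s))) 0 := by
  have h0 : FormLE (fun s => -1 * expAverage (μ * s)) 0 := by
    intro b hb hb2
    have he : ∀ θ s, θ ∈ Set.Ioc (0 : ℝ) 1 → 0 ≤ s → |Real.exp (-θ * (μ * s))| ≤ 1 := by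
      intro θ s hθ hs
      rw [abs_of_pos (Real.exp_pos _), Real.exp_le_one_iff]
      have := hθ.1.le
      have : 0 ≤ θ * (μ * s) := by positivity
      linarith
    have h1 := pairForm_average (κ := fun θ s => Real.exp (-θ * (μ * s))) (by
      exact (by fun_prop : Continuous fun q : ℝ × ℝ =>
        Real.exp (-q.1 * (μ * q.2))).measurable) he hb
    rw [pairForm_const_mul, zero_mul]
    simp only [expAverage]
    rw [h1]
    have : 0 ≤ ∫ θ in Set.Ioc (0 : ℝ) 1, pairForm (fun s => Real.exp (-θ * (μ * s))) b := by
      refine setIntegral_nonneg measurableSet_Ioc fun θ hθ => ?_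
      have := pairForm_exp_nonneg (mul_pos hθ.1 hμ) hb
      simpa only [neg_mul, mul_assoc] using this
    linarith
  refine FormLE.cos_mul (M := 1) ?_ ?_ h0 ω
  · have := measurable_expAverage
    fun_prop
  · intro s hs
    rw [neg_one_mul, abs_neg]
    exact abs_expAverage_le (by positivity)

/-- The integrable part of the kernel `x φ(x)`. -/
def kernelRemainder (x : ℝ) : ℝ :=
  x * ballKernel x + 4 * Real.pi * (Real.cos x * expAverage x)

lemma measurable_kernelRemainder : Measurable kernelRemainder := by
  have := measurable_ballKernel
  have := measurable_expAverage
  unfold kernelRemainder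
  fun_prop

/-- The tail −4π cos x / x of xφ(x) cancels against 4π cos x (1 − e^{−x}) / x. What is left is 4π
sin x / x² and a term with the factor e^{−x}. -/
lemma abs_kernelRemainder_le_inv_sq {x : ℝ} (hx : 1 ≤ x) :
    |kernelRemainder x| ≤ 8 * Real.pi / x ^ 2 := by
  have hpi := Real.pi_pos
  have hx0 : 0 < x := by linarith
  have h1 : kernelRemainder x =
      4 * Real.pi * (Real.sin x - Real.cos x * (x * Real.exp (-x))) / x ^ 2 := by
    rw [kernelRemainder, expAverage_eq hx0, ballKernel]
    field_simp
    ring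
  have h2 : x * Real.exp (-x) ≤ 1 := by
    rw [Real.exp_neg, ← div_eq_mul_inv, div_le_one (Real.exp_pos _)]
    linarith [Real.add_one_le_exp x]
  have h3 : |Real.sin x - Real.cos x * (x * Real.exp (-x))| ≤ 2 := by
    refine (abs_sub _ _).trans ?_
    rw [abs_mul, abs_of_pos (by positivity : 0 < x * Real.exp (-x))]
    have := mul_le_mul (Real.abs_cos_le_one x) h2 (by positivity) zero_le_one
    linarith [Real.abs_sin_le_one x]
  rw [h1, abs_div, abs_mul, abs_of_pos (by positivity : 0 < 4 * Real.pi),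
    abs_of_pos (by positivity : 0 < x ^ 2)]
  refine div_le_div_of_nonneg_right ?_ (by positivity)
  linarith [mul_le_mul_of_nonneg_left h3 (by positivity : 0 ≤ 4 * Real.pi)]

lemma abs_kernelRemainder_le {x : ℝ} (hx : 0 ≤ x) : |kernelRemainder x| ≤ 12 * Real.pi := by
  have hpi := Real.pi_pos
  rcases le_total x 1 with h1 | h1
  · have e1 : |x * ballKernel x| ≤ 8 * Real.pi := by
      rw [abs_mul, abs_of_nonneg hx]
      nlinarith [abs_ballKernel_le x hx, abs_nonneg (ballKernel x)]
    have e2 : |4 * Real.pi * (Real.cos x * expAverage x)| ≤ 4 * Real.pi := by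
      rw [abs_mul (4 * Real.pi), abs_mul (Real.cos x), abs_of_pos (by positivity : 0 < 4 * Real.pi)]
      have := mul_le_mul (Real.abs_cos_le_one x) (abs_expAverage_le hx) (abs_nonneg _) zero_le_one
      nlinarith
    exact (abs_add_le _ _).trans (by linarith)
  · refine (abs_kernelRemainder_le_inv_sq h1).trans ?_
    rw [div_le_iff₀ (by positivity)]
    nlinarith [one_le_pow₀ h1 (n := 2)]

lemma integrableOn_kernelRemainder : IntegrableOn kernelRemainder (Set.Ioi 0) := by
  have hm := measurable_kernelRemainder.aestronglyMeasurable (μ := volume)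
  rw [← Set.Ioc_union_Ioi_eq_Ioi zero_le_one]
  refine IntegrableOn.union ?_ ?_
  · exact (integrableOn_const (μ := volume) (C := 12 * Real.pi) (by simp)).mono' hm.restrict
      ((ae_restrict_mem measurableSet_Ioc).mono fun x hx => abs_kernelRemainder_le hx.1.le)
  · refine ((integrableOn_Ioi_rpow_of_lt (a := -2) (by norm_num) zero_lt_one).const_mul
      (8 * Real.pi)).mono' hm.restrict ((ae_restrict_mem measurableSet_Ioi).mono fun x hx => ?_)
    have hx : 1 < x := hx
    refine (abs_kernelRemainder_le_inv_sq hx.le).trans (le_of_eq ?_)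
    rw [Real.rpow_neg (by linarith), div_eq_mul_inv]
    norm_num

/-- The modulated kernels `cos(ω s) (μ s) φ(μ s)` are bounded above as forms, with a bound that
does not depend on the modulation. -/
lemma formLE_cos_mul_ballKernel {μ : ℝ} (hμ : 0 < μ) (ω : ℝ) :
    FormLE (fun s => Real.cos (ω * s) * (μ * s * ballKernel (μ * s)))
      (2 / μ * ∫ x in Set.Ioi 0, |kernelRemainder x|) := by
  have hpi := Real.pi_pos
  have hEm : Measurable fun s : ℝ => expAverage (μ * s) := by
    have := measurable_expAverage
    fun_prop
  have hRm : Measurable fun s : ℝ => kernelRemainder (μ * s) := by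
    have := measurable_kernelRemainder
    fun_prop
  -- The kernel splits as −4π cos(μs) `expAverage` (μs) plus the remainder: the first part is
  -- nonpositive as a form, the second costs its L¹ norm, which the dilation scales by 1/μ.
  have h1 : FormLE (fun s => 4 * Real.pi * (Real.cos (μ * s) * (-1 * expAverage (μ * s)))) 0 := by
    have := (formLE_neg_cos_mul_expAverage hμ μ).const_mul (by positivity : 0 ≤ 4 * Real.pi)
    rwa [mul_zero] at this
  have h2 : FormLE (fun s => kernelRemainder (μ * s))
      (2 / μ * ∫ x in Set.Ioi 0, |kernelRemainder x|) := by
    have hi : IntegrableOn (fun s => kernelRemainder (μ * s)) (Set.Ioi 0) := by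
      rw [integrableOn_Ioi_comp_mul_left_iff _ _ hμ, mul_zero]
      exact integrableOn_kernelRemainder
    have := formLE_of_integrableOn hRm hi
    rw [integral_comp_mul_left_Ioi (fun x => |kernelRemainder x|) 0 hμ, mul_zero,
      smul_eq_mul] at this
    convert this using 1
    field_simp
  have hEb : ∀ s, 0 ≤ s →
      |4 * Real.pi * (Real.cos (μ * s) * (-1 * expAverage (μ * s)))| ≤ 4 * Real.pi := by
    intro s hs
    rw [abs_mul (4 * Real.pi), abs_mul (Real.cos _), abs_of_pos (by positivity : 0 < 4 * Real.pi),
      neg_one_mul, abs_neg]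
    have := mul_le_mul (Real.abs_cos_le_one (μ * s))
      (abs_expAverage_le (by positivity : 0 ≤ μ * s)) (abs_nonneg _) zero_le_one
    nlinarith
  have hRb : ∀ s, 0 ≤ s → |kernelRemainder (μ * s)| ≤ 12 * Real.pi := fun s hs =>
    abs_kernelRemainder_le (by positivity)
  have hcos : Measurable fun s : ℝ => Real.cos (μ * s) := by fun_prop
  have hEm' : Measurable fun s : ℝ =>
      4 * Real.pi * (Real.cos (μ * s) * (-1 * expAverage (μ * s))) := by fun_prop
  have h3 := FormLE.add hEm' hRm hEb hRb h1 h2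
  rw [zero_add] at h3
  refine (FormLE.cos_mul (hEm'.add hRm) (M := 4 * Real.pi + 12 * Real.pi)
    (fun s hs => (abs_add_le _ _).trans (add_le_add (hEb s hs) (hRb s hs))) h3 ω).congr
    fun s _ => ?_
  simp only [kernelRemainder, Pi.add_apply]
  ring

/-- The response kernel is bounded above as a form, uniformly in the frequency. -/
lemma exists_formLE_responseKernel :
    ∃ C : ℝ, 0 < C ∧ ∀ r : ℝ, 0 < r → FormLE (responseKernel r) C := by
  set K := ∫ x in Set.Ioi 0, |kernelRemainder x| with hK
  have hK0 : 0 ≤ K := setIntegral_nonneg measurableSet_Ioi fun x _ => abs_nonneg _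
  have hpi := Real.pi_pos
  -- The summand 1 only makes the constant positive.
  refine ⟨K + 1, by positivity, fun r hr => ?_⟩
  -- The average of these kernels over θ is the response kernel, since r² s ∫₀¹ cos(θ r² s) dθ =
  -- sin(r² s). The prefactor r cancels the 1/μ of the dilation by μ = 2r, which makes the bound
  -- uniform in r.
  have hb : ∀ θ ∈ Set.Ioc (0 : ℝ) 1, FormLE (fun s => r * (Real.cos (θ * r ^ 2 * s) *
      (2 * r * s * ballKernel (2 * r * s)))) (K + 1) := by
    intro θ _ b hb hb2
    refine ((formLE_cos_mul_ballKernel (by positivity : 0 < 2 * r) (θ * r ^ 2)).const_mul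
      hr.le b hb hb2).trans ?_
    refine mul_le_mul_of_nonneg_right ?_ (integral_nonneg fun t => sq_nonneg _)
    have : r * (2 / (2 * r) * K) = K := by field_simp
    rw [this]
    linarith
  have hM : ∀ θ s, θ ∈ Set.Ioc (0 : ℝ) 1 → 0 ≤ s → |r * (Real.cos (θ * r ^ 2 * s) *
      (2 * r * s * ballKernel (2 * r * s)))| ≤ r * (8 * Real.pi) := by
    intro θ s _ hs
    rw [abs_mul, abs_mul, abs_of_pos hr]
    have e : |2 * r * s * ballKernel (2 * r * s)| ≤ 8 * Real.pi := by
      set x := 2 * r * s with hx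
      have hx0 : 0 ≤ x := by positivity
      rw [abs_mul, abs_of_nonneg hx0]
      rcases le_total x 1 with h1 | h1
      · nlinarith [abs_ballKernel_le x hx0, abs_nonneg (ballKernel x)]
      · have h2 := abs_ballKernel_le_inv_sq (by linarith : 0 < x)
        calc x * |ballKernel x| ≤ x * (8 * Real.pi / x ^ 2) := by gcongr
          _ = 8 * Real.pi / x := by field_simp
          _ ≤ 8 * Real.pi := div_le_self (by positivity) h1
    have := mul_le_mul (Real.abs_cos_le_one (θ * r ^ 2 * s)) e (abs_nonneg _) zero_le_one
    nlinarith
  have hmeas : Measurable (Function.uncurry fun θ s : ℝ => r * (Real.cos (θ * r ^ 2 * s) *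
      (2 * r * s * ballKernel (2 * r * s)))) := by
    have := measurable_ballKernel
    have : Measurable fun q : ℝ × ℝ => r * (Real.cos (q.1 * r ^ 2 * q.2) *
      (2 * r * q.2 * ballKernel (2 * r * q.2))) := by fun_prop
    exact this
  refine (FormLE.average hmeas hM hb (by positivity)).congr fun s hs => ?_
  rcases hs.eq_or_lt with h0 | h0
  · simp [← h0, responseKernel_zero]
  rw [integral_const_mul, integral_mul_const, ← intervalIntegral.integral_of_le zero_le_one]
  have hder : ∀ θ ∈ Set.uIcc (0 : ℝ) 1, HasDerivAt
      (fun θ => Real.sin (θ * r ^ 2 * s) / (r ^ 2 * s)) (Real.cos (θ * r ^ 2 * s)) θ := by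
    intro θ _
    have e1 : HasDerivAt (fun θ : ℝ => θ * r ^ 2 * s) (1 * r ^ 2 * s) θ :=
      ((hasDerivAt_id θ).mul_const _).mul_const _
    have e2 := e1.sin.div_const (r ^ 2 * s)
    convert! e2 using 1
    field_simp
  rw [intervalIntegral.integral_eq_sub_of_hasDerivAt hder
    ((by fun_prop : Continuous fun θ : ℝ => Real.cos (θ * r ^ 2 * s)).intervalIntegrable _ _),
    responseKernel]
  simp only [zero_mul, Real.sin_zero, zero_div, sub_zero, one_mul]
  rw [mul_comm s (r ^ 2)]
  field_simp

end OneSided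

/-! ### Fourier transform of the unit ball -/

section Ball

lemma volume_real_disc (c : ℝ) :
    (volume : Measure (Fin 2 → ℝ)).real {y | y 0 ^ 2 + y 1 ^ 2 ≤ c} = Real.pi * max c 0 := by
  have h0 : {y : Fin 2 → ℝ | y 0 ^ 2 + y 1 ^ 2 ≤ c} =
      WithLp.toLp 2 ⁻¹' {y : EuclideanSpace ℝ (Fin 2) | ‖y‖ ^ 2 ≤ c} := by
    ext y
    simp [EuclideanSpace.norm_sq_eq, Fin.sum_univ_two]
  have hms : MeasurableSet {y : EuclideanSpace ℝ (Fin 2) | ‖y‖ ^ 2 ≤ c} :=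
    (isClosed_le (by fun_prop) continuous_const).measurableSet
  rw [h0, (PiLp.volume_preserving_toLp (Fin 2)).measureReal_preimage hms.nullMeasurableSet]
  rcases le_or_gt 0 c with hc | hc
  · have h1 : {y : EuclideanSpace ℝ (Fin 2) | ‖y‖ ^ 2 ≤ c} = Metric.closedBall 0 √c := by
      ext y
      rw [Set.mem_ofPred_eq, mem_closedBall_zero_iff, Real.le_sqrt (norm_nonneg _) hc]
    rw [h1, Measure.real, EuclideanSpace.volume_closedBall_fin_two, ENNReal.toReal_mul,
      ENNReal.toReal_pow, ENNReal.toReal_ofReal (Real.sqrt_nonneg _), Real.sq_sqrt hc,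
      max_eq_left hc, ENNReal.toReal_ofReal Real.pi_pos.le, mul_comm]
  · have h1 : {y : EuclideanSpace ℝ (Fin 2) | ‖y‖ ^ 2 ≤ c} = ∅ := by
      ext y
      simp only [Set.mem_ofPred_eq, Set.mem_empty_iff_false, iff_false, not_le]
      exact hc.trans_le (sq_nonneg _)
    rw [h1, max_eq_right hc.le]
    simp

/-- Integration over the unit ball of a function of the first coordinate. -/
lemma integral_closedBall_coord (g : ℝ → ℝ) (hg : Continuous g) :
    ∫ ξ in Metric.closedBall (0 : R3) 1, g (ξ 0) =
      ∫ x in (-1 : ℝ)..1, Real.pi * (1 - x ^ 2) * g x := by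
  -- Slicing by the first coordinate: the slice at height x is a disc of area π(1 − x²), empty for
  -- |x| > 1.
  let e := (MeasurableEquiv.piFinSuccAbove (fun _ : Fin 3 => ℝ) 0).symm
  have he : MeasurePreserving e (volume.prod volume) volume :=
    (volume_preserving_piFinSuccAbove (fun _ : Fin 3 => ℝ) 0).symm _
  have hT : MeasurePreserving (fun p => (WithLp.toLp 2 (e p) : R3)) (volume.prod volume) volume :=
    (PiLp.volume_preserving_toLp (Fin 3)).comp he
  have hTe : MeasurableEmbedding (fun p => (WithLp.toLp 2 (e p) : R3)) :=
    (MeasurableEquiv.toLp 2 (Fin 3 → ℝ)).measurableEmbedding.comp e.measurableEmbedding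
  have he0 : ∀ p, e p 0 = p.1 := fun p => rfl
  have he1 : ∀ p, e p 1 = p.2 0 := fun p => rfl
  have he2 : ∀ p, e p 2 = p.2 1 := fun p => rfl
  have hball : ∀ p, WithLp.toLp 2 (e p) ∈ Metric.closedBall (0 : R3) 1 ↔
      p.2 0 ^ 2 + p.2 1 ^ 2 ≤ 1 - p.1 ^ 2 := by
    intro p
    rw [mem_closedBall_zero_iff, ← sq_le_one_iff₀ (norm_nonneg _), EuclideanSpace.norm_sq_eq,
      Fin.sum_univ_three]
    simp only [he0, he1, he2, Real.norm_eq_abs, sq_abs]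
    constructor <;> intro h <;> linarith
  rw [← integral_indicator Metric.isClosed_closedBall.measurableSet,
    ← hT.integral_comp hTe]
  have hint : Integrable (fun p => (Metric.closedBall (0 : R3) 1).indicator
      (fun ξ => g (ξ 0)) (WithLp.toLp 2 (e p))) (volume.prod volume) := by
    refine (hT.integrable_comp_emb hTe (g := (Metric.closedBall (0 : R3) 1).indicator
      (fun ξ => g (ξ 0)))).2 ?_
    rw [integrable_indicator_iff Metric.isClosed_closedBall.measurableSet]
    exact (by fun_prop : Continuous fun ξ : R3 => g (ξ 0)).continuousOn.integrableOn_compact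
      (isCompact_closedBall _ _)
  rw [integral_prod _ hint]
  have h1 : ∀ x : ℝ, ∫ y, (Metric.closedBall (0 : R3) 1).indicator
      (fun ξ => g (ξ 0)) (WithLp.toLp 2 (e (x, y))) =
      (Set.Icc (-1 : ℝ) 1).indicator (fun x => Real.pi * (1 - x ^ 2) * g x) x := by
    intro x
    have h2 : (fun y : Fin 2 → ℝ => (Metric.closedBall (0 : R3) 1).indicator
        (fun ξ => g (ξ 0)) (WithLp.toLp 2 (e (x, y)))) =
        Set.indicator {y | y 0 ^ 2 + y 1 ^ 2 ≤ 1 - x ^ 2} (fun _ => g x) := by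
      ext y
      classical
      simp only [Set.indicator_apply, hball, Set.mem_ofPred_eq]
      rfl
    have hms : MeasurableSet {y : Fin 2 → ℝ | y 0 ^ 2 + y 1 ^ 2 ≤ 1 - x ^ 2} :=
      (isClosed_le (by fun_prop) continuous_const).measurableSet
    rw [h2, integral_indicator_const _ hms, volume_real_disc, smul_eq_mul, Set.indicator_apply]
    split_ifs with hx
    · rw [max_eq_left]
      nlinarith [hx.1, hx.2]
    · rw [max_eq_right, mul_zero, zero_mul]
      rw [Set.mem_Icc, ← abs_le, not_le] at hx
      have := sq_abs x
      nlinarith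
  simp only [h1]
  rw [integral_indicator measurableSet_Icc, integral_Icc_eq_integral_Ioc,
    intervalIntegral.integral_of_le (by norm_num)]

lemma integral_parabola_cos {r : ℝ} (hr : r ≠ 0) :
    ∫ x in (-1 : ℝ)..1, Real.pi * (1 - x ^ 2) * Real.cos (r * x) = ballKernel r := by
  -- The antiderivative comes from integrating by parts twice.
  have hder : ∀ x ∈ Set.uIcc (-1 : ℝ) 1, HasDerivAt
      (fun x => Real.pi * ((1 - x ^ 2) * (Real.sin (r * x) / r) -
        2 * x * (Real.cos (r * x) / r ^ 2) + 2 * (Real.sin (r * x) / r ^ 3)))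
      (Real.pi * (1 - x ^ 2) * Real.cos (r * x)) x := by
    intro x _
    have e0 : HasDerivAt (fun x : ℝ => r * x) (r * 1) x := (hasDerivAt_id x).const_mul r
    have e1 : HasDerivAt (fun x : ℝ => 1 - x ^ 2) (-(2 * x)) x := by
      simpa using (hasDerivAt_pow 2 x).const_sub 1
    have e2 : HasDerivAt (fun x : ℝ => 2 * x) (2 * 1) x := (hasDerivAt_id x).const_mul 2
    have := (((e1.mul (e0.sin.div_const r)).sub (e2.mul (e0.cos.div_const (r ^ 2)))).add
      ((e0.sin.div_const (r ^ 3)).const_mul 2)).const_mul Real.pi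
    convert! this using 1
    field_simp
    ring
  rw [intervalIntegral.integral_eq_sub_of_hasDerivAt hder
    ((by fun_prop : Continuous fun x : ℝ =>
      Real.pi * (1 - x ^ 2) * Real.cos (r * x)).intervalIntegrable _ _), ballKernel]
  simp only [mul_neg, mul_one, Real.sin_neg, Real.cos_neg]
  field_simp
  ring

/-- The Fourier transform of the indicator of the unit ball. -/
lemma integral_closedBall_exp {a : R3} (ha : a ≠ 0) :
    ∫ ξ in Metric.closedBall (0 : R3) 1, Complex.exp (Complex.I * ((inner ℝ a ξ : ℝ) : ℂ)) =
      ballKernel ‖a‖ := by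
  have hB : MeasurableSet (Metric.closedBall (0 : R3) 1) :=
    Metric.isClosed_closedBall.measurableSet
  have hi : ∀ g : R3 → ℝ, Continuous g →
      Integrable g (volume.restrict (Metric.closedBall (0 : R3) 1)) := fun g hg =>
    hg.continuousOn.integrableOn_compact (isCompact_closedBall _ _)
  have hsplit : ∀ ξ : R3, Complex.exp (Complex.I * ((inner ℝ a ξ : ℝ) : ℂ)) =
      ((Real.cos (inner ℝ a ξ) : ℝ) : ℂ) + ((Real.sin (inner ℝ a ξ) : ℝ) : ℂ) * Complex.I := by
    intro ξ
    rw [mul_comm, Complex.exp_mul_I, Complex.ofReal_cos, Complex.ofReal_sin]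
  simp only [hsplit]
  rw [integral_add (hi (fun ξ => Real.cos (inner ℝ a ξ)) (by fun_prop)).ofReal
      ((hi (fun ξ => Real.sin (inner ℝ a ξ)) (by fun_prop)).ofReal.mul_const _),
    integral_mul_const, integral_complex_ofReal, integral_complex_ofReal]
  have hsin : ∫ ξ in Metric.closedBall (0 : R3) 1, Real.sin (inner ℝ a ξ) = 0 := by
    have h1 : ∫ ξ in Metric.closedBall (0 : R3) 1, Real.sin (inner ℝ a ξ) =
        ∫ ξ in Metric.closedBall (0 : R3) 1, Real.sin (inner ℝ a (-ξ)) := by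
      rw [← integral_indicator hB, ← integral_indicator hB, ← integral_neg_eq_self]
      congr 1
      ext ξ
      classical
      simp [Set.indicator_apply]
    simp only [inner_neg_right, Real.sin_neg, integral_neg] at h1
    linarith
  have hcos : ∫ ξ in Metric.closedBall (0 : R3) 1, Real.cos (inner ℝ a ξ) = ballKernel ‖a‖ := by
    set v : R3 := EuclideanSpace.single 0 ‖a‖ with hv
    have hva : ‖v‖ = ‖a‖ := by simp [hv]
    -- The reflection exchanging a with the vector of the same length on the first axis preserves
    -- the ball and the volume.
    let U : R3 ≃ₗᵢ[ℝ] R3 := (ℝ ∙ (v - a))ᗮ.reflection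
    have hU : U v = a := Submodule.reflection_sub hva
    have h1 : ∫ ξ in Metric.closedBall (0 : R3) 1, Real.cos (inner ℝ a ξ) =
        ∫ ξ in Metric.closedBall (0 : R3) 1, Real.cos (‖a‖ * ξ 0) := by
      rw [← integral_indicator hB, ← integral_indicator hB,
        ← U.measurePreserving.integral_comp U.toHomeomorph.measurableEmbedding]
      congr 1
      ext ξ
      have e1 : inner ℝ a (U ξ) = ‖a‖ * ξ 0 := by
        rw [← hU, U.inner_map_map, hv, EuclideanSpace.inner_single_left]
        simp
      classical
      simp only [Set.indicator_apply, mem_closedBall_zero_iff, U.norm_map, e1]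
    rw [h1, integral_closedBall_coord (fun x => Real.cos (‖a‖ * x)) (by fun_prop),
      integral_parabola_cos (norm_ne_zero_iff.2 ha)]
  rw [hsin, hcos]
  simp

end Ball

/-! ### Phases and products with bounded fields -/

section PhaseMul

variable {F : Type*} [NormedAddCommGroup F] [NormedSpace ℂ F]

lemma coeFn_phaseMul (φ : C(R3, ℝ)) (u : L2 F) :
    phaseMul φ u =ᵐ[volume] fun ξ => Complex.exp (Complex.I * (φ ξ : ℂ)) • u ξ :=
  (memLp_phase_smul φ u).coeFn_toLp

lemma phaseMul_add (φ : C(R3, ℝ)) (u v : L2 F) :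
    phaseMul φ (u + v) = phaseMul φ u + phaseMul φ v := by
  ext1
  filter_upwards [coeFn_phaseMul φ (u + v), coeFn_phaseMul φ u, coeFn_phaseMul φ v,
    Lp.coeFn_add u v, Lp.coeFn_add (phaseMul φ u) (phaseMul φ v)] with ξ h1 h2 h3 h4 h5
  rw [h1, h5, Pi.add_apply, h2, h3, h4, Pi.add_apply, smul_add]

lemma phaseMul_smul (φ : C(R3, ℝ)) (c : ℂ) (u : L2 F) :
    phaseMul φ (c • u) = c • phaseMul φ u := by
  ext1
  filter_upwards [coeFn_phaseMul φ (c • u), coeFn_phaseMul φ u,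
    Lp.coeFn_smul c u, Lp.coeFn_smul c (phaseMul φ u)] with ξ h1 h2 h3 h4
  rw [h1, h4, Pi.smul_apply, h2, h3, Pi.smul_apply, smul_comm]

lemma phaseMul_sub (φ : C(R3, ℝ)) (u v : L2 F) :
    phaseMul φ (u - v) = phaseMul φ u - phaseMul φ v := by
  rw [sub_eq_add_neg, phaseMul_add, ← neg_one_smul ℂ v, phaseMul_smul, neg_one_smul,
    sub_eq_add_neg]

lemma phaseMul_phaseMul (φ χ : C(R3, ℝ)) (u : L2 F) :
    phaseMul φ (phaseMul χ u) = phaseMul (φ + χ) u := by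
  ext1
  filter_upwards [coeFn_phaseMul φ (phaseMul χ u), coeFn_phaseMul χ u,
    coeFn_phaseMul (φ + χ) u] with ξ h1 h2 h3
  rw [h1, h2, h3, smul_smul, ← Complex.exp_add, ContinuousMap.add_apply]
  push_cast
  ring_nf

lemma coeFn_mulField (V : L2 ℝ) (Z : R3 →ᵇ F) :
    mulField V Z =ᵐ[volume] fun x => (V x : ℂ) • Z x :=
  (memLp_smul_field V Z).coeFn_toLp

lemma norm_mulField_le (V : L2 ℝ) (Z : R3 →ᵇ F) : ‖mulField V Z‖ ≤ ‖Z‖ * ‖V‖ := by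
  refine Lp.norm_le_mul_norm_of_ae_le_mul ?_
  filter_upwards [coeFn_mulField V Z] with x hx
  rw [hx, norm_smul, Complex.norm_real, mul_comm]
  exact mul_le_mul_of_nonneg_right (Z.norm_coe_le_norm x) (norm_nonneg _)

lemma mulField_add (V V' : L2 ℝ) (Z : R3 →ᵇ F) :
    mulField (V + V') Z = mulField V Z + mulField V' Z := by
  ext1
  filter_upwards [coeFn_mulField (V + V') Z, coeFn_mulField V Z, coeFn_mulField V' Z,
    Lp.coeFn_add V V', Lp.coeFn_add (mulField V Z) (mulField V' Z)] with ξ h1 h2 h3 h4 h5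
  rw [h1, h5, Pi.add_apply, h2, h3, h4, Pi.add_apply, Complex.ofReal_add, add_smul]

lemma mulField_smul (c : ℝ) (V : L2 ℝ) (Z : R3 →ᵇ F) :
    mulField (c • V) Z = (c : ℂ) • mulField V Z := by
  ext1
  filter_upwards [coeFn_mulField (c • V) Z, coeFn_mulField V Z,
    Lp.coeFn_smul c V, Lp.coeFn_smul (c : ℂ) (mulField V Z)] with ξ h1 h2 h3 h4
  rw [h1, h4, Pi.smul_apply, h2, h3, Pi.smul_apply, smul_eq_mul, Complex.ofReal_mul, smul_smul]

lemma mulField_sub (V V' : L2 ℝ) (Z : R3 →ᵇ F) :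
    mulField (V - V') Z = mulField V Z - mulField V' Z := by
  rw [sub_eq_add_neg, mulField_add, ← neg_one_smul ℝ V', mulField_smul, Complex.ofReal_neg,
    Complex.ofReal_one, neg_one_smul, sub_eq_add_neg]

lemma mulField_sub_right (V : L2 ℝ) (Z Z' : R3 →ᵇ F) :
    mulField V (Z - Z') = mulField V Z - mulField V Z' := by
  ext1
  filter_upwards [coeFn_mulField V (Z - Z'), coeFn_mulField V Z, coeFn_mulField V Z',
    Lp.coeFn_sub (mulField V Z) (mulField V Z')] with ξ h1 h2 h3 h4
  rw [h1, h4, Pi.sub_apply, h2, h3, BoundedContinuousFunction.coe_sub, Pi.sub_apply, smul_sub]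

/-- Both factors depend on time under the Duhamel integral, so measurability there needs joint
continuity. -/
lemma continuous_mulField : Continuous fun p : L2 ℝ × (R3 →ᵇ F) => mulField p.1 p.2 := by
  rw [continuous_iff_continuousAt]
  rintro ⟨V, Z⟩
  rw [ContinuousAt, tendsto_iff_norm_sub_tendsto_zero]
  have h : ∀ p : L2 ℝ × (R3 →ᵇ F), ‖mulField p.1 p.2 - mulField V Z‖ ≤
      ‖p.2‖ * ‖p.1 - V‖ + ‖p.2 - Z‖ * ‖V‖ := by
    intro p
    have : mulField p.1 p.2 - mulField V Z =
        mulField (p.1 - V) p.2 + mulField V (p.2 - Z) := by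
      rw [mulField_sub, mulField_sub_right]; abel
    rw [this]
    exact (norm_add_le _ _).trans (add_le_add (norm_mulField_le _ _) (norm_mulField_le _ _))
  have hc : Continuous fun p : L2 ℝ × (R3 →ᵇ F) =>
      ‖p.2‖ * ‖p.1 - V‖ + ‖p.2 - Z‖ * ‖V‖ := by fun_prop
  have h0 := hc.tendsto (V, Z)
  simp only [sub_self, norm_zero, mul_zero, zero_mul, add_zero] at h0
  exact squeeze_zero (fun _ => norm_nonneg _) h h0

end PhaseMul

/-! ### Fields with values in a Hilbert space -/

section Hilbert

variable {F : Type*} [NormedAddCommGroup F] [InnerProductSpace ℂ F]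

lemma continuous_inner_phaseMul {φ : ℝ → C(R3, ℝ)} (hφ : ∀ ξ, Continuous fun t => φ t ξ)
    (g u : L2 F) : Continuous fun t => inner ℂ g (phaseMul (φ t) u) := by
  have h : (fun t => inner ℂ g (phaseMul (φ t) u)) =
      fun t => ∫ ξ, inner ℂ (g ξ) (Complex.exp (Complex.I * (φ t ξ : ℂ)) • u ξ) := by
    funext t
    rw [L2.inner_def]
    refine integral_congr_ae ?_
    filter_upwards [coeFn_phaseMul (φ t) u] with ξ hξ
    rw [hξ]
  rw [h]
  refine continuous_of_dominated (bound := fun ξ => ‖g ξ‖ * ‖u ξ‖)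
    (fun t => ?_) (fun t => ?_) ?_ ?_
  · exact ((Lp.aestronglyMeasurable g).inner (𝕜 := ℂ)
      (Lp.aestronglyMeasurable (phaseMul (φ t) u))).congr
        ((coeFn_phaseMul (φ t) u).mono fun ξ hξ => by simp only [hξ])
  · filter_upwards with ξ
    refine (norm_inner_le_norm _ _).trans (le_of_eq ?_)
    rw [norm_smul, mul_comm Complex.I, Complex.norm_exp_ofReal_mul_I, one_mul]
  · exact (Lp.memLp g).norm.integrable_mul (Lp.memLp u).norm
  · filter_upwards with ξ
    have := hφ ξ
    have hc : Continuous fun t => Complex.exp (Complex.I * (φ t ξ : ℂ)) • u ξ := by fun_prop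
    exact continuous_const.inner hc

/-- Unimodular factors keep the norm constant, so the weak continuity obtained by dominated
convergence is already strong continuity. -/
lemma continuous_phaseMul {φ : ℝ → C(R3, ℝ)} (hφ : ∀ ξ, Continuous fun t => φ t ξ)
    (u : L2 F) : Continuous fun t => phaseMul (φ t) u := by
  rw [continuous_iff_continuousAt]
  intro t₀
  rw [ContinuousAt, tendsto_iff_norm_sub_tendsto_zero]
  have h : ∀ t, ‖phaseMul (φ t) u - phaseMul (φ t₀) u‖ ^ 2 =
      2 * ‖u‖ ^ 2 - 2 * (inner ℂ (phaseMul (φ t₀) u) (phaseMul (φ t) u)).re := by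
    intro t
    rw [norm_sub_rev, @norm_sub_sq ℂ, norm_phaseMul, norm_phaseMul, RCLike.re_to_complex]
    ring
  have h0 : 2 * ‖u‖ ^ 2 - 2 * (inner ℂ (phaseMul (φ t₀) u) (phaseMul (φ t₀) u)).re = 0 := by
    rw [← h t₀, sub_self, norm_zero, zero_pow two_ne_zero]
  have hsq : Tendsto (fun t => ‖phaseMul (φ t) u - phaseMul (φ t₀) u‖ ^ 2) (𝓝 t₀) (𝓝 0) := by
    simp only [h]
    rw [← h0]
    exact (continuous_const.sub (continuous_const.mul (Complex.continuous_re.comp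
      (continuous_inner_phaseMul hφ (phaseMul (φ t₀) u) u)))).tendsto t₀
  have := hsq.sqrt
  simpa only [Real.sqrt_sq (norm_nonneg _), Real.sqrt_zero] using this

lemma memLp_re_inner_field (Z : R3 →ᵇ F) (D : L2 F) :
    MemLp (fun x => (inner ℂ (Z x) (D x)).re) 2 (volume : Measure R3) := by
  refine (Lp.memLp D).of_le_mul (c := ‖Z‖) ?_ ?_
  · exact Complex.continuous_re.comp_aestronglyMeasurable
      (Z.continuous.aestronglyMeasurable.inner (𝕜 := ℂ) (Lp.aestronglyMeasurable D))
  · filter_upwards with x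
    rw [Real.norm_eq_abs]
    exact (Complex.abs_re_le_norm _).trans ((norm_inner_le_norm _ _).trans
      (mul_le_mul_of_nonneg_right (Z.norm_coe_le_norm x) (norm_nonneg _)))

/-- The pairing `x ↦ Re ⟪Z(x), D(x)⟫` of a bounded continuous field with an `L²` field. -/
def pairField (Z : R3 →ᵇ F) (D : L2 F) : L2 ℝ := (memLp_re_inner_field Z D).toLp

lemma coeFn_pairField (Z : R3 →ᵇ F) (D : L2 F) :
    pairField Z D =ᵐ[volume] fun x => (inner ℂ (Z x) (D x)).re :=
  (memLp_re_inner_field Z D).coeFn_toLp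

lemma norm_pairField_le (Z : R3 →ᵇ F) (D : L2 F) : ‖pairField Z D‖ ≤ ‖Z‖ * ‖D‖ := by
  refine Lp.norm_le_mul_norm_of_ae_le_mul ?_
  filter_upwards [coeFn_pairField Z D] with x hx
  rw [hx, Real.norm_eq_abs]
  exact (Complex.abs_re_le_norm _).trans ((norm_inner_le_norm _ _).trans
    (mul_le_mul_of_nonneg_right (Z.norm_coe_le_norm x) (norm_nonneg _)))

lemma pairField_add (Z : R3 →ᵇ F) (D D' : L2 F) :
    pairField Z (D + D') = pairField Z D + pairField Z D' := by
  ext1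
  filter_upwards [coeFn_pairField Z (D + D'), coeFn_pairField Z D, coeFn_pairField Z D',
    Lp.coeFn_add D D', Lp.coeFn_add (pairField Z D) (pairField Z D')] with ξ h1 h2 h3 h4 h5
  rw [h1, h5, Pi.add_apply, h2, h3, h4, Pi.add_apply, inner_add_right, Complex.add_re]

lemma pairField_smul (c : ℝ) (Z : R3 →ᵇ F) (D : L2 F) :
    pairField Z ((c : ℂ) • D) = c • pairField Z D := by
  ext1
  filter_upwards [coeFn_pairField Z ((c : ℂ) • D), coeFn_pairField Z D,
    Lp.coeFn_smul (c : ℂ) D, Lp.coeFn_smul c (pairField Z D)] with ξ h1 h2 h3 h4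
  rw [h1, h4, Pi.smul_apply, h2, h3, Pi.smul_apply, inner_smul_right, Complex.re_ofReal_mul,
    smul_eq_mul]

lemma pairField_sub_left (Z Z' : R3 →ᵇ F) (D : L2 F) :
    pairField (Z - Z') D = pairField Z D - pairField Z' D := by
  ext1
  filter_upwards [coeFn_pairField (Z - Z') D, coeFn_pairField Z D, coeFn_pairField Z' D,
    Lp.coeFn_sub (pairField Z D) (pairField Z' D)] with ξ h1 h2 h3 h4
  rw [h1, h4, Pi.sub_apply, h2, h3, BoundedContinuousFunction.coe_sub, Pi.sub_apply,
    inner_sub_left, Complex.sub_re]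

lemma pairField_sub (Z : R3 →ᵇ F) (D D' : L2 F) :
    pairField Z (D - D') = pairField Z D - pairField Z D' := by
  have := pairField_add Z (D - D') D'
  rw [sub_add_cancel] at this
  rw [this, add_sub_cancel_right]

lemma continuous_pairField : Continuous fun p : (R3 →ᵇ F) × L2 F => pairField p.1 p.2 := by
  rw [continuous_iff_continuousAt]
  rintro ⟨Z, D⟩
  rw [ContinuousAt, tendsto_iff_norm_sub_tendsto_zero]
  have h : ∀ p : (R3 →ᵇ F) × L2 F, ‖pairField p.1 p.2 - pairField Z D‖ ≤
      ‖p.1‖ * ‖p.2 - D‖ + ‖p.1 - Z‖ * ‖D‖ := by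
    intro p
    have : pairField p.1 p.2 - pairField Z D =
        pairField p.1 (p.2 - D) + pairField (p.1 - Z) D := by
      rw [pairField_sub, pairField_sub_left]; abel
    rw [this]
    exact (norm_add_le _ _).trans (add_le_add (norm_pairField_le _ _) (norm_pairField_le _ _))
  have hc : Continuous fun p : (R3 →ᵇ F) × L2 F =>
      ‖p.1‖ * ‖p.2 - D‖ + ‖p.1 - Z‖ * ‖D‖ := by fun_prop
  have h0 := hc.tendsto (Z, D)
  simp only [sub_self, norm_zero, mul_zero, zero_mul, add_zero] at h0
  exact squeeze_zero (fun _ => norm_nonneg _) h h0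

/-- The pairing with a field is the real adjoint of the multiplication by the field. -/
lemma inner_pairField (v : L2 ℝ) (Z : R3 →ᵇ F) (D : L2 F) :
    inner ℝ v (pairField Z D) = (inner ℂ (mulField v Z) D).re := by
  rw [L2.inner_def, L2.inner_def]
  have h : ∀ f : R3 → ℂ, Integrable f → (∫ x, f x).re = ∫ x, (f x).re := fun f hf =>
    (integral_re hf).symm
  rw [h _ (L2.integrable_inner _ _)]
  refine integral_congr_ae ?_
  filter_upwards [coeFn_pairField Z D, coeFn_mulField v Z] with x h1 h2
  rw [h1, h2, inner_smul_left, Complex.conj_ofReal, Complex.re_ofReal_mul]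
  simp [mul_comm]

/-! ### The free propagator as a unitary group -/

section FreeFlow

variable [CompleteSpace F]

lemma fourier_freeFlow (m t : ℝ) (u : L2 F) : 𝓕 (freeFlow m t u) =
    phaseMul ⟨fun ξ => -(t * (m + 4 * Real.pi ^ 2 * ‖ξ‖ ^ 2)), by fun_prop⟩ (𝓕 u) := by
  rw [freeFlow, FourierTransform.fourier_fourierInv_eq]

lemma norm_freeFlow (m t : ℝ) (u : L2 F) : ‖freeFlow m t u‖ = ‖u‖ := by
  rw [← Lp.norm_fourier_eq, fourier_freeFlow, norm_phaseMul, Lp.norm_fourier_eq]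

lemma fourier_injective_L2 : Function.Injective (fun u : L2 F => 𝓕 u) :=
  (Lp.fourierTransformₗᵢ R3 F).injective

lemma freeFlow_add (m t : ℝ) (u v : L2 F) :
    freeFlow m t (u + v) = freeFlow m t u + freeFlow m t v := by
  apply fourier_injective_L2
  simp only [fourier_freeFlow, FourierAdd.fourier_add, phaseMul_add]

lemma freeFlow_smul (m t : ℝ) (c : ℂ) (u : L2 F) :
    freeFlow m t (c • u) = c • freeFlow m t u := by
  apply fourier_injective_L2
  simp only [fourier_freeFlow, FourierSMul.fourier_smul, phaseMul_smul]

lemma freeFlow_freeFlow (m t s : ℝ) (u : L2 F) :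
    freeFlow m t (freeFlow m s u) = freeFlow m (t + s) u := by
  apply fourier_injective_L2
  simp only [fourier_freeFlow, phaseMul_phaseMul]
  congr 1
  ext ξ
  simp
  ring

/-- The propagator as a bounded operator. -/
def freeFlowL (m t : ℝ) : L2 F →L[ℂ] L2 F :=
  LinearMap.mkContinuous
    { toFun := freeFlow m t
      map_add' := freeFlow_add m t
      map_smul' := freeFlow_smul m t } 1 fun u => by
        rw [one_mul]; exact (norm_freeFlow m t u).le

lemma freeFlowL_apply (m t : ℝ) (u : L2 F) : freeFlowL m t u = freeFlow m t u := rfl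

/-- Strong continuity in time becomes joint because every `freeFlow m t` is an isometry. -/
lemma continuous_freeFlow (m : ℝ) : Continuous fun p : ℝ × L2 F => freeFlow m p.1 p.2 := by
  have h1 : ∀ u : L2 F, Continuous fun t => freeFlow m t u := by
    intro u
    have h2 : Continuous fun t : ℝ => phaseMul
        ⟨fun ξ : R3 => -(t * (m + 4 * Real.pi ^ 2 * ‖ξ‖ ^ 2)), by fun_prop⟩ (𝓕 u) :=
      continuous_phaseMul (φ := fun t : ℝ =>
        ⟨fun ξ : R3 => -(t * (m + 4 * Real.pi ^ 2 * ‖ξ‖ ^ 2)), by fun_prop⟩)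
        (fun ξ => by simp only [ContinuousMap.coe_mk]; fun_prop) (𝓕 u)
    exact (Lp.fourierTransformₗᵢ R3 F).symm.continuous.comp h2
  rw [continuous_iff_continuousAt]
  rintro ⟨t₀, u₀⟩
  rw [ContinuousAt, tendsto_iff_norm_sub_tendsto_zero]
  have h : ∀ p : ℝ × L2 F, ‖freeFlow m p.1 p.2 - freeFlow m t₀ u₀‖ ≤
      ‖p.2 - u₀‖ + ‖freeFlow m p.1 u₀ - freeFlow m t₀ u₀‖ := by
    intro p
    have : freeFlow m p.1 p.2 - freeFlow m t₀ u₀ = freeFlow m p.1 (p.2 - u₀) +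
        (freeFlow m p.1 u₀ - freeFlow m t₀ u₀) := by
      rw [← freeFlowL_apply m p.1 (p.2 - u₀), map_sub]
      simp only [freeFlowL_apply]
      abel
    rw [this]
    refine (norm_add_le _ _).trans (le_of_eq ?_)
    rw [norm_freeFlow]
  have hc : Continuous fun p : ℝ × L2 F =>
      ‖p.2 - u₀‖ + ‖freeFlow m p.1 u₀ - freeFlow m t₀ u₀‖ := by
    have := (h1 u₀).comp (continuous_fst (X := ℝ) (Y := L2 F))
    fun_prop
  have h0 := hc.tendsto (t₀, u₀)
  simp only [sub_self, norm_zero, add_zero] at h0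
  exact squeeze_zero (fun _ => norm_nonneg _) h h0

end FreeFlow

end Hilbert

/-! ### Convolution with a finite signed measure -/

section Convolution

lemma translate_add (y : R3) (u v : L2 ℝ) :
    translate y (u + v) = translate y u + translate y v :=
  map_add (Lp.compMeasurePreserving _ _) u v

lemma translate_smul (y : R3) (c : ℝ) (u : L2 ℝ) : translate y (c • u) = c • translate y u :=
  map_smul (Lp.compMeasurePreservingₗ ℝ _ (measurePreserving_sub_right volume y)) c u

lemma norm_translate (y : R3) (u : L2 ℝ) : ‖translate y u‖ = ‖u‖ :=
  Lp.norm_compMeasurePreserving _ _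

lemma continuous_translate (u : L2 ℝ) : Continuous fun y => translate y u := by
  let φ : R3 → C(R3, R3) := fun y => ⟨fun x => x - y, by fun_prop⟩
  have hφ : Continuous φ := ContinuousMap.continuous_of_continuous_uncurry _
    (by fun_prop : Continuous fun p : R3 × R3 => p.2 - p.1)
  have h2 : (2 : ℝ≥0∞) ≠ ∞ := ENNReal.ofNat_ne_top
  have h3 : ∀ y, MeasurePreserving (φ y) (volume : Measure R3) volume :=
    fun y => measurePreserving_sub_right volume y
  exact (continuous_const (y := u)).compMeasurePreservingLp hφ h3 h2

lemma integrable_translate (μ : Measure R3) [IsFiniteMeasure μ] (u : L2 ℝ) :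
    Integrable (fun y => translate y u) μ :=
  (integrable_const ‖u‖).mono' (continuous_translate u).aestronglyMeasurable
    (Eventually.of_forall fun y => (norm_translate y u).le)

/-- The convolution with a finite signed measure as a bounded operator. -/
def convL (w : SignedMeasure R3) : L2 ℝ →L[ℝ] L2 ℝ :=
  LinearMap.mkContinuous
    { toFun := conv w
      map_add' := fun u v => by
        simp only [conv, translate_add]
        rw [integral_add (integrable_translate _ u) (integrable_translate _ v),
          integral_add (integrable_translate _ u) (integrable_translate _ v)]
        abel
      map_smul' := fun c u => by
        simp only [conv, translate_smul, integral_smul, RingHom.id_apply, smul_sub] }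
    (w.toJordanDecomposition.posPart.real Set.univ +
      w.toJordanDecomposition.negPart.real Set.univ) fun u => by
    have h : ∀ (μ : Measure R3) [IsFiniteMeasure μ],
        ‖∫ y, translate y u ∂μ‖ ≤ μ.real Set.univ * ‖u‖ := fun μ _ => by
      rw [mul_comm]
      exact norm_integral_le_of_norm_le_const
        (Eventually.of_forall fun y => (norm_translate y u).le)
    rw [add_mul]
    exact (norm_sub_le _ _).trans (add_le_add (h _) (h _))

lemma convL_apply (w : SignedMeasure R3) (u : L2 ℝ) : convL w u = conv w u := rfl

end Convolution

/-! ### The response to a general field Y and a bounded operator K -/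

section Response

variable {F : Type*} [NormedAddCommGroup F] [InnerProductSpace ℂ F] [CompleteSpace F]

/-- The Duhamel operator on fields with values in a Hilbert space. -/
def duhamelField (m : ℝ) (ψ : ℝ → L2 F) (t : ℝ) : L2 F :=
  -Complex.I • ∫ τ in (0 : ℝ)..t, freeFlow m (t - τ) (ψ τ)

/-- The response `2 Re ⟪Y, D((K u) Y)⟫` to a perturbation `K u` of the field `Y`. -/
def response (m : ℝ) (Y : ℝ → R3 →ᵇ F) (K : L2 ℝ →L[ℝ] L2 ℝ) (u : ℝ → L2 ℝ) (t : ℝ) : L2 ℝ :=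
  (2 : ℝ) • pairField (Y t) (duhamelField m (fun τ => mulField (K (u τ)) (Y τ)) t)

variable {m : ℝ} {Y : ℝ → R3 →ᵇ F} {K : L2 ℝ →L[ℝ] L2 ℝ} {u v : ℝ → L2 ℝ} {c : ℝ}

omit [CompleteSpace F] in
lemma intervalIntegrable_mulField (hY : Continuous Y) (hYc : ∀ t, ‖Y t‖ ≤ c)
    (hu : ∀ a b, IntervalIntegrable u volume a b) (a b : ℝ) :
    IntervalIntegrable (fun τ => mulField (K (u τ)) (Y τ)) volume a b := by
  rw [intervalIntegrable_iff]
  have h := intervalIntegrable_iff.1 (hu a b)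
  refine (h.norm.const_mul (c * ‖K‖)).mono' ?_ (Eventually.of_forall fun τ => ?_)
  · exact continuous_mulField.comp_aestronglyMeasurable
      ((K.continuous.comp_aestronglyMeasurable h.aestronglyMeasurable).prodMk
        hY.aestronglyMeasurable)
  · refine (norm_mulField_le _ _).trans ?_
    rw [mul_assoc]
    have hc : 0 ≤ c := (norm_nonneg _).trans (hYc τ)
    exact mul_le_mul (hYc τ) (K.le_opNorm _) (norm_nonneg _) hc

lemma intervalIntegrable_freeFlow {ψ : ℝ → L2 F}
    (hψ : ∀ a b, IntervalIntegrable ψ volume a b) (t a b : ℝ) :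
    IntervalIntegrable (fun τ => freeFlow m (t - τ) (ψ τ)) volume a b := by
  rw [intervalIntegrable_iff]
  have h := intervalIntegrable_iff.1 (hψ a b)
  have h1 : AEStronglyMeasurable (fun τ => (t - τ, ψ τ)) (volume.restrict (Set.uIoc a b)) :=
    (by fun_prop : Continuous fun τ : ℝ => t - τ).aestronglyMeasurable.prodMk
      h.aestronglyMeasurable
  have h2 : AEStronglyMeasurable (fun τ => freeFlow m (t - τ) (ψ τ))
      (volume.restrict (Set.uIoc a b)) := by
    have h4 := (continuous_freeFlow (F := F) m).comp_aestronglyMeasurable h1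
    exact h4
  have h3 : ∀ τ, ‖freeFlow m (t - τ) (ψ τ)‖ ≤ ‖ψ τ‖ := fun τ => (norm_freeFlow m (t - τ) (ψ τ)).le
  exact h.norm.mono' h2 (Eventually.of_forall h3)

lemma duhamelField_add {ψ χ : ℝ → L2 F} (hψ : ∀ a b, IntervalIntegrable ψ volume a b)
    (hχ : ∀ a b, IntervalIntegrable χ volume a b) (t : ℝ) :
    duhamelField m (fun τ => ψ τ + χ τ) t = duhamelField m ψ t + duhamelField m χ t := by
  simp only [duhamelField, freeFlow_add]
  rw [intervalIntegral.integral_add (intervalIntegrable_freeFlow hψ t 0 t)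
    (intervalIntegrable_freeFlow hχ t 0 t), smul_add]

lemma duhamelField_smul (a : ℂ) (ψ : ℝ → L2 F) (t : ℝ) :
    duhamelField m (fun τ => a • ψ τ) t = a • duhamelField m ψ t := by
  simp only [duhamelField, freeFlow_smul]
  rw [intervalIntegral.integral_smul, smul_comm]

lemma continuous_duhamelField {ψ : ℝ → L2 F} (hψ : ∀ a b, IntervalIntegrable ψ volume a b) :
    Continuous (duhamelField m ψ) := by
  -- The group law takes S(t) out of the integral, leaving a strongly continuous flow applied to a
  -- continuous primitive.
  have h : duhamelField m ψ = fun t => -Complex.I • freeFlow m t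
      (∫ τ in (0 : ℝ)..t, freeFlow m (0 - τ) (ψ τ)) := by
    funext t
    rw [duhamelField, ← freeFlowL_apply m t,
      ← (freeFlowL m t).intervalIntegral_comp_comm (intervalIntegrable_freeFlow hψ 0 0 t)]
    congr 2
    ext1 τ
    rw [freeFlowL_apply, freeFlow_freeFlow]
    congr 1
    ring
  rw [h]
  have h2 : Continuous fun t => ∫ τ in (0 : ℝ)..t, freeFlow m (0 - τ) (ψ τ) :=
    intervalIntegral.continuous_primitive (fun a b => intervalIntegrable_freeFlow hψ 0 a b) 0
  have h3 : Continuous fun t => freeFlow m t (∫ τ in (0 : ℝ)..t, freeFlow m (0 - τ) (ψ τ)) :=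
    (continuous_freeFlow (F := F) m).comp (continuous_id.prodMk h2)
  exact h3.const_smul (-Complex.I)

lemma norm_duhamelField_le {ψ : ℝ → L2 F} (t : ℝ) :
    ‖duhamelField m ψ t‖ ≤ ∫ τ in Set.uIoc 0 t, ‖ψ τ‖ := by
  rw [duhamelField, norm_smul, norm_neg, Complex.norm_I, one_mul]
  refine intervalIntegral.norm_integral_le_integral_norm_uIoc.trans (le_of_eq ?_)
  simp only [norm_freeFlow]

lemma duhamelField_congr {ψ χ : ℝ → L2 F} {t : ℝ}
    (h : ∀ᵐ τ, τ ∈ Set.uIoc 0 t → ψ τ = χ τ) :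
    duhamelField m ψ t = duhamelField m χ t := by
  rw [duhamelField, duhamelField]
  congr 1
  refine intervalIntegral.integral_congr_ae ?_
  filter_upwards [h] with τ hτ h'
  rw [hτ h']

lemma response_add (hY : Continuous Y) (hYc : ∀ t, ‖Y t‖ ≤ c)
    (hu : ∀ a b, IntervalIntegrable u volume a b) (hv : ∀ a b, IntervalIntegrable v volume a b)
    (t : ℝ) : response m Y K (fun τ => u τ + v τ) t = response m Y K u t + response m Y K v t := by
  simp only [response, map_add, mulField_add]
  rw [duhamelField_add (intervalIntegrable_mulField hY hYc hu)
    (intervalIntegrable_mulField hY hYc hv), pairField_add, smul_add]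

lemma response_smul (a : ℝ) (t : ℝ) :
    response m Y K (fun τ => a • u τ) t = a • response m Y K u t := by
  simp only [response, map_smul, mulField_smul]
  rw [duhamelField_smul, pairField_smul, smul_comm]

/-- Causality: the response at time t sees the perturbation only between 0 and t. -/
lemma response_congr {t : ℝ} (h : ∀ᵐ τ, τ ∈ Set.uIoc 0 t → u τ = v τ) :
    response m Y K u t = response m Y K v t := by
  rw [response, response, duhamelField_congr]
  filter_upwards [h] with τ hτ h'
  rw [hτ h']

lemma continuous_response (hY : Continuous Y) (hYc : ∀ t, ‖Y t‖ ≤ c)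
    (hu : ∀ a b, IntervalIntegrable u volume a b) : Continuous (response m Y K u) := by
  have h : Continuous fun t =>
      pairField (Y t) (duhamelField m (fun τ => mulField (K (u τ)) (Y τ)) t) :=
    continuous_pairField.comp (hY.prodMk (continuous_duhamelField
      (intervalIntegrable_mulField hY hYc hu)))
  exact h.const_smul (2 : ℝ)

/-- A crude bound that grows with |t|; it serves only to make the truncations bounded operators. -/
lemma norm_response_le (hYc : ∀ t, ‖Y t‖ ≤ c)
    (hu : ∀ a b, IntervalIntegrable u volume a b) (t : ℝ) :
    ‖response m Y K u t‖ ≤ 2 * c ^ 2 * ‖K‖ * ∫ τ in Set.uIoc 0 t, ‖u τ‖ := by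
  have hc : 0 ≤ c := (norm_nonneg _).trans (hYc 0)
  have h1 : ∫ τ in Set.uIoc 0 t, ‖mulField (K (u τ)) (Y τ)‖ ≤
      c * ‖K‖ * ∫ τ in Set.uIoc 0 t, ‖u τ‖ := by
    rw [← integral_const_mul]
    refine integral_mono_of_nonneg (Eventually.of_forall fun τ => norm_nonneg _)
      ((intervalIntegrable_iff.1 (hu 0 t)).norm.const_mul _) (Eventually.of_forall fun τ => ?_)
    refine (norm_mulField_le _ _).trans ?_
    simp only [mul_assoc]
    exact mul_le_mul (hYc τ) (K.le_opNorm _) (norm_nonneg _) hc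
  rw [response, norm_smul, Real.norm_two]
  have h2 := norm_pairField_le (Y t) (duhamelField m (fun τ => mulField (K (u τ)) (Y τ)) t)
  have h3 := norm_duhamelField_le (m := m) (ψ := fun τ => mulField (K (u τ)) (Y τ)) t
  calc _ ≤ 2 * (c * (c * ‖K‖ * ∫ τ in Set.uIoc 0 t, ‖u τ‖)) := by
        refine mul_le_mul_of_nonneg_left ?_ zero_le_two
        exact h2.trans (mul_le_mul (hYc t) (h3.trans h1) (norm_nonneg _) hc)
    _ = _ := by ring

/-- The weak form of the response operator. -/
lemma inner_response (hY : Continuous Y) (hYc : ∀ t, ‖Y t‖ ≤ c)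
    (hu : ∀ a b, IntervalIntegrable u volume a b) (f : L2 ℝ) (t : ℝ) :
    inner ℝ f (response m Y K u t) = ∫ τ in (0 : ℝ)..t,
      2 * (inner ℂ (mulField f (Y t)) (freeFlow m (t - τ) (mulField (K (u τ)) (Y τ)))).im := by
  have hi := intervalIntegrable_freeFlow (m := m)
    (intervalIntegrable_mulField (K := K) hY hYc hu) t 0 t
  rw [response, inner_smul_right, inner_pairField, duhamelField, inner_smul_right,
    intervalIntegral.integral_const_mul]
  congr 1
  have h1 : inner ℂ (mulField f (Y t))
      (∫ τ in (0 : ℝ)..t, freeFlow m (t - τ) (mulField (K (u τ)) (Y τ))) =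
      ∫ τ in (0 : ℝ)..t, inner ℂ (mulField f (Y t))
        (freeFlow m (t - τ) (mulField (K (u τ)) (Y τ))) :=
    ((innerSL ℂ (mulField f (Y t))).intervalIntegral_comp_comm hi).symm
  have h2 : IntervalIntegrable (fun τ => inner ℂ (mulField f (Y t))
      (freeFlow m (t - τ) (mulField (K (u τ)) (Y τ)))) volume 0 t :=
    ⟨(innerSL ℂ (mulField f (Y t))).integrable_comp hi.1,
      (innerSL ℂ (mulField f (Y t))).integrable_comp hi.2⟩
  -- The prefactor −i of the Duhamel operator turns the real part of the pairing into an imaginary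
  -- part.
  have h3 := Complex.imCLM.intervalIntegral_comp_comm h2
  simp only [Complex.imCLM_apply] at h3
  rw [h3, ← h1]
  simp

end Response

/-! ### The steady state as a continuous path of bounded fields -/

section SteadyState

variable {Ω : Type*} [MeasurableSpace Ω] {P : Measure Ω}

lemma planeWave_eq (f : L2 ℂ) (m t : ℝ) (x : R3) :
    planeWave f m t x = phaseMul ⟨fun ξ => inner ℝ x ξ, by fun_prop⟩
      (phaseMul ⟨fun ξ => -(t * (m + ‖ξ‖ ^ 2)), by fun_prop⟩ f) := by
  rw [phaseMul_phaseMul, planeWave]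
  congr 1

lemma norm_steadyState_le (W : WienerIntegral P) (f : L2 ℂ) (m t : ℝ) :
    ‖steadyState W f m t‖ ≤ ‖f‖ :=
  BoundedContinuousFunction.norm_ofNormedAddCommGroup_le _ (norm_nonneg _) _

/-- The spatial phase is an isometry, so the distance between two times is the same at every x;
continuity therefore holds in the supremum norm. -/
lemma continuous_steadyState (W : WienerIntegral P) (f : L2 ℂ) (m : ℝ) :
    Continuous (steadyState W f m) := by
  have h1 : Continuous fun t : ℝ =>
      phaseMul ⟨fun ξ : R3 => -(t * (m + ‖ξ‖ ^ 2)), by fun_prop⟩ f :=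
    continuous_phaseMul (φ := fun t : ℝ => ⟨fun ξ : R3 => -(t * (m + ‖ξ‖ ^ 2)), by fun_prop⟩)
      (fun ξ => by simp only [ContinuousMap.coe_mk]; fun_prop) f
  rw [continuous_iff_continuousAt] at h1 ⊢
  intro t₀
  have h2 := h1 t₀
  rw [ContinuousAt, tendsto_iff_norm_sub_tendsto_zero] at h2 ⊢
  refine squeeze_zero (fun _ => norm_nonneg _) (fun t => ?_) h2
  rw [BoundedContinuousFunction.norm_le (norm_nonneg _)]
  intro x
  change ‖W.toIsometry (planeWave f m t x) - W.toIsometry (planeWave f m t₀ x)‖ ≤ _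
  rw [← map_sub, LinearIsometry.norm_map, planeWave_eq, planeWave_eq, ← phaseMul_sub,
    norm_phaseMul]

/-- The linear response operator is the response of the steady state. -/
lemma linearResponse_ae_eq (W : WienerIntegral P) (f : L2 ℂ) (w : SignedMeasure R3)
    (u : L2tx) (t : ℝ) : (fun x => linearResponse W f w u t x) =ᵐ[volume]
      response (mass f w) (steadyState W f (mass f w)) (convL w) u t := by
  have hd : duhamel P (mass f w)
      (fun τ => mulField (conv w (u τ)) (steadyState W f (mass f w) τ)) t =
      duhamelField (mass f w)
        (fun τ => mulField (convL w (u τ)) (steadyState W f (mass f w) τ)) t := rfl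
  filter_upwards [Lp.coeFn_smul (2 : ℝ) (pairField (steadyState W f (mass f w) t)
    (duhamelField (mass f w)
        (fun τ => mulField (convL w (u τ)) (steadyState W f (mass f w) τ)) t)),
    coeFn_pairField (steadyState W f (mass f w) t) (duhamelField (mass f w)
        (fun τ => mulField (convL w (u τ)) (steadyState W f (mass f w) τ)) t)] with x h1 h2
  rw [response, h1, Pi.smul_apply, h2, smul_eq_mul, L2.inner_def, ← hd]
  simp only [linearResponse, RCLike.inner_apply']

end SteadyState

/-! ### The L² Fourier transform as an integral; real functions -/

section FourierIntegral

open SchwartzMap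

variable {F : Type*} [NormedAddCommGroup F] [InnerProductSpace ℂ F] [CompleteSpace F]

/-- The Fourier transform of an element of `L¹ ∩ L²` is given by the Fourier integral. -/
lemma fourier_toLp_ae_eq {g : R3 → F} (h1 : Integrable g) (h2 : MemLp g 2) :
    (𝓕 h2.toLp : L2 F) =ᵐ[volume] 𝓕 g := by
  have hc : Continuous (𝓕 g) :=
    VectorFourier.fourierIntegral_continuous Real.continuous_fourierChar
      (innerSL ℝ).continuous₂ h1
  -- Both sides are tested against smooth compactly supported functions. There the L² transform acts
  -- as a tempered distribution, and the Fourier integral satisfies ∫ φ̂ g = ∫ φ ĝ.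
  refine ae_eq_of_integral_contDiff_smul_eq
    ((Lp.memLp _).locallyIntegrable (by norm_num)) hc.locallyIntegrable fun φ hφ hφc => ?_
  let χ : 𝓢(R3, ℂ) := HasCompactSupport.toSchwartzMap (f := fun x => (φ x : ℂ))
    (hφc.comp_left Complex.ofReal_zero) (Complex.ofRealCLM.contDiff.comp hφ)
  have hχ : ∀ x, χ x = (φ x : ℂ) := fun x => rfl
  have e1 := congrArg (fun T : 𝓢'(R3, F) => T χ) (Lp.fourier_toTemperedDistribution_eq h2.toLp)
  simp only [TemperedDistribution.fourier_apply, Lp.toTemperedDistribution_apply] at e1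
  have e2 : ∫ x, (𝓕 χ) x • h2.toLp g x = ∫ x, (𝓕 χ) x • g x := by
    refine integral_congr_ae ?_
    filter_upwards [h2.coeFn_toLp] with x hx
    rw [hx]
  have e3 : ∫ x, (𝓕 (χ : R3 → ℂ)) x • g x = ∫ x, χ x • (𝓕 g) x := by
    have := VectorFourier.integral_fourierIntegral_smul_eq_flip (μ := (volume : Measure R3))
      (ν := (volume : Measure R3)) (L := innerₗ R3) Real.continuous_fourierChar
      (innerSL ℝ).continuous₂ χ.integrable h1
    rw [flip_innerₗ] at this
    exact this
  rw [e2, SchwartzMap.fourier_coe, e3] at e1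
  simp only [hχ] at e1
  exact e1.symm

/-- The complexification of a real `L²` function. -/
def cplx (u : L2 ℝ) : L2 ℂ := Complex.ofRealCLM.compLp u

lemma coeFn_cplx (u : L2 ℝ) : cplx u =ᵐ[volume] fun x => (u x : ℂ) :=
  Complex.ofRealCLM.coeFn_compLp u

/-- The Fourier transform of a real `L²` function. -/
def hat (u : L2 ℝ) : L2 ℂ := 𝓕 (cplx u)

lemma cplx_add (u v : L2 ℝ) : cplx (u + v) = cplx u + cplx v :=
  map_add (Complex.ofRealCLM.compLpL 2 volume) u v

lemma cplx_smul (c : ℝ) (u : L2 ℝ) : cplx (c • u) = (c : ℂ) • cplx u := by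
  ext1
  filter_upwards [coeFn_cplx (c • u), coeFn_cplx u, Lp.coeFn_smul c u,
    Lp.coeFn_smul (c : ℂ) (cplx u)] with x h1 h2 h3 h4
  rw [h1, h4, Pi.smul_apply, h2, h3, Pi.smul_apply]
  simp

lemma norm_cplx (u : L2 ℝ) : ‖cplx u‖ = ‖u‖ := by
  rw [Lp.norm_def, Lp.norm_def]
  congr 1
  refine eLpNorm_congr_norm_ae ?_
  filter_upwards [coeFn_cplx u] with x hx
  rw [hx, Complex.norm_real]

lemma hat_add (u v : L2 ℝ) : hat (u + v) = hat u + hat v := by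
  rw [hat, cplx_add, FourierAdd.fourier_add, hat, hat]

lemma hat_smul (c : ℝ) (u : L2 ℝ) : hat (c • u) = (c : ℂ) • hat u := by
  rw [hat, cplx_smul, FourierSMul.fourier_smul, hat]

lemma norm_hat (u : L2 ℝ) : ‖hat u‖ = ‖u‖ := by
  rw [hat, Lp.norm_fourier_eq, norm_cplx]

/-- The Fourier transform of a real Schwartz function. -/
def schwartzHat (φ : 𝓢(R3, ℝ)) : 𝓢(R3, ℂ) := 𝓕 (SchwartzMap.postcompCLM Complex.ofRealCLM φ)

lemma schwartzHat_apply (φ : 𝓢(R3, ℝ)) (η : R3) :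
    schwartzHat φ η = 𝓕 (fun x => (φ x : ℂ)) η := by
  rw [schwartzHat, SchwartzMap.fourier_coe]
  rfl

lemma hat_toLp (φ : 𝓢(R3, ℝ)) : hat (φ.toLp 2) = (schwartzHat φ).toLp 2 := by
  rw [hat, schwartzHat, ← SchwartzMap.toLp_fourier_eq]
  congr 1

/-- This symmetry, the trace of φ being real, is what later isolates the imaginary part of the
propagator kernel. -/
lemma schwartzHat_neg (φ : 𝓢(R3, ℝ)) (η : R3) :
    schwartzHat φ (-η) = conj (schwartzHat φ η) := by
  rw [schwartzHat_apply, schwartzHat_apply, Real.fourier_eq', Real.fourier_eq', ← integral_conj]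
  congr 1
  ext x
  simp only [smul_eq_mul, map_mul, Complex.conj_ofReal, ← Complex.exp_conj, Complex.conj_I,
    inner_neg_right]
  congr 2
  push_cast
  ring

end FourierIntegral

/-! ### Fourier transform of a Schwartz function times a plane wave -/

section PlaneWaveTransform

open SchwartzMap

/-- The wave e^{i⟨x, ξ⟩} has frequency ξ/(2π) in the normalization of `𝓕`, hence the shift in the
argument. -/
lemma memLp_schwartzHat_mul (φ : 𝓢(R3, ℝ)) (f : L2 ℂ) (ζ : R3) :
    MemLp (fun ξ => schwartzHat φ (ζ - (2 * Real.pi)⁻¹ • ξ) * f ξ) 2 := by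
  refine (Lp.memLp f).of_le_mul (c := ‖(schwartzHat φ).toBoundedContinuousFunction‖) ?_
    (Eventually.of_forall fun ξ => ?_)
  · exact (by fun_prop : Continuous fun ξ : R3 =>
      schwartzHat φ (ζ - (2 * Real.pi)⁻¹ • ξ)).aestronglyMeasurable.mul
      (Lp.aestronglyMeasurable f)
  · rw [norm_mul]
    exact mul_le_mul_of_nonneg_right
      ((schwartzHat φ).toBoundedContinuousFunction.norm_coe_le_norm _) (norm_nonneg _)

/-- The Fourier transform in `x` of a Schwartz function times a plane wave. -/
lemma fourier_smul_planeWave (φ : 𝓢(R3, ℝ)) (f : L2 ℂ) (m t : ℝ) (ζ : R3) :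
    𝓕 (fun x => (φ x : ℂ) • planeWave f m t x) ζ = phaseMul
      ⟨fun ξ => -(t * (m + ‖ξ‖ ^ 2)), by fun_prop⟩ (memLp_schwartzHat_mul φ f ζ).toLp := by
  -- Pairing with g turns the L²-valued Fourier integral into a scalar double integral, to which
  -- Fubini applies.
  refine ext_inner_left ℂ fun g => ?_
  have hi : Integrable fun x => (φ x : ℂ) • planeWave f m t x := by
    refine (φ.integrable.norm.mul_const ‖f‖).mono' ?_ (Eventually.of_forall fun x => ?_)
    · exact ((by fun_prop : Continuous fun x => (φ x : ℂ)).smul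
        (continuous_planeWave f m t)).aestronglyMeasurable
    · rw [norm_smul, norm_planeWave, Complex.norm_real]
  have hi' := (Real.fourierIntegral_convergent_iff (μ := volume) ζ).2 hi
  have h0 : inner ℂ g (∫ x, Real.fourierChar (-inner ℝ x ζ) • (φ x : ℂ) • planeWave f m t x) =
      ∫ x, inner ℂ g (Real.fourierChar (-inner ℝ x ζ) • (φ x : ℂ) • planeWave f m t x) :=
    ((innerSL ℂ g).integral_comp_comm hi').symm
  rw [Real.fourier_eq]
  refine h0.trans ?_
  have h1 : ∀ x, inner ℂ g (Real.fourierChar (-inner ℝ x ζ) • (φ x : ℂ) • planeWave f m t x) =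
      ∫ ξ, conj (g ξ) * f ξ * Complex.exp (Complex.I * ((-(t * (m + ‖ξ‖ ^ 2)) : ℝ) : ℂ)) *
        (Complex.exp (((-2 * Real.pi * inner ℝ x (ζ - (2 * Real.pi)⁻¹ • ξ) : ℝ) : ℂ) * Complex.I)
          * (φ x : ℂ)) := by
    intro x
    rw [Circle.smul_def, inner_smul_right, inner_smul_right, L2.inner_def,
      ← integral_const_mul, ← integral_const_mul]
    refine integral_congr_ae ?_
    filter_upwards [coeFn_planeWave f m t x] with ξ hξ
    rw [hξ, RCLike.inner_apply', Real.fourierChar_apply]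
    have e : Complex.exp (((2 * Real.pi * -inner ℝ x ζ : ℝ) : ℂ) * Complex.I) *
        Complex.exp (Complex.I * ((inner ℝ x ξ - t * (m + ‖ξ‖ ^ 2) : ℝ) : ℂ)) =
        Complex.exp (Complex.I * ((-(t * (m + ‖ξ‖ ^ 2)) : ℝ) : ℂ)) *
        Complex.exp (((-2 * Real.pi * inner ℝ x (ζ - (2 * Real.pi)⁻¹ • ξ) : ℝ) : ℂ) *
          Complex.I) := by
      rw [← Complex.exp_add, ← Complex.exp_add, inner_sub_right, inner_smul_right]
      congr 1
      have hp : (Real.pi : ℂ) ≠ 0 := by exact_mod_cast Real.pi_ne_zero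
      push_cast
      field_simp
      ring
    simp only [smul_eq_mul]
    linear_combination (conj (g ξ) * f ξ * (φ x : ℂ)) * e
  simp only [h1]
  rw [integral_integral_swap]
  · rw [L2.inner_def]
    refine integral_congr_ae ?_
    filter_upwards [coeFn_phaseMul ⟨fun ξ => -(t * (m + ‖ξ‖ ^ 2)), by fun_prop⟩
      (memLp_schwartzHat_mul φ f ζ).toLp, (memLp_schwartzHat_mul φ f ζ).coeFn_toLp] with ξ h2 h3
    rw [h2, h3, RCLike.inner_apply', schwartzHat_apply, Real.fourier_eq', integral_const_mul]
    simp only [smul_eq_mul, ContinuousMap.coe_mk]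
    ring
  · have h4 : Integrable (fun ξ => conj (g ξ) * f ξ) := by
      have := L2.integrable_inner (𝕜 := ℂ) g f
      simpa only [RCLike.inner_apply'] using this
    have h5 : Integrable (fun x => (φ x : ℂ)) := φ.integrable.ofReal
    have h6 : Integrable (fun q : R3 × R3 => (φ q.1 : ℂ) * (conj (g q.2) * f q.2)) :=
      h5.mul_prod h4
    have hc : Continuous fun q : R3 × R3 =>
        Complex.exp (Complex.I * ((-(t * (m + ‖q.2‖ ^ 2)) : ℝ) : ℂ)) *
        Complex.exp (((-2 * Real.pi * inner ℝ q.1 (ζ - (2 * Real.pi)⁻¹ • q.2) : ℝ) : ℂ) *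
          Complex.I) := by fun_prop
    refine (h6.bdd_mul (c := 1) hc.aestronglyMeasurable (Eventually.of_forall fun q => ?_)).congr
      (Eventually.of_forall fun q => ?_)
    · rw [norm_mul, Complex.norm_exp_ofReal_mul_I, mul_comm Complex.I,
        Complex.norm_exp_ofReal_mul_I, one_mul]
    · simp only [Function.uncurry]
      ring

end PlaneWaveTransform

/-! ### Matrix elements of the propagator in momentum space -/

section SteadyKernel

open SchwartzMap

lemma inner_fourier_smul_planeWave (φ χ : 𝓢(R3, ℝ)) (f : L2 ℂ) (m t τ : ℝ) (ζ : R3) :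
    inner ℂ (𝓕 (fun x => (φ x : ℂ) • planeWave f m t x) ζ)
      (𝓕 (fun x => (χ x : ℂ) • planeWave f m τ x) ζ) =
      ∫ ξ, conj (schwartzHat φ (ζ - (2 * Real.pi)⁻¹ • ξ)) *
        schwartzHat χ (ζ - (2 * Real.pi)⁻¹ • ξ) *
        Complex.exp (Complex.I * (((t - τ) * (m + ‖ξ‖ ^ 2) : ℝ) : ℂ)) * ((‖f ξ‖ ^ 2 : ℝ) : ℂ) := by
  rw [fourier_smul_planeWave, fourier_smul_planeWave, L2.inner_def]
  refine integral_congr_ae ?_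
  filter_upwards [coeFn_phaseMul ⟨fun ξ => -(t * (m + ‖ξ‖ ^ 2)), by fun_prop⟩
      (memLp_schwartzHat_mul φ f ζ).toLp, (memLp_schwartzHat_mul φ f ζ).coeFn_toLp,
    coeFn_phaseMul ⟨fun ξ => -(τ * (m + ‖ξ‖ ^ 2)), by fun_prop⟩
      (memLp_schwartzHat_mul χ f ζ).toLp, (memLp_schwartzHat_mul χ f ζ).coeFn_toLp]
    with ξ h1 h2 h3 h4
  rw [h1, h2, h3, h4, RCLike.inner_apply']
  simp only [smul_eq_mul, ContinuousMap.coe_mk, map_mul, ← Complex.exp_conj, Complex.conj_I,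
    Complex.conj_ofReal]
  have e1 : Complex.exp (-Complex.I * ((-(t * (m + ‖ξ‖ ^ 2)) : ℝ) : ℂ)) *
      Complex.exp (Complex.I * ((-(τ * (m + ‖ξ‖ ^ 2)) : ℝ) : ℂ)) =
      Complex.exp (Complex.I * (((t - τ) * (m + ‖ξ‖ ^ 2) : ℝ) : ℂ)) := by
    rw [← Complex.exp_add]
    congr 1
    push_cast
    ring
  have e2 : conj (f ξ) * f ξ = ((‖f ξ‖ ^ 2 : ℝ) : ℂ) := by
    rw [Complex.conj_mul']
    push_cast
    rfl
  rw [← e1, ← e2]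
  ring

variable {Ω : Type*} [MeasurableSpace Ω] {P : Measure Ω}

/-- The Wiener integral is a bounded linear map, so it commutes with the Fourier integral in x;
being an isometry, it then turns expectations into integrals over ξ. -/
lemma fourier_mulField_steadyState (W : WienerIntegral P) (φ : 𝓢(R3, ℝ)) (f : L2 ℂ) (m t : ℝ) :
    (𝓕 (mulField (φ.toLp 2) (steadyState W f m t)) : L2 (Lp ℂ 2 P)) =ᵐ[volume] fun ζ =>
      W.toIsometry (𝓕 (fun x => (φ x : ℂ) • planeWave f m t x) ζ) := by
  set Z := steadyState W f m t with hZ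
  have hc : Continuous fun x => (φ x : ℂ) • Z x := (by fun_prop : Continuous fun x =>
    (φ x : ℂ)).smul Z.continuous
  have hb : ∀ x, ‖(φ x : ℂ) • Z x‖ ≤ ‖Z‖ * ‖φ x‖ := fun x => by
    rw [norm_smul, Complex.norm_real, mul_comm]
    exact mul_le_mul_of_nonneg_right (Z.norm_coe_le_norm x) (norm_nonneg _)
  have h1 : Integrable fun x => (φ x : ℂ) • Z x :=
    (φ.integrable.norm.const_mul ‖Z‖).mono' hc.aestronglyMeasurable (Eventually.of_forall hb)
  have h2 : MemLp (fun x => (φ x : ℂ) • Z x) 2 :=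
    (φ.memLp 2).of_le_mul hc.aestronglyMeasurable (Eventually.of_forall hb)
  have h3 : mulField (φ.toLp 2) Z = h2.toLp := by
    ext1
    filter_upwards [coeFn_mulField (φ.toLp 2) Z, h2.coeFn_toLp, φ.coeFn_toLp 2] with x e1 e2 e3
    rw [e1, e2, e3]
  rw [h3]
  filter_upwards [fourier_toLp_ae_eq h1 h2] with ζ hζ
  rw [hζ, Real.fourier_eq, Real.fourier_eq]
  have hi : Integrable fun x => (φ x : ℂ) • planeWave f m t x := by
    refine (φ.integrable.norm.mul_const ‖f‖).mono' ?_ (Eventually.of_forall fun x => ?_)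
    · exact ((by fun_prop : Continuous fun x => (φ x : ℂ)).smul
        (continuous_planeWave f m t)).aestronglyMeasurable
    · rw [norm_smul, norm_planeWave, Complex.norm_real]
  have hi' := (Real.fourierIntegral_convergent_iff (μ := volume) ζ).2 hi
  refine Eq.trans ?_ (W.toIsometry.toContinuousLinearMap.integral_comp_comm hi')
  refine integral_congr_ae (Eventually.of_forall fun x => ?_)
  have hx : Z x = W.toIsometry (planeWave f m t x) := rfl
  simp only [hx, Circle.smul_def, LinearIsometry.coe_toContinuousLinearMap, map_smul]

/-- The phase that the propagator between the times `τ` and `τ + s` produces at the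
momentum transfer `η` from the momentum `ξ`. -/
def transferPhase (s : ℝ) (η ξ : R3) : ℂ := Complex.exp (Complex.I *
  ((-(s * (4 * Real.pi ^ 2 * ‖η‖ ^ 2 + 4 * Real.pi * inner ℝ η ξ)) : ℝ) : ℂ))

lemma norm_transferPhase (s : ℝ) (η ξ : R3) : ‖transferPhase s η ξ‖ = 1 := by
  rw [transferPhase, mul_comm Complex.I, Complex.norm_exp_ofReal_mul_I]

lemma continuous_transferPhase (s : ℝ) :
    Continuous fun q : R3 × R3 => transferPhase s q.1 q.2 := by
  unfold transferPhase
  fun_prop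

lemma integrable_transferPhase_mul {q g : R3 → ℂ} (hq : Integrable q) (hg : Integrable g) (s : ℝ) :
    Integrable (fun p : R3 × R3 => q p.1 * (transferPhase s p.1 p.2 * g p.2))
      ((volume : Measure R3).prod (volume : Measure R3)) := by
  refine ((hq.mul_prod hg).bdd_mul (c := 1) (continuous_transferPhase s).aestronglyMeasurable
    (Eventually.of_forall fun p => (norm_transferPhase s p.1 p.2).le)).congr
    (Eventually.of_forall fun p => ?_)
  simp only
  ring

/-- The substitution η = ζ − aξ, for fixed ξ, passes from the outgoing momentum to the momentum
transfer; Fubini is applied before and after it. -/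
lemma integral_transferPhase {q g : R3 → ℂ} (hq : Integrable q) (hg : Integrable g) (s a : ℝ) :
    ∫ ζ, ∫ ξ, q (ζ - a • ξ) * (transferPhase s (ζ - a • ξ) ξ * g ξ) =
      ∫ η, q η * ∫ ξ, transferPhase s η ξ * g ξ := by
  have h0 := integrable_transferPhase_mul hq hg s
  have hmp : MeasurePreserving (fun p : R3 × R3 => (p.1 - a • p.2, p.2))
      ((volume : Measure R3).prod (volume : Measure R3))
      ((volume : Measure R3).prod (volume : Measure R3)) := by
    have h1 : MeasurePreserving (fun p : R3 × R3 => (p.1, p.2 - a • p.1))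
        ((volume : Measure R3).prod (volume : Measure R3))
        ((volume : Measure R3).prod (volume : Measure R3)) :=
      (MeasurePreserving.id volume).skew_product (g := fun x y => y - a • x)
        (by fun_prop) (Eventually.of_forall fun x =>
          (measurePreserving_sub_right volume (a • x)).map_eq)
    exact (Measure.measurePreserving_swap.comp h1).comp Measure.measurePreserving_swap
  have h1 : Integrable (fun p : R3 × R3 =>
      q (p.1 - a • p.2) * (transferPhase s (p.1 - a • p.2) p.2 * g p.2))
      ((volume : Measure R3).prod (volume : Measure R3)) :=
    hmp.integrable_comp_of_integrable h0
  have h2 := integral_integral_swap (f := fun ζ ξ =>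
    q (ζ - a • ξ) * (transferPhase s (ζ - a • ξ) ξ * g ξ)) h1
  have h3 := integral_integral_swap (f := fun η ξ => q η * (transferPhase s η ξ * g ξ)) h0
  rw [h2]
  simp only [integral_const_mul] at h3
  rw [h3]
  refine integral_congr_ae (Eventually.of_forall fun ξ => ?_)
  exact integral_sub_right_eq_self (fun η => q η * (transferPhase s η ξ * g ξ)) (a • ξ)

/-- With ζ = η + ξ/(2π) the mass cancels, and so does ‖ξ‖²: 4π²‖ζ‖² − ‖ξ‖² = 4π²‖η‖² + 4π⟨η, ξ⟩. -/
lemma exp_mul_exp_eq_transferPhase (m s : ℝ) (ζ ξ : R3) :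
    Complex.exp (Complex.I * ((-(s * (m + 4 * Real.pi ^ 2 * ‖ζ‖ ^ 2)) : ℝ) : ℂ)) *
      Complex.exp (Complex.I * ((s * (m + ‖ξ‖ ^ 2) : ℝ) : ℂ)) =
      transferPhase s (ζ - (2 * Real.pi)⁻¹ • ξ) ξ := by
  rw [transferPhase, ← Complex.exp_add, ← mul_add, ← Complex.ofReal_add]
  congr 3
  rw [norm_sub_sq_real, inner_sub_left, inner_smul_left, inner_smul_right, norm_smul,
    real_inner_self_eq_norm_sq]
  have := Real.pi_ne_zero
  simp only [norm_inv, norm_mul, Real.norm_eq_abs, abs_of_pos Real.pi_pos, abs_two,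
    RCLike.conj_to_real]
  field_simp
  ring

lemma integrable_conj_schwartzHat_mul (φ χ : 𝓢(R3, ℝ)) :
    Integrable fun η => conj (schwartzHat φ η) * schwartzHat χ η := by
  refine ((schwartzHat χ).integrable (μ := volume)).bdd_mul
    (c := ‖(schwartzHat φ).toBoundedContinuousFunction‖) ?_ (Eventually.of_forall fun η => ?_)
  · exact (Complex.continuous_conj.comp (schwartzHat φ).continuous).aestronglyMeasurable
  · rw [RCLike.norm_conj]
    exact (schwartzHat φ).toBoundedContinuousFunction.norm_coe_le_norm η

lemma inner_fourier_mulField_phaseMul_ae (W : WienerIntegral P) (φ χ : 𝓢(R3, ℝ)) (f : L2 ℂ)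
    (m t τ : ℝ) (ψ : C(R3, ℝ))
    (hψ : ∀ ξ, ψ ξ = -((t - τ) * (m + 4 * Real.pi ^ 2 * ‖ξ‖ ^ 2))) :
    (fun ζ => inner ℂ ((𝓕 (mulField (φ.toLp 2) (steadyState W f m t)) : L2 (Lp ℂ 2 P)) ζ)
      (phaseMul ψ (𝓕 (mulField (χ.toLp 2) (steadyState W f m τ))) ζ)) =ᵐ[volume] fun ζ =>
      ∫ ξ, (conj (schwartzHat φ (ζ - (2 * Real.pi)⁻¹ • ξ)) *
        schwartzHat χ (ζ - (2 * Real.pi)⁻¹ • ξ)) *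
        (transferPhase (t - τ) (ζ - (2 * Real.pi)⁻¹ • ξ) ξ * ((‖f ξ‖ ^ 2 : ℝ) : ℂ)) := by
  filter_upwards [fourier_mulField_steadyState W φ f m t, fourier_mulField_steadyState W χ f m τ,
    coeFn_phaseMul ψ (𝓕 (mulField (χ.toLp 2) (steadyState W f m τ)))] with ζ e1 e2 e3
  rw [e1, e3, e2, inner_smul_right, LinearIsometry.inner_map_map,
    inner_fourier_smul_planeWave, ← integral_const_mul]
  refine integral_congr_ae (Eventually.of_forall fun ξ => ?_)
  simp only [hψ]
  rw [← exp_mul_exp_eq_transferPhase m]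
  ring

/-- The matrix elements of the propagator between products with the steady state. -/
lemma inner_mulField_freeFlow (W : WienerIntegral P) (φ χ : 𝓢(R3, ℝ)) (f : L2 ℂ) (m t τ : ℝ) :
    inner ℂ (mulField (φ.toLp 2) (steadyState W f m t))
      (freeFlow m (t - τ) (mulField (χ.toLp 2) (steadyState W f m τ))) =
      ∫ η, (conj (schwartzHat φ η) * schwartzHat χ η) *
        ∫ ξ, transferPhase (t - τ) η ξ * ((‖f ξ‖ ^ 2 : ℝ) : ℂ) := by
  have hf2 : Integrable fun ξ => ((‖f ξ‖ ^ 2 : ℝ) : ℂ) := (Lp.memLp f).norm.integrable_sq.ofReal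
  rw [← integral_transferPhase (integrable_conj_schwartzHat_mul φ χ) hf2 (t - τ)
    (2 * Real.pi)⁻¹, ← Lp.inner_fourier_eq, fourier_freeFlow, L2.inner_def]
  exact integral_congr_ae (inner_fourier_mulField_phaseMul_ae W φ χ f m t τ _ fun ξ => rfl)

end SteadyKernel

/-! ### The response of the Fermi ball -/

section FermiBall

open SchwartzMap

/-- The integral of the transfer phase over the Fermi ball. -/
def ballTransfer (s : ℝ) (η : R3) : ℂ := ∫ ξ in Metric.closedBall (0 : R3) 1, transferPhase s η ξ

lemma transferPhase_neg (s : ℝ) (η ξ : R3) : transferPhase s (-η) ξ = transferPhase s η (-ξ) := by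
  simp only [transferPhase, norm_neg, inner_neg_left, inner_neg_right]

lemma ballTransfer_neg (s : ℝ) (η : R3) : ballTransfer s (-η) = ballTransfer s η := by
  have hs : MeasurableSet (Metric.closedBall (0 : R3) 1) := Metric.isClosed_closedBall.measurableSet
  rw [ballTransfer, ballTransfer, ← integral_indicator hs, ← integral_indicator hs,
    ← integral_neg_eq_self]
  congr 1
  ext ξ
  classical
  simp only [Set.indicator_apply, mem_closedBall_zero_iff, norm_neg, transferPhase_neg, neg_neg]

/-- The integral over ξ is the Fourier transform of the ball at −4πsη, which is real. The imaginary
part comes only from the factor e^{−is(2π‖η‖)²}, which produces the sine in `responseKernel`. -/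
lemma ballTransfer_im (s : ℝ) {η : R3} (hη : η ≠ 0) :
    2 * (ballTransfer s η).im = -responseKernel (2 * Real.pi * ‖η‖) s := by
  rcases eq_or_ne s 0 with rfl | hs
  · have h1 : ∀ ξ, transferPhase 0 η ξ = ((1 : ℝ) : ℂ) := fun ξ => by simp [transferPhase]
    rw [ballTransfer]
    simp only [h1]
    rw [setIntegral_const, responseKernel_zero, Complex.smul_im]
    simp
  · have ha : (-(4 * Real.pi * s)) • η ≠ 0 := by
      refine smul_ne_zero ?_ hη
      have := Real.pi_ne_zero
      simp [hs]
    have h1 : ∀ ξ, transferPhase s η ξ =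
        Complex.exp (((-(s * (4 * Real.pi ^ 2 * ‖η‖ ^ 2)) : ℝ) : ℂ) * Complex.I) *
        Complex.exp (Complex.I * ((inner ℝ ((-(4 * Real.pi * s)) • η) ξ : ℝ) : ℂ)) := fun ξ => by
      rw [transferPhase, ← Complex.exp_add, inner_smul_left, RCLike.conj_to_real]
      congr 1
      push_cast
      ring
    have h2 : ballKernel ‖(-(4 * Real.pi * s)) • η‖ = ballKernel (2 * (2 * Real.pi * ‖η‖) * s) := by
      rw [norm_smul, Real.norm_eq_abs, abs_neg, abs_mul, abs_of_pos (by positivity)]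
      rcases abs_cases s with ⟨h, -⟩ | ⟨h, -⟩
      · rw [h]
        congr 1
        ring
      · rw [h, ← ballKernel_neg]
        congr 1
        ring
    rw [ballTransfer]
    simp only [h1]
    rw [integral_const_mul, integral_closedBall_exp ha, h2, Complex.im_mul_ofReal,
      Complex.exp_ofReal_mul_I_im, Real.sin_neg, responseKernel]
    rw [show s * (2 * Real.pi * ‖η‖) ^ 2 = s * (4 * Real.pi ^ 2 * ‖η‖ ^ 2) by ring]
    ring

lemma norm_ballTransfer_le (s : ℝ) (η : R3) :
    ‖ballTransfer s η‖ ≤ volume.real (Metric.closedBall (0 : R3) 1) := by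
  have := norm_setIntegral_le_of_norm_le_const (μ := (volume : Measure R3))
    (s := Metric.closedBall (0 : R3) 1) (C := 1) (f := transferPhase s η)
    (measure_closedBall_lt_top) (fun ξ _ => (norm_transferPhase s η ξ).le)
  rwa [one_mul] at this

lemma stronglyMeasurable_ballTransfer (s : ℝ) : StronglyMeasurable (ballTransfer s) :=
  (continuous_transferPhase s).stronglyMeasurable.integral_prod_right

lemma integral_transferPhase_mul_eq_ballTransfer {f : L2 ℂ}
    (hf : ∀ᵐ ξ : R3, ‖f ξ‖ ^ 2 = Set.indicator {ξ | ‖ξ‖ ≤ 1} 1 ξ) (s : ℝ) (η : R3) :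
    ∫ ξ, transferPhase s η ξ * ((‖f ξ‖ ^ 2 : ℝ) : ℂ) = ballTransfer s η := by
  rw [ballTransfer, ← integral_indicator Metric.isClosed_closedBall.measurableSet]
  refine integral_congr_ae ?_
  filter_upwards [hf] with ξ hξ
  rw [hξ]
  classical
  simp only [Set.indicator_apply, mem_closedBall_zero_iff, Set.mem_ofPred_eq]
  split_ifs <;> simp

/-- Averaging the integral over η and −η replaces q by its real part. -/
lemma integral_im_mul_of_conj_symm {q B : R3 → ℂ} (hq : ∀ η, q (-η) = conj (q η))
    (hB : ∀ η, B (-η) = B η) (hi : Integrable fun η => q η * B η) :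
    (∫ η, q η * B η).im = ∫ η, (q η).re * (B η).im := by
  have h1 : ∫ η, q η * B η = ∫ η, conj (q η) * B η := by
    rw [← integral_neg_eq_self]
    simp only [hq, hB]
  have hi' : Integrable fun η => conj (q η) * B η := by
    have := hi.comp_neg
    simpa only [hq, hB] using this
  have h2 : 2 * (∫ η, q η * B η).im = 2 * ∫ η, (q η).re * (B η).im := by
    calc 2 * (∫ η, q η * B η).im = (∫ η, (q η * B η + conj (q η) * B η)).im := by
          rw [integral_add hi hi', ← h1, Complex.add_im, two_mul]
      _ = ∫ η, (q η * B η + conj (q η) * B η).im := (integral_im (hi.add hi')).symm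
      _ = ∫ η, 2 * ((q η).re * (B η).im) := by
          congr 1
          ext η
          simp only [Complex.add_im, Complex.mul_im, Complex.conj_re, Complex.conj_im]
          ring
      _ = _ := integral_const_mul _ _
  linarith

variable {Ω : Type*} [MeasurableSpace Ω] {P : Measure Ω}

lemma im_inner_mulField_freeFlow_toLp (W : WienerIntegral P) (φ χ : 𝓢(R3, ℝ)) {f : L2 ℂ}
    (hf : ∀ᵐ ξ : R3, ‖f ξ‖ ^ 2 = Set.indicator {ξ | ‖ξ‖ ≤ 1} 1 ξ) (m t τ : ℝ) :
    2 * (inner ℂ (mulField (φ.toLp 2) (steadyState W f m t))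
      (freeFlow m (t - τ) (mulField (χ.toLp 2) (steadyState W f m τ)))).im =
      -∫ η, (conj (schwartzHat φ η) * schwartzHat χ η).re *
        responseKernel (2 * Real.pi * ‖η‖) (t - τ) := by
  rw [inner_mulField_freeFlow]
  simp only [integral_transferPhase_mul_eq_ballTransfer hf]
  have hi : Integrable fun η => (conj (schwartzHat φ η) * schwartzHat χ η) *
      ballTransfer (t - τ) η :=
    (integrable_conj_schwartzHat_mul φ χ).mul_bdd
      (c := volume.real (Metric.closedBall (0 : R3) 1))
      (stronglyMeasurable_ballTransfer _).aestronglyMeasurable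
      (Eventually.of_forall fun η => norm_ballTransfer_le _ _)
  rw [integral_im_mul_of_conj_symm (fun η => by
    simp only [schwartzHat_neg, map_mul]) (ballTransfer_neg _) hi, ← integral_const_mul,
    ← integral_neg]
  refine integral_congr_ae ?_
  filter_upwards [(measure_eq_zero_iff_ae_notMem.1 (measure_singleton (0 : R3)) :
    ∀ᵐ η : R3, η ∉ ({0} : Set R3))] with η hη
  have := ballTransfer_im (t - τ) hη
  linear_combination (conj (schwartzHat φ η) * schwartzHat χ η).re * this

end FermiBall

/-! ### Fourier multiplier forms on real L² functions -/

section WeightForm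

/-- The form `Re ∫ conj(v̂) û κ` of the Fourier multiplier `κ` on real functions. -/
def weightForm (κ : R3 → ℝ) (v u : L2 ℝ) : ℝ := ∫ η, (conj (hat v η) * hat u η).re * κ η

variable {κ : R3 → ℝ} {M : ℝ}

lemma integrable_re_conj_hat_mul (v u : L2 ℝ) :
    Integrable fun η => (conj (hat v η) * hat u η).re := by
  have := (L2.integrable_inner (𝕜 := ℂ) (hat v) (hat u)).re
  simpa only [RCLike.inner_apply', RCLike.re_to_complex] using this

lemma integrable_weightForm (hκ : Measurable κ) (hM : ∀ η, |κ η| ≤ M) (v u : L2 ℝ) :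
    Integrable fun η => (conj (hat v η) * hat u η).re * κ η :=
  (integrable_re_conj_hat_mul v u).mul_bdd hκ.aestronglyMeasurable (Eventually.of_forall hM)

lemma integral_norm_sq {α E : Type*} [MeasurableSpace α] {μ : Measure α} [NormedAddCommGroup E]
    (g : Lp E 2 μ) : ∫ x, ‖g x‖ ^ 2 ∂μ = ‖g‖ ^ 2 := by
  have h := (Lp.memLp g).eLpNorm_eq_integral_rpow_norm two_ne_zero ENNReal.ofNat_ne_top
  have h0 : 0 ≤ ∫ x, ‖g x‖ ^ 2 ∂μ := integral_nonneg fun x => sq_nonneg _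
  rw [Lp.norm_def, h, ENNReal.toReal_ofReal (by positivity)]
  simp only [ENNReal.toReal_ofNat, Real.rpow_two]
  rw [← one_div, ← Real.sqrt_eq_rpow, Real.sq_sqrt h0]

lemma abs_weightForm_le (hM : ∀ η, |κ η| ≤ M) (v u : L2 ℝ) :
    |weightForm κ v u| ≤ M * ‖v‖ * ‖u‖ := by
  have hM0 : 0 ≤ M := (abs_nonneg _).trans (hM 0)
  have h1 : Integrable fun η => ‖hat v η‖ * ‖hat u η‖ :=
    (Lp.memLp (hat v)).norm.integrable_mul (Lp.memLp (hat u)).norm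
  have h2 : ∫ η, ‖hat v η‖ * ‖hat u η‖ ≤ ‖v‖ * ‖u‖ := by
    have h := integral_mul_le_Lp_mul_Lq_of_nonneg (μ := (volume : Measure R3))
      (f := fun η => ‖hat v η‖) (g := fun η => ‖hat u η‖) (p := 2) (q := 2)
      Real.HolderConjugate.two_two
      (Eventually.of_forall fun η => norm_nonneg _) (Eventually.of_forall fun η => norm_nonneg _)
      (by simpa using (Lp.memLp (hat v)).norm) (by simpa using (Lp.memLp (hat u)).norm)
    have e : ∀ z : L2 ℝ, (∫ η, ‖hat z η‖ ^ (2 : ℝ)) ^ (1 / (2 : ℝ)) = ‖z‖ := fun z => by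
      simp only [Real.rpow_two]
      rw [integral_norm_sq, norm_hat, ← Real.sqrt_eq_rpow, Real.sqrt_sq (norm_nonneg _)]
    rwa [e, e] at h
  calc |weightForm κ v u| ≤ ∫ η, M * (‖hat v η‖ * ‖hat u η‖) := by
        refine norm_integral_le_of_norm_le (f := fun η => (conj (hat v η) * hat u η).re * κ η)
          (h1.const_mul M) (Eventually.of_forall fun η => ?_)
        rw [norm_mul, mul_comm]
        refine mul_le_mul (hM η) ?_ (norm_nonneg _) hM0
        refine (Complex.abs_re_le_norm _).trans (le_of_eq ?_)
        rw [norm_mul, RCLike.norm_conj]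
    _ ≤ M * ‖v‖ * ‖u‖ := by
        rw [integral_const_mul, mul_assoc]
        exact mul_le_mul_of_nonneg_left h2 hM0

lemma weightForm_add_left (hκ : Measurable κ) (hM : ∀ η, |κ η| ≤ M) (v v' u : L2 ℝ) :
    weightForm κ (v + v') u = weightForm κ v u + weightForm κ v' u := by
  rw [weightForm, weightForm, weightForm, ← integral_add (integrable_weightForm hκ hM v u)
    (integrable_weightForm hκ hM v' u), hat_add]
  refine integral_congr_ae ?_
  filter_upwards [Lp.coeFn_add (hat v) (hat v')] with η h
  rw [h, Pi.add_apply, map_add, add_mul, Complex.add_re, add_mul]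

lemma weightForm_smul_left (c : ℝ) (v u : L2 ℝ) :
    weightForm κ (c • v) u = c * weightForm κ v u := by
  rw [weightForm, weightForm, ← integral_const_mul, hat_smul]
  refine integral_congr_ae ?_
  filter_upwards [Lp.coeFn_smul (c : ℂ) (hat v)] with η h
  rw [h, Pi.smul_apply, smul_eq_mul, map_mul, Complex.conj_ofReal, mul_assoc, Complex.re_ofReal_mul,
    mul_assoc]

lemma weightForm_comm (v u : L2 ℝ) : weightForm κ v u = weightForm κ u v := by
  rw [weightForm, weightForm]
  congr 1
  ext η
  simp only [Complex.mul_re, Complex.conj_re, Complex.conj_im]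
  ring

lemma isBoundedBilinearMap_weightForm (hκ : Measurable κ) (hM : ∀ η, |κ η| ≤ M) :
    IsBoundedBilinearMap ℝ fun p : L2 ℝ × L2 ℝ => weightForm κ p.1 p.2 where
  add_left v v' u := weightForm_add_left hκ hM v v' u
  smul_left c v u := weightForm_smul_left c v u
  add_right v u u' := by
    simp only [weightForm_comm v]
    exact weightForm_add_left hκ hM u u' v
  smul_right c v u := by
    simp only [weightForm_comm v]
    exact weightForm_smul_left c u v
  bound := by
    have hM0 : 0 ≤ M := (abs_nonneg _).trans (hM 0)
    refine ⟨M + 1, by positivity, fun v u => (abs_weightForm_le hM v u).trans ?_⟩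
    gcongr
    linarith

lemma abs_responseKernel_le_of_nonneg {r : ℝ} (hr : 0 ≤ r) (s : ℝ) :
    |responseKernel r s| ≤ 16 * Real.pi := by
  rcases le_total 0 s with hs | hs
  · exact abs_responseKernel_le hr hs
  · rw [← neg_neg s, responseKernel_neg, abs_neg]
    exact abs_responseKernel_le hr (neg_nonneg.2 hs)

lemma measurable_responseKernel_norm (s : ℝ) :
    Measurable fun η : R3 => responseKernel (2 * Real.pi * ‖η‖) s := by
  have h1 : Measurable fun η : R3 => (2 * Real.pi * ‖η‖, s) := by fun_prop
  have h2 := measurable_responseKernel.comp h1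
  exact h2

lemma abs_responseKernel_norm_le (s : ℝ) (η : R3) :
    |responseKernel (2 * Real.pi * ‖η‖) s| ≤ 16 * Real.pi :=
  abs_responseKernel_le_of_nonneg (by positivity) s

open SchwartzMap in
lemma denseRange_schwartz_toLp :
    DenseRange fun φ : 𝓢(R3, ℝ) => (φ.toLp 2 : L2 ℝ) :=
  SchwartzMap.denseRange_toLpCLM (E := R3) (F := ℝ) (p := 2) (μ := volume) ENNReal.ofNat_ne_top

open SchwartzMap in
lemma hat_toLp_ae_eq (φ : 𝓢(R3, ℝ)) : hat (φ.toLp 2) =ᵐ[volume] schwartzHat φ := by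
  rw [hat_toLp]
  exact (schwartzHat φ).coeFn_toLp 2

variable {Ω : Type*} [MeasurableSpace Ω] {P : Measure Ω}

/-- Both sides are continuous in the pair (v, u), so the identity for Schwartz functions extends by
density. -/
lemma im_inner_mulField_freeFlow (W : WienerIntegral P) {f : L2 ℂ}
    (hf : ∀ᵐ ξ : R3, ‖f ξ‖ ^ 2 = Set.indicator {ξ | ‖ξ‖ ≤ 1} 1 ξ) (m t τ : ℝ) (v u : L2 ℝ) :
    2 * (inner ℂ (mulField v (steadyState W f m t))
      (freeFlow m (t - τ) (mulField u (steadyState W f m τ)))).im =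
      -weightForm (fun η => responseKernel (2 * Real.pi * ‖η‖) (t - τ)) v u := by
  have hb : Continuous fun p : L2 ℝ × L2 ℝ =>
      weightForm (fun η => responseKernel (2 * Real.pi * ‖η‖) (t - τ)) p.1 p.2 := by
    have h := isBoundedBilinearMap_weightForm (measurable_responseKernel_norm (t - τ))
      (abs_responseKernel_norm_le (t - τ))
    exact h.continuous
  have h1 : Continuous fun p : L2 ℝ × L2 ℝ => mulField p.1 (steadyState W f m t) :=
    continuous_mulField.comp (continuous_fst.prodMk continuous_const)
  have h2 : Continuous fun p : L2 ℝ × L2 ℝ => mulField p.2 (steadyState W f m τ) :=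
    continuous_mulField.comp (continuous_snd.prodMk continuous_const)
  have h3 : Continuous fun p : L2 ℝ × L2 ℝ =>
      freeFlow m (t - τ) (mulField p.2 (steadyState W f m τ)) := by
    have h := (freeFlowL (F := Lp ℂ 2 P) m (t - τ)).continuous.comp h2
    exact h
  have h4 : Continuous fun p : L2 ℝ × L2 ℝ => 2 * (inner ℂ (mulField p.1 (steadyState W f m t))
      (freeFlow m (t - τ) (mulField p.2 (steadyState W f m τ)))).im :=
    continuous_const.mul (Complex.continuous_im.comp (h1.inner h3))
  have h5 := (denseRange_schwartz_toLp.prodMap denseRange_schwartz_toLp).equalizer h4 hb.neg (by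
    funext ⟨φ, χ⟩
    refine (im_inner_mulField_freeFlow_toLp W φ χ hf m t τ).trans ?_
    simp only [Function.comp_apply, Prod.map_apply, weightForm]
    congr 1
    refine integral_congr_ae ?_
    filter_upwards [hat_toLp_ae_eq φ, hat_toLp_ae_eq χ] with η e1 e2
    exact congrArg₂ (fun a b => (conj a * b).re * responseKernel (2 * Real.pi * ‖η‖) (t - τ))
      e1.symm e2.symm)
  exact congrFun h5 (v, u)

end WeightForm

/-! ### Convolution as multiplication by ŵ -/

section ConvolutionTransform

open SchwartzMap

lemma isometry_hat : Isometry hat :=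
  AddMonoidHomClass.isometry_of_norm (AddMonoidHom.mk' hat hat_add) norm_hat

lemma fourier_translate (φ : 𝓢(R3, ℝ)) (y η : R3) : 𝓕 (fun x => (φ (x - y) : ℂ)) η =
    Complex.exp (Complex.I * ((-(2 * Real.pi * inner ℝ y η) : ℝ) : ℂ)) • schwartzHat φ η := by
  rw [schwartzHat_apply, Real.fourier_eq', Real.fourier_eq', ← integral_smul]
  conv_rhs => rw [← integral_sub_right_eq_self _ y]
  refine integral_congr_ae (Eventually.of_forall fun x => ?_)
  simp only [smul_eq_mul]
  rw [← mul_assoc, ← Complex.exp_add, inner_sub_left]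
  congr 2
  push_cast
  ring

lemma hat_translate (y : R3) (u : L2 ℝ) : hat (translate y u) =
    phaseMul ⟨fun η => -(2 * Real.pi * inner ℝ y η), by fun_prop⟩ (hat u) := by
  have h1 : Continuous fun u : L2 ℝ => hat (translate y u) :=
    isometry_hat.continuous.comp (Lp.isometry_compMeasurePreserving _).continuous
  have h2 : Continuous fun u : L2 ℝ =>
      phaseMul ⟨fun η => -(2 * Real.pi * inner ℝ y η), by fun_prop⟩ (hat u) := by
    refine Isometry.continuous (isometry_iff_dist_eq.2 fun u v => ?_)
    rw [dist_eq_norm, ← phaseMul_sub, norm_phaseMul, ← dist_eq_norm, isometry_hat.dist_eq]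
  have h3 := denseRange_schwartz_toLp.equalizer h1 h2 (by
    funext φ
    simp only [Function.comp_apply]
    have i1 : Integrable fun x => ((φ (x - y) : ℝ) : ℂ) := (φ.integrable.comp_sub_right y).ofReal
    have i2 : MemLp (fun x => ((φ (x - y) : ℝ) : ℂ)) 2 :=
      ((φ.memLp 2).comp_measurePreserving (measurePreserving_sub_right volume y)).ofReal
    have e1 : cplx (translate y (φ.toLp 2)) = i2.toLp := by
      ext1
      filter_upwards [coeFn_cplx (translate y (φ.toLp 2)), i2.coeFn_toLp,
        Lp.coeFn_compMeasurePreserving (φ.toLp 2) (measurePreserving_sub_right volume y),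
        (measurePreserving_sub_right volume y).quasiMeasurePreserving.ae_eq_comp
          (φ.coeFn_toLp 2)]
        with x a1 a2 a3 a4
      rw [a1, a2, translate, a3, Function.comp_apply]
      exact congrArg _ a4
    rw [hat, e1]
    ext1
    filter_upwards [fourier_toLp_ae_eq i1 i2, hat_toLp_ae_eq φ,
      coeFn_phaseMul ⟨fun η => -(2 * Real.pi * inner ℝ y η), by fun_prop⟩ (hat (φ.toLp 2))]
      with η a1 a2 a3
    rw [a1, fourier_translate]
    exact ((a3.trans (congrArg _ a2))).symm)
  exact congrFun h3 u

variable {κ : R3 → ℝ} {M : ℝ}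

lemma weightForm_translate (y : R3) (v u : L2 ℝ) : weightForm κ v (translate y u) =
    ∫ η, (conj (hat v η) * hat u η *
      Complex.exp (-Complex.I * ((inner ℝ y ((2 * Real.pi) • η) : ℝ) : ℂ))).re * κ η := by
  rw [weightForm, hat_translate]
  refine integral_congr_ae ?_
  filter_upwards [coeFn_phaseMul ⟨fun η => -(2 * Real.pi * inner ℝ y η), by fun_prop⟩ (hat u)]
    with η h
  have e : Complex.exp (Complex.I * ((-(2 * Real.pi * inner ℝ y η) : ℝ) : ℂ)) =
      Complex.exp (-Complex.I * ((inner ℝ y ((2 * Real.pi) • η) : ℝ) : ℂ)) := by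
    rw [inner_smul_right]
    congr 1
    push_cast
    ring
  rw [h, ContinuousMap.coe_mk, e, smul_eq_mul, mul_left_comm, mul_comm]
  ring_nf

/-- The bounded form passes under the L²-valued integral, and Fubini collects the phases of the
translations into the Fourier transform of μ at 2πη. -/
lemma weightForm_integral_translate (hκ : Measurable κ) (hM : ∀ η, |κ η| ≤ M) (μ : Measure R3)
    [IsFiniteMeasure μ] (v u : L2 ℝ) : weightForm κ v (∫ y, translate y u ∂μ) =
      ∫ η, (conj (hat v η) * hat u η *
        ∫ y, Complex.exp (-Complex.I * ((inner ℝ y ((2 * Real.pi) • η) : ℝ) : ℂ)) ∂μ).re * κ η := by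
  let T : L2 ℝ →L[ℝ] ℝ :=
    ((isBoundedBilinearMap_weightForm hκ hM).isBoundedLinearMap_right v).toContinuousLinearMap
  have h1 : weightForm κ v (∫ y, translate y u ∂μ) = ∫ y, weightForm κ v (translate y u) ∂μ :=
    (T.integral_comp_comm (integrable_translate μ u)).symm
  have hc : Continuous fun p : R3 × R3 =>
      Complex.exp (-Complex.I * ((inner ℝ p.1 ((2 * Real.pi) • p.2) : ℝ) : ℂ)) := by fun_prop
  have hn : ∀ y η : R3, ‖Complex.exp (-Complex.I *
      ((inner ℝ y ((2 * Real.pi) • η) : ℝ) : ℂ))‖ ≤ 1 := fun y η => by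
    rw [neg_mul, ← mul_neg, ← Complex.ofReal_neg, mul_comm, Complex.norm_exp_ofReal_mul_I]
  have hq : Integrable fun η => conj (hat v η) * hat u η * (κ η : ℂ) := by
    have h := L2.integrable_inner (𝕜 := ℂ) (hat v) (hat u)
    simp only [RCLike.inner_apply'] at h
    refine h.mul_bdd (c := M) (Complex.measurable_ofReal.comp hκ).aestronglyMeasurable
      (Eventually.of_forall fun η => ?_)
    exact (Complex.norm_real _).trans_le (hM η)
  have hi : Integrable (fun p : R3 × R3 => (conj (hat v p.2) * hat u p.2 *
      Complex.exp (-Complex.I * ((inner ℝ p.1 ((2 * Real.pi) • p.2) : ℝ) : ℂ))).re * κ p.2)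
      (μ.prod volume) := by
    have h := ((hq.comp_snd μ).bdd_mul (c := 1) hc.aestronglyMeasurable
      (Eventually.of_forall fun p => hn p.1 p.2)).re
    refine h.congr (Eventually.of_forall fun p => ?_)
    simp only [RCLike.re_to_complex]
    rw [← Complex.re_mul_ofReal]
    ring_nf
  rw [h1]
  simp only [weightForm_translate]
  rw [integral_integral_swap (f := fun y η => (conj (hat v η) * hat u η *
      Complex.exp (-Complex.I * ((inner ℝ y ((2 * Real.pi) • η) : ℝ) : ℂ))).re * κ η) hi]
  refine integral_congr_ae (Eventually.of_forall fun η => ?_)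
  have h2 : Integrable (fun y : R3 => conj (hat v η) * hat u η *
      Complex.exp (-Complex.I * ((inner ℝ y ((2 * Real.pi) • η) : ℝ) : ℂ))) μ := by
    refine Integrable.const_mul ((integrable_const (1 : ℝ)).mono' ?_
      (Eventually.of_forall fun y => hn y η)) _
    exact (by fun_prop : Continuous fun y : R3 =>
      Complex.exp (-Complex.I * ((inner ℝ y ((2 * Real.pi) • η) : ℝ) : ℂ))).aestronglyMeasurable
  simp only
  rw [integral_mul_const, ← integral_const_mul]
  congr 1
  exact integral_re h2

lemma norm_integral_exp_le (μ : Measure R3) [IsFiniteMeasure μ] (ξ : R3) :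
    ‖∫ x, Complex.exp (-Complex.I * ((inner ℝ x ξ : ℝ) : ℂ)) ∂μ‖ ≤ μ.real Set.univ := by
  have := norm_integral_le_of_norm_le_const (μ := μ) (C := 1)
    (f := fun x : R3 => Complex.exp (-Complex.I * ((inner ℝ x ξ : ℝ) : ℂ)))
    (Eventually.of_forall fun x => by
      rw [neg_mul, ← mul_neg, ← Complex.ofReal_neg, mul_comm, Complex.norm_exp_ofReal_mul_I])
  rwa [one_mul] at this

lemma measurable_fourierMeasure (w : SignedMeasure R3) : Measurable (fourierMeasure w) := by
  have h : ∀ (μ : Measure R3) [IsFiniteMeasure μ], Measurable fun ξ : R3 =>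
      ∫ x, Complex.exp (-Complex.I * ((inner ℝ x ξ : ℝ) : ℂ)) ∂μ := fun μ _ =>
    ((by fun_prop : Continuous fun p : R3 × R3 => Complex.exp
      (-Complex.I * ((inner ℝ p.2 p.1 : ℝ) : ℂ))).stronglyMeasurable.integral_prod_right
      (ν := μ)).measurable
  exact (h _).sub (h _)

lemma exists_norm_fourierMeasure_le (w : SignedMeasure R3) :
    ∃ M, ∀ ξ, ‖fourierMeasure w ξ‖ ≤ M :=
  ⟨_, fun ξ => (norm_sub_le _ _).trans (add_le_add (norm_integral_exp_le _ ξ)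
    (norm_integral_exp_le _ ξ))⟩

/-- Convolution with a signed measure is the Fourier multiplier `ŵ`. -/
lemma weightForm_conv (hκ : Measurable κ) (hM : ∀ η, |κ η| ≤ M) {w : SignedMeasure R3}
    (hw : ∀ ξ, (fourierMeasure w ξ).im = 0) (v u : L2 ℝ) : weightForm κ v (convL w u) =
      weightForm (fun η => (fourierMeasure w ((2 * Real.pi) • η)).re * κ η) v u := by
  have hb := isBoundedBilinearMap_weightForm hκ hM
  have h0 : ∀ a b : L2 ℝ, weightForm κ v (a - b) = weightForm κ v a - weightForm κ v b :=
    fun a b => hb.map_sub_right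
  have hi : ∀ (μ : Measure R3) [IsFiniteMeasure μ], Integrable fun η => (conj (hat v η) * hat u η *
        ∫ y, Complex.exp (-Complex.I * ((inner ℝ y ((2 * Real.pi) • η) : ℝ) : ℂ)) ∂μ).re * κ η := by
    intro μ _
    have h := L2.integrable_inner (𝕜 := ℂ) (hat v) (hat u)
    simp only [RCLike.inner_apply'] at h
    have hm : StronglyMeasurable fun η : R3 => ∫ y, Complex.exp
        (-Complex.I * ((inner ℝ y ((2 * Real.pi) • η) : ℝ) : ℂ)) ∂μ :=
      (by fun_prop : Continuous fun p : R3 × R3 => Complex.exp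
        (-Complex.I * ((inner ℝ p.2 ((2 * Real.pi) • p.1) : ℝ) : ℂ))).stronglyMeasurable.integral_prod_right
    exact (h.mul_bdd hm.aestronglyMeasurable (Eventually.of_forall fun η =>
      norm_integral_exp_le μ _)).re.mul_bdd hκ.aestronglyMeasurable (Eventually.of_forall hM)
  rw [convL_apply, conv, h0, weightForm_integral_translate hκ hM,
    weightForm_integral_translate hκ hM, ← integral_sub (hi _) (hi _), weightForm]
  congr 1
  ext η
  rw [← sub_mul, ← Complex.sub_re, ← mul_sub]
  change (_ * fourierMeasure w ((2 * Real.pi) • η)).re * κ η = _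
  -- Since ŵ is real, it can be taken out of the real part.
  rw [Complex.mul_re, hw, mul_zero, sub_zero, mul_assoc]

end ConvolutionTransform

/-! ### From causal to symmetric forms -/

section PairIntegral

/-- A field of amplitudes `b(t, η)` that lives on the times `t ∈ I` and is square integrable
in `η` uniformly in the time. -/
structure IsAmplitude (I : Set ℝ) (h : R3 → ℝ) (b : ℝ → R3 → ℂ) : Prop where
  measurableSet : MeasurableSet I
  measure_ne_top : volume I ≠ ∞
  integrable : Integrable h
  measurable : Measurable (Function.uncurry b)
  bound : ∀ t η, ‖b t η‖ ^ 2 ≤ I.indicator 1 t * h η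

/-- The form of the kernel `κ(η, |t - τ|)` integrated over `η`. -/
def pairIntegral (κ : R3 → ℝ → ℝ) (b : ℝ → R3 → ℂ) (p : ℝ × ℝ) : ℝ :=
  ∫ η, κ η |p.1 - p.2| * (conj (b p.1 η) * b p.2 η).re

variable {I : Set ℝ} {h : R3 → ℝ} {b : ℝ → R3 → ℂ} {κ : R3 → ℝ → ℝ} {M : ℝ}

namespace IsAmplitude

lemma integrable_indicator (hb : IsAmplitude I h b) : Integrable (I.indicator (1 : ℝ → ℝ)) :=
  (integrable_indicator_iff hb.measurableSet).2 (integrableOn_const hb.measure_ne_top)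

lemma restrict (hb : IsAmplitude I h b) {J : Set ℝ} (hJ : MeasurableSet J) :
    IsAmplitude I h (fun t η => J.indicator (fun _ => b t η) t) where
  measurableSet := hb.measurableSet
  measure_ne_top := hb.measure_ne_top
  integrable := hb.integrable
  measurable := by
    have h1 : (Function.uncurry fun t η => J.indicator (fun _ => b t η) t) =
        (Prod.fst ⁻¹' J).indicator (Function.uncurry b) := by
      ext ⟨t, η⟩
      classical
      simp only [Function.uncurry, Set.indicator_apply, Set.mem_preimage]
    rw [h1]
    exact hb.measurable.indicator (measurable_fst hJ)
  bound t η := by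
    refine le_trans ?_ (hb.bound t η)
    classical
    simp only [Set.indicator_apply]
    split_ifs
    · exact le_rfl
    · simp

lemma integrable_norm_sq (hb : IsAmplitude I h b) :
    Integrable (fun p : ℝ × R3 => ‖b p.1 p.2‖ ^ 2) (volume.prod volume) := by
  refine (hb.integrable_indicator.mul_prod hb.integrable).mono'
    (hb.measurable.norm.pow_const 2).aestronglyMeasurable (Eventually.of_forall fun p => ?_)
  rw [Real.norm_of_nonneg (sq_nonneg _)]
  exact hb.bound p.1 p.2

lemma norm_mul_norm_le (hb : IsAmplitude I h b) (t τ : ℝ) (η : R3) :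
    ‖b t η‖ * ‖b τ η‖ ≤ I.indicator 1 t * I.indicator 1 τ * h η := by
  have h1 := hb.bound t η
  have h2 := hb.bound τ η
  have n1 := norm_nonneg (b t η)
  have n2 := norm_nonneg (b τ η)
  by_cases ht : t ∈ I <;> by_cases hτ : τ ∈ I <;>
    simp only [ht, hτ, Set.indicator_of_mem, Set.indicator_of_notMem, not_false_eq_true,
      Pi.one_apply, one_mul, zero_mul, mul_zero] at h1 h2 ⊢ <;>
    nlinarith [sq_nonneg (‖b t η‖ - ‖b τ η‖)]

lemma memLp (hb : IsAmplitude I h b) (η : R3) : MemLp (fun t => b t η) 2 := by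
  have hm : Measurable fun t => b t η := hb.measurable.comp measurable_prodMk_right
  rw [memLp_two_iff_integrable_sq_norm hm.aestronglyMeasurable]
  refine (hb.integrable_indicator.mul_const (h η)).mono' (hm.norm.pow_const 2).aestronglyMeasurable
    (Eventually.of_forall fun t => ?_)
  rw [Real.norm_of_nonneg (sq_nonneg _)]
  exact hb.bound t η

lemma integrable_apply (hb : IsAmplitude I h b) (η : R3) : Integrable fun t => b t η := by
  have hm : Measurable fun t => b t η := hb.measurable.comp measurable_prodMk_right
  refine (hb.integrable_indicator.mul_const (h η + 1)).mono' hm.aestronglyMeasurable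
    (Eventually.of_forall fun t => ?_)
  have h1 := hb.bound t η
  have n1 := norm_nonneg (b t η)
  by_cases ht : t ∈ I <;>
    simp only [ht, Set.indicator_of_mem, Set.indicator_of_notMem, not_false_eq_true,
      Pi.one_apply, one_mul, zero_mul] at h1 ⊢ <;> nlinarith [sq_nonneg (‖b t η‖ - 1)]

lemma integrable_pair (hb : IsAmplitude I h b) (hκ : Measurable (Function.uncurry κ))
    (hM : ∀ η s, |κ η s| ≤ M) :
    Integrable (fun q : (ℝ × ℝ) × R3 => κ q.2 |q.1.1 - q.1.2| *
      (conj (b q.1.1 q.2) * b q.1.2 q.2).re) (volume.prod volume) := by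
  have h0 : Integrable (fun q : (ℝ × ℝ) × R3 =>
      I.indicator (1 : ℝ → ℝ) q.1.1 * I.indicator (1 : ℝ → ℝ) q.1.2 * h q.2)
      (volume.prod volume) :=
    (hb.integrable_indicator.mul_prod hb.integrable_indicator).mul_prod hb.integrable
  have hm : Measurable fun q : (ℝ × ℝ) × R3 => κ q.2 |q.1.1 - q.1.2| *
      (conj (b q.1.1 q.2) * b q.1.2 q.2).re := by
    have m1 : Measurable fun q : (ℝ × ℝ) × R3 => κ q.2 |q.1.1 - q.1.2| :=
      hκ.comp (by fun_prop : Measurable fun q : (ℝ × ℝ) × R3 => (q.2, |q.1.1 - q.1.2|))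
    have m2 : Measurable fun q : (ℝ × ℝ) × R3 => b q.1.1 q.2 :=
      hb.measurable.comp (by fun_prop : Measurable fun q : (ℝ × ℝ) × R3 => (q.1.1, q.2))
    have m3 : Measurable fun q : (ℝ × ℝ) × R3 => b q.1.2 q.2 :=
      hb.measurable.comp (by fun_prop : Measurable fun q : (ℝ × ℝ) × R3 => (q.1.2, q.2))
    exact m1.mul (Complex.measurable_re.comp ((Complex.continuous_conj.measurable.comp m2).mul m3))
  refine (h0.const_mul M).mono' hm.aestronglyMeasurable (Eventually.of_forall fun q => ?_)
  rw [norm_mul]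
  have hM0 : 0 ≤ M := (abs_nonneg _).trans (hM 0 0)
  refine mul_le_mul (hM _ _) ?_ (norm_nonneg _) hM0
  refine ((Complex.abs_re_le_norm _).trans (le_of_eq ?_)).trans
    (hb.norm_mul_norm_le q.1.1 q.1.2 q.2)
  rw [norm_mul, RCLike.norm_conj]

lemma integrable_pairIntegral (hb : IsAmplitude I h b) (hκ : Measurable (Function.uncurry κ))
    (hM : ∀ η s, |κ η s| ≤ M) : Integrable (pairIntegral κ b) :=
  (hb.integrable_pair hκ hM).integral_prod_left

/-- Fubini reduces the estimate to the scalar form at fixed η; the excluded frequency 0 has measure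
zero. -/
lemma integral_pairIntegral_le (hb : IsAmplitude I h b) (hκ : Measurable (Function.uncurry κ))
    (hM : ∀ η s, |κ η s| ≤ M) (hκ1 : ∀ η, η ≠ 0 → FormLE (κ η) 1) :
    ∫ p, pairIntegral κ b p ≤ ∫ t, ∫ η, ‖b t η‖ ^ 2 := by
  have h1 : ∫ p, pairIntegral κ b p = ∫ η, pairForm (κ η) (fun t => b t η) :=
    integral_integral_swap (f := fun (p : ℝ × ℝ) (η : R3) =>
      κ η |p.1 - p.2| * (conj (b p.1 η) * b p.2 η).re) (hb.integrable_pair hκ hM)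
  have h2 : ∫ t, ∫ η, ‖b t η‖ ^ 2 = ∫ η, ∫ t, ‖b t η‖ ^ 2 :=
    integral_integral_swap (f := fun (t : ℝ) (η : R3) => ‖b t η‖ ^ 2) hb.integrable_norm_sq
  rw [h1, h2]
  refine integral_mono_ae (hb.integrable_pair hκ hM).integral_prod_right
    hb.integrable_norm_sq.integral_prod_right ?_
  filter_upwards [(measure_eq_zero_iff_ae_notMem.1 (measure_singleton (0 : R3)) :
    ∀ᵐ η : R3, η ∉ ({0} : Set R3))] with η hη
  have := hκ1 η hη _ (hb.integrable_apply η) (hb.memLp η)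
  rwa [one_mul] at this

end IsAmplitude

lemma pairIntegral_swap (κ : R3 → ℝ → ℝ) (b : ℝ → R3 → ℂ) (p : ℝ × ℝ) :
    pairIntegral κ b p.swap = pairIntegral κ b p := by
  simp only [pairIntegral, Prod.fst_swap, Prod.snd_swap, abs_sub_comm p.2 p.1]
  congr 1
  ext η
  simp only [Complex.mul_re, Complex.conj_re, Complex.conj_im]
  ring

lemma pairIntegral_diag (h0 : ∀ η, κ η 0 = 0) (b : ℝ → R3 → ℂ) (t : ℝ) :
    pairIntegral κ b (t, t) = 0 := by
  simp [pairIntegral, h0]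

lemma pairIntegral_restrict (κ : R3 → ℝ → ℝ) (b : ℝ → R3 → ℂ) (J : Set ℝ) (p : ℝ × ℝ) :
    pairIntegral κ (fun t η => J.indicator (fun _ => b t η) t) p =
      (J ×ˢ J).indicator (pairIntegral κ b) p := by
  classical
  by_cases h1 : p.1 ∈ J <;> by_cases h2 : p.2 ∈ J <;>
    simp [pairIntegral, h1, h2]

/-- The causal half of a symmetric form, split according to the sign of the times. -/
lemma pairIntegral_causal (h0 : ∀ η, κ η 0 = 0) (b : ℝ → R3 → ℂ) (p : ℝ × ℝ) :
    (Set.uIoc 0 p.1).indicator (fun τ => pairIntegral κ b (p.1, τ)) p.2 +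
      (Set.uIoc 0 p.2).indicator (fun τ => pairIntegral κ b (p.2, τ)) p.1 =
      pairIntegral κ (fun t η => (Set.Ioi 0).indicator (fun _ => b t η) t) p +
      pairIntegral κ (fun t η => (Set.Iic 0).indicator (fun _ => b t η) t) p := by
  obtain ⟨t, τ⟩ := p
  have hs : pairIntegral κ b (τ, t) = pairIntegral κ b (t, τ) := pairIntegral_swap κ b (t, τ)
  -- Times of opposite sign contribute to neither side. For distinct times of the same sign exactly
  -- one of the two intervals contains the other time, and on the diagonal the kernel vanishes.
  simp only [pairIntegral_restrict]
  classical
  simp only [Set.indicator_apply, Set.mem_uIoc, Set.mem_prod, Set.mem_Ioi, Set.mem_Iic, hs]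
  rcases lt_trichotomy t τ with h | rfl | h
  · split_ifs <;> grind
  · simp [pairIntegral_diag h0]
  · split_ifs <;> grind

/-- The causal region consists of the triangles 0 < τ ≤ t and t < τ ≤ 0. Adding its mirror image
fills the squares of positive and of negative times, where the symmetric bound applies; each causal
part is half of a square, whence the division by 2. -/
lemma IsAmplitude.integral_causal_le (hb : IsAmplitude I h b)
    (hκ : Measurable (Function.uncurry κ)) (hM : ∀ η s, |κ η s| ≤ M)
    (hκ1 : ∀ η, η ≠ 0 → FormLE (κ η) 1) (h0 : ∀ η, κ η 0 = 0) :
    ∫ t, ∫ τ in Set.uIoc 0 t, pairIntegral κ b (t, τ) ≤ (∫ t, ∫ η, ‖b t η‖ ^ 2) / 2 := by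
  let E : Set (ℝ × ℝ) := {p | p.2 ∈ Set.uIoc 0 p.1}
  have hE : MeasurableSet E := by
    have : E = {p : ℝ × ℝ | min 0 p.1 < p.2} ∩ {p | p.2 ≤ max 0 p.1} := by
      ext p
      simp [E, Set.uIoc]
    rw [this]
    exact (measurableSet_lt (by fun_prop) (by fun_prop)).inter
      (measurableSet_le (by fun_prop) (by fun_prop))
  have hi : Integrable (E.indicator (pairIntegral κ b)) :=
    (hb.integrable_pairIntegral hκ hM).indicator hE
  have hp := hb.restrict (J := Set.Ioi 0) measurableSet_Ioi
  have hn := hb.restrict (J := Set.Iic 0) measurableSet_Iic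
  have e1 : ∫ t, ∫ τ in Set.uIoc 0 t, pairIntegral κ b (t, τ) =
      ∫ p, E.indicator (pairIntegral κ b) p := by
    refine Eq.trans ?_ (integral_prod (μ := (volume : Measure ℝ)) (ν := (volume : Measure ℝ))
      _ hi).symm
    congr 1
    ext t
    rw [← integral_indicator measurableSet_uIoc]
    rfl
  have e2 : ∫ p, E.indicator (pairIntegral κ b) p =
      ∫ p : ℝ × ℝ, E.indicator (pairIntegral κ b) p.swap :=
    (integral_prod_swap (μ := (volume : Measure ℝ)) (ν := (volume : Measure ℝ)) _).symm
  have e3 : 2 * ∫ p, E.indicator (pairIntegral κ b) p =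
      (∫ p, pairIntegral κ (fun t η => (Set.Ioi 0).indicator (fun _ => b t η) t) p) +
      ∫ p, pairIntegral κ (fun t η => (Set.Iic 0).indicator (fun _ => b t η) t) p := by
    have hi' : Integrable fun p : ℝ × ℝ => E.indicator (pairIntegral κ b) p.swap := hi.swap
    rw [two_mul]
    nth_rw 2 [e2]
    rw [← integral_add hi hi', ← integral_add (hp.integrable_pairIntegral hκ hM)
      (hn.integrable_pairIntegral hκ hM)]
    congr 1
    ext p
    rw [← pairIntegral_causal h0 b p]
    rfl
  have e4 : ∫ t, ∫ η, ‖b t η‖ ^ 2 =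
      (∫ t, ∫ η, ‖(Set.Ioi (0 : ℝ)).indicator (fun _ => b t η) t‖ ^ 2) +
      ∫ t, ∫ η, ‖(Set.Iic (0 : ℝ)).indicator (fun _ => b t η) t‖ ^ 2 := by
    rw [← integral_add hp.integrable_norm_sq.integral_prod_left
      hn.integrable_norm_sq.integral_prod_left]
    congr 1
    ext t
    classical
    rcases lt_or_ge 0 t with ht | ht
    · simp [ht, not_le.2 ht]
    · simp [ht, not_lt.2 ht]
  have i1 := hp.integral_pairIntegral_le hκ hM hκ1
  have i2 := hn.integral_pairIntegral_le hκ hM hκ1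
  rw [e1]
  linarith

end PairIntegral

/-! ### Operators on L²_t L²_x and time windows -/

section Truncation

/-- The bounded operator on `L²_t L²_x` given by a family of functions of the time. -/
def timeOperator (T : L2tx → ℝ → L2 ℝ) (hT : ∀ u, MemLp (T u) 2)
    (hadd : ∀ u v, T (u + v) =ᵐ[volume] T u + T v)
    (hsmul : ∀ (a : ℝ) u, T (a • u) =ᵐ[volume] a • T u) (C : ℝ)
    (hC : ∀ u, ∫ t, ‖T u t‖ ^ 2 ≤ (C * ‖u‖) ^ 2) (hC0 : 0 ≤ C) : L2tx →L[ℝ] L2tx :=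
  LinearMap.mkContinuous
    { toFun := fun u => (hT u).toLp
      map_add' := fun u v =>
        (MemLp.toLp_congr (hT (u + v)) ((hT u).add (hT v)) (hadd u v)).trans
          (MemLp.toLp_add (hT u) (hT v))
      map_smul' := fun a u =>
        (MemLp.toLp_congr (hT (a • u)) ((hT u).const_smul a) (hsmul a u)).trans
          (MemLp.toLp_const_smul a (hT u)) } C fun u => by
    refine le_of_sq_le_sq ?_ (mul_nonneg hC0 (norm_nonneg u))
    refine le_trans (le_of_eq ?_) (hC u)
    rw [← integral_norm_sq]
    refine integral_congr_ae ?_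
    filter_upwards [(hT u).coeFn_toLp] with t h
    exact congrArg (fun z => ‖z‖ ^ 2) h

lemma coeFn_timeOperator {T : L2tx → ℝ → L2 ℝ} (hT : ∀ u, MemLp (T u) 2)
    (hadd : ∀ u v, T (u + v) =ᵐ[volume] T u + T v)
    (hsmul : ∀ (a : ℝ) u, T (a • u) =ᵐ[volume] a • T u) (C : ℝ)
    (hC : ∀ u, ∫ t, ‖T u t‖ ^ 2 ≤ (C * ‖u‖) ^ 2) (hC0 : 0 ≤ C) (u : L2tx) :
    timeOperator T hT hadd hsmul C hC hC0 u =ᵐ[volume] T u := (hT u).coeFn_toLp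

/-- Multiplication by the indicator function of a time set. -/
def truncate {S : Set ℝ} (hS : MeasurableSet S) : L2tx →L[ℝ] L2tx :=
  timeOperator (fun u => S.indicator u) (fun u => (Lp.memLp u).indicator hS)
    (fun u v => by
      filter_upwards [Lp.coeFn_add u v] with t h
      by_cases ht : t ∈ S
      · simp only [ht, Set.indicator_of_mem, Pi.add_apply]
        exact h
      · simp [ht])
    (fun a u => by
      filter_upwards [Lp.coeFn_smul a u] with t h
      by_cases ht : t ∈ S <;> simp [ht, h])
    1 (fun u => by
      rw [one_mul, ← integral_norm_sq]
      refine integral_mono ((Lp.memLp u).indicator hS).norm.integrable_sq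
        (Lp.memLp u).norm.integrable_sq fun t => ?_
      exact pow_le_pow_left₀ (norm_nonneg _) (norm_indicator_le_norm_self _ _) 2) zero_le_one

lemma coeFn_truncate {S : Set ℝ} (hS : MeasurableSet S) (u : L2tx) :
    truncate hS u =ᵐ[volume] S.indicator u := coeFn_timeOperator _ _ _ _ _ _ u

/-- The time window `[-n, n]`. -/
def window (n : ℕ) : Set ℝ := Set.Icc (-n : ℝ) n

lemma measurableSet_window (n : ℕ) : MeasurableSet (window n) := measurableSet_Icc

lemma window_mono {n k : ℕ} (h : n ≤ k) : window n ⊆ window k := by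
  have : (n : ℝ) ≤ k := by exact_mod_cast h
  exact Set.Icc_subset_Icc (neg_le_neg this) this

lemma uIoc_subset_window {n : ℕ} {t : ℝ} (ht : t ∈ window n) : Set.uIoc 0 t ⊆ window n := by
  intro τ hτ
  rcases Set.mem_uIoc.1 hτ with h | h
  · exact ⟨by linarith [ht.1, ht.2, h.1], h.2.trans ht.2⟩
  · exact ⟨ht.1.trans h.1.le, h.2.trans (Nat.cast_nonneg n)⟩

lemma exists_mem_window (t : ℝ) : ∃ n, ∀ k, n ≤ k → t ∈ window k := by
  obtain ⟨n, hn⟩ := exists_nat_ge |t|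
  exact ⟨n, fun k hk => window_mono hk (abs_le.1 hn)⟩

lemma tendsto_truncate_window (u : L2tx) :
    Tendsto (fun n => truncate (measurableSet_window n) u) atTop (𝓝 u) := by
  rw [tendsto_iff_norm_sub_tendsto_zero]
  have h1 : ∀ n, ‖truncate (measurableSet_window n) u - u‖ ^ 2 =
      ∫ t, (window n)ᶜ.indicator (fun t => ‖u t‖ ^ 2) t := fun n => by
    rw [← integral_norm_sq]
    refine integral_congr_ae ?_
    filter_upwards [coeFn_truncate (measurableSet_window n) u,
      Lp.coeFn_sub (truncate (measurableSet_window n) u) u] with t h1 h2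
    rw [h2, Pi.sub_apply, h1]
    by_cases ht : t ∈ window n <;> simp [ht]
  have h2 : Tendsto (fun n : ℕ => ∫ t, (window n)ᶜ.indicator (fun t => ‖u t‖ ^ 2) t) atTop
      (𝓝 (∫ _ : ℝ, (0 : ℝ))) := by
    refine tendsto_integral_of_dominated_convergence (fun t => ‖u t‖ ^ 2) (fun n => ?_)
      (Lp.memLp u).norm.integrable_sq (fun n => Eventually.of_forall fun t => ?_)
      (Eventually.of_forall fun t => ?_)
    · exact ((Lp.memLp u).norm.integrable_sq.indicator
        (measurableSet_window n).compl).aestronglyMeasurable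
    · refine (norm_indicator_le_norm_self _ _).trans (le_of_eq ?_)
      rw [Real.norm_of_nonneg (sq_nonneg _)]
    · obtain ⟨n, hn⟩ := exists_mem_window t
      refine tendsto_const_nhds.congr' ?_
      filter_upwards [eventually_ge_atTop n] with k hk
      rw [Set.indicator_of_notMem]
      exact fun h => h (hn k hk)
  rw [integral_zero] at h2
  have h3 := h2.sqrt
  simp only [← h1, Real.sqrt_sq (norm_nonneg _), Real.sqrt_zero] at h3
  exact h3

lemma truncate_truncate {n k : ℕ} (h : n ≤ k) (u : L2tx) :
    truncate (measurableSet_window n) (truncate (measurableSet_window k) u) =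
      truncate (measurableSet_window n) u := by
  ext1
  filter_upwards [coeFn_truncate (measurableSet_window n) (truncate (measurableSet_window k) u),
    coeFn_truncate (measurableSet_window k) u, coeFn_truncate (measurableSet_window n) u]
    with t h1 h2 h3
  rw [h1, h3]
  by_cases ht : t ∈ window n
  · simp only [ht, Set.indicator_of_mem, h2, window_mono h ht]
  · simp only [ht, Set.indicator_of_notMem, not_false_eq_true]

lemma inner_truncate {S : Set ℝ} (hS : MeasurableSet S) (u v : L2tx) :
    inner ℝ (truncate hS u) v = inner ℝ u (truncate hS v) := by
  rw [L2.inner_def, L2.inner_def]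
  refine integral_congr_ae ?_
  filter_upwards [coeFn_truncate hS u, coeFn_truncate hS v] with t h1 h2
  rw [h1, h2]
  by_cases ht : t ∈ S <;> simp [ht]

lemma intervalIntegrable_coe (u : L2tx) (a b : ℝ) : IntervalIntegrable u volume a b :=
  (((Lp.memLp u).locallyIntegrable one_le_two).integrableOn_isCompact
    isCompact_uIcc).intervalIntegrable

lemma setIntegral_norm_le (u : L2tx) {S : Set ℝ} (hS : volume S ≠ ∞) :
    ∫ τ in S, ‖u τ‖ ≤ √(volume.real S) * ‖u‖ := by
  have : IsFiniteMeasure ((volume : Measure ℝ).restrict S) := ⟨by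
    rw [Measure.restrict_apply_univ]; exact hS.lt_top⟩
  have h := integral_mul_le_Lp_mul_Lq_of_nonneg (μ := (volume : Measure ℝ).restrict S)
    (f := fun _ => (1 : ℝ)) (g := fun τ => ‖u τ‖) (p := 2) (q := 2)
    Real.HolderConjugate.two_two (Eventually.of_forall fun _ => zero_le_one)
    (Eventually.of_forall fun _ => norm_nonneg _) (memLp_const 1)
    (by simpa using ((Lp.memLp u).restrict S).norm)
  simp only [one_mul, Real.rpow_two, one_pow, ← Real.sqrt_eq_rpow] at h
  rw [setIntegral_const, smul_eq_mul, mul_one] at h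
  refine h.trans (mul_le_mul_of_nonneg_left ?_ (Real.sqrt_nonneg _))
  rw [← Real.sqrt_sq (norm_nonneg u), ← integral_norm_sq]
  exact Real.sqrt_le_sqrt (setIntegral_le_integral (Lp.memLp u).norm.integrable_sq
    (Eventually.of_forall fun _ => sq_nonneg _))

end Truncation

/-! ### The response operator on a window -/

section ResponseOperator

variable {F : Type*} [NormedAddCommGroup F] [InnerProductSpace ℂ F] [CompleteSpace F]
variable {m : ℝ} {Y : ℝ → R3 →ᵇ F} {K : L2 ℝ →L[ℝ] L2 ℝ} {c : ℝ}

lemma norm_response_window_le (hYc : ∀ t, ‖Y t‖ ≤ c) (u : L2tx) {n : ℕ} {t : ℝ}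
    (ht : t ∈ window n) : ‖response m Y K u t‖ ≤
      2 * c ^ 2 * ‖K‖ * (√(volume.real (window n)) * ‖u‖) := by
  refine (norm_response_le hYc (intervalIntegrable_coe u) t).trans ?_
  refine mul_le_mul_of_nonneg_left ?_ (by positivity)
  refine le_trans ?_ (setIntegral_norm_le u (S := window n) measure_Icc_lt_top.ne)
  have hi : IntegrableOn u (window n) :=
    ((Lp.memLp u).locallyIntegrable one_le_two).integrableOn_isCompact isCompact_Icc
  exact setIntegral_mono_set hi.norm (Eventually.of_forall fun _ => norm_nonneg _)
    (uIoc_subset_window ht).eventuallyLE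

lemma memLp_response_window (hY : Continuous Y) (hYc : ∀ t, ‖Y t‖ ≤ c) (u : L2tx) (n : ℕ) :
    MemLp ((window n).indicator (response m Y K u)) 2 := by
  rw [memLp_indicator_iff_restrict (measurableSet_window n)]
  have : IsFiniteMeasure ((volume : Measure ℝ).restrict (window n)) := ⟨by
    rw [Measure.restrict_apply_univ]; exact measure_Icc_lt_top⟩
  exact MemLp.of_bound
    (continuous_response hY hYc (intervalIntegrable_coe u)).aestronglyMeasurable _
    ((ae_restrict_iff' (measurableSet_window n)).2
      (Eventually.of_forall fun t ht => norm_response_window_le hYc u ht))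

lemma norm_sq_response_window_le (hYc : ∀ t, ‖Y t‖ ≤ c) (u : L2tx) (n : ℕ) (t : ℝ) :
    ‖(window n).indicator (response m Y K u) t‖ ^ 2 ≤ (window n).indicator (fun _ =>
      (2 * c ^ 2 * ‖K‖ * (√(volume.real (window n)) * ‖u‖)) ^ 2) t := by
  by_cases ht : t ∈ window n
  · simp only [ht, Set.indicator_of_mem]
    exact pow_le_pow_left₀ (norm_nonneg _) (norm_response_window_le hYc u ht) 2
  · simp [ht]

lemma response_coe_add (hY : Continuous Y) (hYc : ∀ t, ‖Y t‖ ≤ c) (u v : L2tx) (t : ℝ) :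
    response m Y K (u + v : L2tx) t = response m Y K u t + response m Y K v t := by
  rw [← response_add hY hYc (intervalIntegrable_coe u) (intervalIntegrable_coe v)]
  refine response_congr ?_
  filter_upwards [Lp.coeFn_add u v] with τ h _
  exact h

lemma response_coe_smul (a : ℝ) (u : L2tx) (t : ℝ) :
    response m Y K (a • u : L2tx) t = a • response m Y K u t := by
  rw [← response_smul]
  refine response_congr ?_
  filter_upwards [Lp.coeFn_smul a u] with τ h _
  exact h

/-- The response operator on the time window `[-n, n]`. -/
def windowResponse (m : ℝ) (K : L2 ℝ →L[ℝ] L2 ℝ) (hY : Continuous Y) (hYc : ∀ t, ‖Y t‖ ≤ c)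
    (n : ℕ) : L2tx →L[ℝ] L2tx :=
  timeOperator (fun u => (window n).indicator (response m Y K u))
    (fun u => memLp_response_window hY hYc u n)
    (fun u v => by
      rw [← Set.indicator_add', funext (response_coe_add hY hYc u v)]
      rfl)
    (fun a u => by
      refine Eventually.of_forall fun t => ?_
      by_cases ht : t ∈ window n <;> simp [ht, response_coe_smul])
    -- This constant grows with the window; uniformity in n is needed only for the inverses and
    -- comes from coercivity.
    (2 * c ^ 2 * ‖K‖ * volume.real (window n)) (fun u => by
      refine (integral_mono (memLp_response_window hY hYc u n).norm.integrable_sq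
        ((integrable_indicator_iff (measurableSet_window n)).2
          (integrableOn_const measure_Icc_lt_top.ne)) fun t =>
            norm_sq_response_window_le hYc u n t).trans (le_of_eq ?_)
      rw [integral_indicator (measurableSet_window n), setIntegral_const, smul_eq_mul, mul_pow,
        mul_pow _ ‖u‖, Real.sq_sqrt measureReal_nonneg]
      ring) (by positivity)

variable (hY : Continuous Y) (hYc : ∀ t, ‖Y t‖ ≤ c)

lemma coeFn_windowResponse (n : ℕ) (u : L2tx) : windowResponse m K hY hYc n u =ᵐ[volume]
    (window n).indicator (response m Y K u) :=
  coeFn_timeOperator _ _ _ _ _ _ u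

lemma truncate_windowResponse {n k : ℕ} (h : n ≤ k) (u : L2tx) :
    truncate (measurableSet_window n) (windowResponse m K hY hYc k u) =
      windowResponse m K hY hYc n u := by
  ext1
  filter_upwards [coeFn_truncate (measurableSet_window n) (windowResponse m K hY hYc k u),
    coeFn_windowResponse (m := m) (K := K) hY hYc k u,
    coeFn_windowResponse (m := m) (K := K) hY hYc n u] with t h1 h2 h3
  rw [h1, h3]
  by_cases ht : t ∈ window n
  · simp only [ht, Set.indicator_of_mem, h2, window_mono h ht]
  · simp only [ht, Set.indicator_of_notMem, not_false_eq_true]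

/-- For t in the window all times between 0 and t also lie in it, so causality makes the values
outside irrelevant. -/
lemma windowResponse_truncate (n : ℕ) (u : L2tx) :
    windowResponse m K hY hYc n (truncate (measurableSet_window n) u) =
      windowResponse m K hY hYc n u := by
  ext1
  filter_upwards [coeFn_windowResponse (m := m) (K := K) hY hYc n
    (truncate (measurableSet_window n) u), coeFn_windowResponse (m := m) (K := K) hY hYc n u]
    with t h1 h2
  rw [h1, h2]
  by_cases ht : t ∈ window n
  · simp only [ht, Set.indicator_of_mem]
    refine response_congr ?_
    filter_upwards [coeFn_truncate (measurableSet_window n) u] with τ h3 h4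
    rw [h3, Set.indicator_of_mem (uIoc_subset_window ht h4)]
  · simp only [ht, Set.indicator_of_notMem, not_false_eq_true]

/-- The linear response equation on all windows. -/
lemma forall_window_iff (u g : L2tx) :
    (∀ n, truncate (measurableSet_window n) u - windowResponse m K hY hYc n u =
      truncate (measurableSet_window n) g) ↔
    ∀ᵐ t : ℝ, u t - response m Y K u t = g t := by
  have h : ∀ n, truncate (measurableSet_window n) u - windowResponse m K hY hYc n u =
      truncate (measurableSet_window n) g ↔
      ∀ᵐ t : ℝ, t ∈ window n → u t - response m Y K u t = g t := fun n => by
    rw [Lp.ext_iff]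
    refine eventually_congr ?_
    filter_upwards [Lp.coeFn_sub (truncate (measurableSet_window n) u)
      (windowResponse m K hY hYc n u), coeFn_truncate (measurableSet_window n) u,
      coeFn_truncate (measurableSet_window n) g,
      coeFn_windowResponse (m := m) (K := K) hY hYc n u] with t h1 h2 h3 h4
    rw [h1, Pi.sub_apply, h2, h3, h4]
    by_cases ht : t ∈ window n <;> simp [ht]
  simp only [h]
  rw [← ae_all_iff]
  refine eventually_congr (Eventually.of_forall fun t => ⟨fun h => ?_, fun h _ _ => h⟩)
  obtain ⟨n, hn⟩ := exists_mem_window t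
  exact h n (hn n le_rfl)

end ResponseOperator

/-! ### Coercivity on every window -/

section Coercivity

/-- The amplitudes of a simple function in a time window. -/
def simpleAmplitude (n : ℕ) (S : SimpleFunc ℝ (L2 ℝ)) (t : ℝ) (η : R3) : ℂ :=
  (window n).indicator (fun _ => hat (S t) η) t

lemma isAmplitude_simpleAmplitude (n : ℕ) (S : SimpleFunc ℝ (L2 ℝ)) :
    IsAmplitude (window n) (fun η => ∑ v ∈ S.range, ‖hat v η‖ ^ 2) (simpleAmplitude n S) where
  measurableSet := measurableSet_window n
  measure_ne_top := measure_Icc_lt_top.ne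
  integrable := integrable_finsetSum _ fun v _ => (Lp.memLp (hat v)).norm.integrable_sq
  measurable := by
    have h1 : Measurable fun p : ℝ × R3 => hat (S p.1) p.2 :=
      (S.comp Prod.fst measurable_fst).measurable_bind (fun v p => hat v p.2) fun v =>
        (Lp.stronglyMeasurable (hat v)).measurable.comp measurable_snd
    have h2 : Function.uncurry (simpleAmplitude n S) =
        (Prod.fst ⁻¹' window n).indicator fun p : ℝ × R3 => hat (S p.1) p.2 := by
      ext ⟨t, η⟩
      by_cases ht : t ∈ window n <;> simp [Function.uncurry, simpleAmplitude, ht]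
    rw [h2]
    exact h1.indicator (measurable_fst (measurableSet_window n))
  bound t η := by
    by_cases ht : t ∈ window n
    · simp only [simpleAmplitude, ht, Set.indicator_of_mem, Pi.one_apply, one_mul]
      exact Finset.single_le_sum (f := fun v => ‖hat v η‖ ^ 2) (fun _ _ => sq_nonneg _)
        (SimpleFunc.mem_range_self S t)
    · simp [simpleAmplitude, ht]

variable {F : Type*} [NormedAddCommGroup F] [InnerProductSpace ℂ F] [CompleteSpace F]
variable {m : ℝ} {Y : ℝ → R3 →ᵇ F} {K : L2 ℝ →L[ℝ] L2 ℝ} {c M : ℝ} {κ : R3 → ℝ → ℝ}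
-- For t < 0 the oriented integral changes sign, and so does the odd kernel; both cases become one
-- integral with the kernel at |t − τ|.
lemma inner_response_eq_setIntegral (hY : Continuous Y) (hYc : ∀ t, ‖Y t‖ ≤ c)
    (hform : ∀ t τ v u, 2 * (inner ℂ (mulField v (Y t))
      (freeFlow m (t - τ) (mulField (K u) (Y τ)))).im = weightForm (fun η => κ η (t - τ)) v u)
    (hodd : ∀ η s, κ η (-s) = -κ η s) {u : ℝ → L2 ℝ}
    (hu : ∀ a b, IntervalIntegrable u volume a b) (v : L2 ℝ) (t : ℝ) :
    inner ℝ v (response m Y K u t) =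
      ∫ τ in Set.uIoc 0 t, weightForm (fun η => κ η |t - τ|) v (u τ) := by
  rw [inner_response hY hYc hu]
  simp only [hform]
  rcases le_total 0 t with ht | ht
  · rw [intervalIntegral.integral_of_le ht, Set.uIoc_of_le ht]
    refine setIntegral_congr_fun measurableSet_Ioc fun τ hτ => ?_
    simp only [abs_of_nonneg (sub_nonneg.2 hτ.2)]
  · rw [intervalIntegral.integral_of_ge ht, Set.uIoc_of_ge ht, ← integral_neg]
    refine setIntegral_congr_fun measurableSet_Ioc fun τ hτ => ?_
    simp only [abs_of_nonpos (sub_nonpos.2 hτ.1.le), hodd, weightForm, mul_neg, integral_neg]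

/-- Simple functions of time take finitely many values in L², which provides a jointly measurable
Fourier transform in (t, η) and an integrable majorant; both are needed for Fubini. -/
lemma inner_windowResponse_simple_le (hY : Continuous Y) (hYc : ∀ t, ‖Y t‖ ≤ c)
    (hform : ∀ t τ v u, 2 * (inner ℂ (mulField v (Y t))
      (freeFlow m (t - τ) (mulField (K u) (Y τ)))).im = weightForm (fun η => κ η (t - τ)) v u)
    (hodd : ∀ η s, κ η (-s) = -κ η s) (hκ : Measurable (Function.uncurry κ))
    (hM : ∀ η s, |κ η s| ≤ M) (hκ1 : ∀ η, η ≠ 0 → FormLE (κ η) 1) (n : ℕ) {u : L2tx}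
    {S : SimpleFunc ℝ (L2 ℝ)} (hS : S =ᵐ[volume] u) :
    inner ℝ u (windowResponse m K hY hYc n u) ≤ ‖u‖ ^ 2 / 2 := by
  have hb := isAmplitude_simpleAmplitude n S
  have h0 : ∀ η, κ η 0 = 0 := fun η => by
    have := hodd η 0
    rw [neg_zero] at this
    linarith
  have h1 : inner ℝ u (windowResponse m K hY hYc n u) =
      ∫ t, ∫ τ in Set.uIoc 0 t, pairIntegral κ (simpleAmplitude n S) (t, τ) := by
    rw [L2.inner_def]
    refine integral_congr_ae ?_
    filter_upwards [coeFn_windowResponse (m := m) (K := K) hY hYc n u, hS] with t e1 e2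
    rw [e1]
    by_cases ht : t ∈ window n
    · simp only [ht, Set.indicator_of_mem]
      rw [inner_response_eq_setIntegral hY hYc hform hodd (intervalIntegrable_coe u)]
      refine setIntegral_congr_ae measurableSet_uIoc ?_
      filter_upwards [hS] with τ e3 hτ
      rw [← e2, ← e3, weightForm, pairIntegral]
      refine integral_congr_ae (Eventually.of_forall fun η => ?_)
      simp only [simpleAmplitude, ht, uIoc_subset_window ht hτ, Set.indicator_of_mem]
      exact mul_comm _ _
    · simp [ht, pairIntegral, simpleAmplitude]
  have h2 : ∫ t, ∫ η, ‖simpleAmplitude n S t η‖ ^ 2 ≤ ‖u‖ ^ 2 := by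
    rw [← integral_norm_sq]
    refine integral_mono_ae hb.integrable_norm_sq.integral_prod_left
      (Lp.memLp u).norm.integrable_sq ?_
    filter_upwards [hS] with t e2
    rw [← e2]
    by_cases ht : t ∈ window n
    · simp only [simpleAmplitude, ht, Set.indicator_of_mem]
      rw [integral_norm_sq, norm_hat]
    · simp [simpleAmplitude, ht]
  rw [h1]
  have h3 := hb.integral_causal_le hκ hM hκ1 h0
  linarith

lemma inner_windowResponse_le (hY : Continuous Y) (hYc : ∀ t, ‖Y t‖ ≤ c)
    (hform : ∀ t τ v u, 2 * (inner ℂ (mulField v (Y t))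
      (freeFlow m (t - τ) (mulField (K u) (Y τ)))).im = weightForm (fun η => κ η (t - τ)) v u)
    (hodd : ∀ η s, κ η (-s) = -κ η s) (hκ : Measurable (Function.uncurry κ))
    (hM : ∀ η s, |κ η s| ≤ M) (hκ1 : ∀ η, η ≠ 0 → FormLE (κ η) 1) (n : ℕ) (u : L2tx) :
    inner ℝ u (windowResponse m K hY hYc n u) ≤ ‖u‖ ^ 2 / 2 := by
  have hd : DenseRange ((↑) : Lp.simpleFunc (L2 ℝ) 2 (volume : Measure ℝ) → L2tx) :=
    Lp.simpleFunc.denseRange ENNReal.ofNat_ne_top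
  -- The inequality is a closed condition on u because the truncated operator is bounded.
  refine hd.induction_on (p := fun u : L2tx =>
    inner ℝ u (windowResponse m K hY hYc n u) ≤ ‖u‖ ^ 2 / 2) u ?_ fun s => ?_
  · exact isClosed_le (continuous_id.inner (windowResponse m K hY hYc n).continuous)
      ((continuous_norm.pow 2).div_const 2)
  · exact inner_windowResponse_simple_le hY hYc hform hodd hκ hM hκ1 n
      (Lp.simpleFunc.toSimpleFunc_eq_toFun s)

/-- The response equation is boundedly solvable if the response kernel is bounded above as a
form. -/
theorem exists_inverse_response (hY : Continuous Y) (hYc : ∀ t, ‖Y t‖ ≤ c)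
    (hform : ∀ t τ v u, 2 * (inner ℂ (mulField v (Y t))
      (freeFlow m (t - τ) (mulField (K u) (Y τ)))).im = weightForm (fun η => κ η (t - τ)) v u)
    (hodd : ∀ η s, κ η (-s) = -κ η s) (hκ : Measurable (Function.uncurry κ))
    (hM : ∀ η s, |κ η s| ≤ M) (hκ1 : ∀ η, η ≠ 0 → FormLE (κ η) 1) :
    ∃ R : L2tx →L[ℝ] L2tx, ∀ u g : L2tx,
      (∀ᵐ t : ℝ, u t - response m Y K u t = g t) ↔ u = R g := by
  obtain ⟨R, hR⟩ := exists_inverse_of_causal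
    (P := fun n => truncate (measurableSet_window n)) (A := windowResponse m K hY hYc)
    (fun n k h u => truncate_truncate h u) (fun n u v => inner_truncate _ u v)
    tendsto_truncate_window (fun n k h u => truncate_windowResponse hY hYc h u)
    (windowResponse_truncate hY hYc) (inner_windowResponse_le hY hYc hform hodd hκ hM hκ1)
  exact ⟨R, fun u g => (forall_window_iff hY hYc u g).symm.trans (hR u g)⟩

end Coercivity

/-! ### The kernel with the potential and the choice of constants -/

section Fermi

/-- The kernel of the response of the Fermi sea at the frequency `η`. -/
def fermiKernel (w : SignedMeasure R3) (η : R3) (s : ℝ) : ℝ :=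
  -((fourierMeasure w ((2 * Real.pi) • η)).re * responseKernel (2 * Real.pi * ‖η‖) s)

lemma fermiKernel_neg (w : SignedMeasure R3) (η : R3) (s : ℝ) :
    fermiKernel w η (-s) = -fermiKernel w η s := by
  rw [fermiKernel, fermiKernel, responseKernel_neg]
  ring

lemma measurable_fermiKernel (w : SignedMeasure R3) :
    Measurable (Function.uncurry (fermiKernel w)) := by
  have h1 : Measurable fun p : R3 × ℝ => (fourierMeasure w ((2 * Real.pi) • p.1)).re :=
    Complex.measurable_re.comp ((measurable_fourierMeasure w).comp (by fun_prop))
  have h2 : Measurable fun p : R3 × ℝ => (2 * Real.pi * ‖p.1‖, p.2) := by fun_prop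
  have h3 := measurable_responseKernel.comp h2
  have h4 := (h1.mul h3).neg
  exact h4

lemma exists_abs_fermiKernel_le (w : SignedMeasure R3) : ∃ M, ∀ η s, |fermiKernel w η s| ≤ M := by
  obtain ⟨M, hM⟩ := exists_norm_fourierMeasure_le w
  refine ⟨M * (16 * Real.pi), fun η s => ?_⟩
  rw [fermiKernel, abs_neg, abs_mul]
  exact mul_le_mul ((Complex.abs_re_le_norm _).trans (hM _))
    (abs_responseKernel_le_of_nonneg (by positivity) s) (abs_nonneg _)
    ((norm_nonneg _).trans (hM 0))

variable {Ω : Type*} [MeasurableSpace Ω] {P : Measure Ω}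

lemma im_inner_mulField_convL (W : WienerIntegral P) {f : L2 ℂ}
    (hf : ∀ᵐ ξ : R3, ‖f ξ‖ ^ 2 = Set.indicator {ξ | ‖ξ‖ ≤ 1} 1 ξ) {w : SignedMeasure R3}
    (hw : ∀ ξ, (fourierMeasure w ξ).im = 0) (m t τ : ℝ) (v u : L2 ℝ) :
    2 * (inner ℂ (mulField v (steadyState W f m t))
      (freeFlow m (t - τ) (mulField (convL w u) (steadyState W f m τ)))).im =
      weightForm (fun η => fermiKernel w η (t - τ)) v u := by
  rw [im_inner_mulField_freeFlow W hf, weightForm_conv (measurable_responseKernel_norm (t - τ))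
    (abs_responseKernel_norm_le (t - τ)) hw]
  simp only [weightForm, fermiKernel, mul_neg, integral_neg]

/-- Smallness of the potential bounds the response kernel from above. -/
lemma formLE_fermiKernel {C D : ℝ} (hC : 0 < C) (hD : 0 < D)
    (hCk : ∀ r : ℝ, 0 < r → FormLE (responseKernel r) C)
    (hDk : ∀ r : ℝ, 0 < r → IntegrableOn (responseKernel r) (Set.Ioi 0) ∧
      ∫ s in Set.Ioi 0, |responseKernel r s| ≤ D * √(1 + Real.log r ^ 2)) {w : SignedMeasure R3}
    (hw : ∀ ξ : R3, ξ ≠ 0 → -(1 / C) ≤ (fourierMeasure w ξ).re ∧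
      (fourierMeasure w ξ).re ≤ 1 / (2 * D) / √(1 + (Real.log ‖ξ‖) ^ 2)) {η : R3} (hη : η ≠ 0) :
    FormLE (fermiKernel w η) 1 := by
  have hp := Real.pi_pos
  have hr : ‖(2 * Real.pi) • η‖ = 2 * Real.pi * ‖η‖ := by
    rw [norm_smul, Real.norm_of_nonneg (by positivity)]
  have hr0 : 0 < 2 * Real.pi * ‖η‖ := by
    have := norm_pos_iff.2 hη
    positivity
  obtain ⟨h1, h2⟩ := hw ((2 * Real.pi) • η) (smul_ne_zero (by positivity) hη)
  rw [hr] at h2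
  set a := (fourierMeasure w ((2 * Real.pi) • η)).re with ha
  set r := 2 * Real.pi * ‖η‖ with hrdef
  intro b hb hb2
  have hk : pairForm (fermiKernel w η) b = -a * pairForm (responseKernel r) b := by
    rw [← pairForm_const_mul]
    congr 1
    ext s
    rw [fermiKernel]
    ring
  have hN : 0 ≤ ∫ t, ‖b t‖ ^ 2 := integral_nonneg fun t => sq_nonneg _
  rw [hk, one_mul]
  -- For a ≤ 0 the one-sided bound C is multiplied by −a ≤ 1/C. For a ≥ 0 the lower bound of the
  -- form is needed, and the logarithm in Schur's bound cancels that in the bound of a.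
  rcases le_total a 0 with h | h
  · calc -a * pairForm (responseKernel r) b ≤ -a * (C * ∫ t, ‖b t‖ ^ 2) :=
          mul_le_mul_of_nonneg_left (hCk r hr0 b hb hb2) (by linarith)
      _ ≤ 1 / C * (C * ∫ t, ‖b t‖ ^ 2) :=
          mul_le_mul_of_nonneg_right (by linarith) (by positivity)
      _ = ∫ t, ‖b t‖ ^ 2 := by field_simp
  · obtain ⟨h3, h4⟩ := hDk r hr0
    have hm : Measurable (responseKernel r) := by
      have := measurable_responseKernel.comp (measurable_prodMk_left (x := r))
      exact this
    have h5 := abs_pairForm_le hm h3 hb2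
    have hL : 0 < √(1 + Real.log r ^ 2) := Real.sqrt_pos.2 (by positivity)
    calc -a * pairForm (responseKernel r) b ≤ a * |pairForm (responseKernel r) b| := by
          rw [neg_mul, ← mul_neg]
          exact mul_le_mul_of_nonneg_left (neg_le_abs _) h
      _ ≤ a * (2 * (D * √(1 + Real.log r ^ 2)) * ∫ t, ‖b t‖ ^ 2) := by
          refine mul_le_mul_of_nonneg_left (h5.trans ?_) h
          gcongr
      _ ≤ 1 / (2 * D) / √(1 + Real.log r ^ 2) *
          (2 * (D * √(1 + Real.log r ^ 2)) * ∫ t, ‖b t‖ ^ 2) :=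
          mul_le_mul_of_nonneg_right h2 (by positivity)
      _ = ∫ t, ‖b t‖ ^ 2 := by field_simp

end Fermi

end HartreeFermi

end

/-! ### The main theorem -/

theorem mainTheorem6 :
    ∃ δ : ℝ, 0 < δ ∧ ∃ δ₀ : ℝ, 0 < δ₀ ∧
      ∀ (f : HartreeFermi.L2 ℂ) (w : SignedMeasure HartreeFermi.R3),
        (∀ᵐ ξ : HartreeFermi.R3, ‖f ξ‖ ^ 2 = Set.indicator {ξ | ‖ξ‖ ≤ 1} 1 ξ) →
        (∀ ξ : HartreeFermi.R3, (HartreeFermi.fourierMeasure w ξ).im = 0) →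
        (∀ ξ : HartreeFermi.R3, ξ ≠ 0 →
          -δ ≤ (HartreeFermi.fourierMeasure w ξ).re ∧
            (HartreeFermi.fourierMeasure w ξ).re ≤ δ₀ / √(1 + (Real.log ‖ξ‖) ^ 2)) →
        ∀ {Ω : Type*} [MeasurableSpace Ω] (P : Measure Ω) [IsProbabilityMeasure P]
          (W : HartreeFermi.WienerIntegral P),
          HartreeFermi.OneSubHasBoundedInverse (HartreeFermi.linearResponse W f w) := by
  obtain ⟨C, hC, hCk⟩ := HartreeFermi.exists_formLE_responseKernel
  obtain ⟨D, hD, hDk⟩ := HartreeFermi.exists_integral_abs_responseKernel_le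
  -- The constants bring the form bound to exactly 1 for either sign of ŵ; the 2 in 1/(2D) offsets
  -- the factor 2 of Schur's test.
  refine ⟨1 / C, by positivity, 1 / (2 * D), by positivity, fun f w hf him hw Ω _ P _ W => ?_⟩
  obtain ⟨M, hM⟩ := HartreeFermi.exists_abs_fermiKernel_le w
  obtain ⟨R, hR⟩ := HartreeFermi.exists_inverse_response
    (HartreeFermi.continuous_steadyState W f (HartreeFermi.mass f w))
    (HartreeFermi.norm_steadyState_le W f (HartreeFermi.mass f w))
    (HartreeFermi.im_inner_mulField_convL W hf him (HartreeFermi.mass f w))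
    (HartreeFermi.fermiKernel_neg w) (HartreeFermi.measurable_fermiKernel w) hM
    (fun η hη => HartreeFermi.formLE_fermiKernel hC hD hCk hDk hw hη)
  -- At a fixed time the equation for almost every x is an equality in L²(ℝ³), because the pointwise
  -- response agrees almost everywhere with the L²-valued one.
  refine ⟨R, fun u g => Iff.trans (eventually_congr (Eventually.of_forall fun t => ?_)) (hR u g)⟩
  rw [Lp.ext_iff]
  refine eventually_congr ?_
  filter_upwards [HartreeFermi.linearResponse_ae_eq W f w u t,
    Lp.coeFn_sub (u t) (HartreeFermi.response (HartreeFermi.mass f w)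
      (HartreeFermi.steadyState W f (HartreeFermi.mass f w)) (HartreeFermi.convL w) u t)]
    with x h1 h2
  rw [h2, Pi.sub_apply, h1]
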